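/- Let $n,k\ge 1$, let $\mathcal N$ be a smooth manifold of dimension $n+k$ and $\omega$ a smooth, closed, nowhere vanishing $n$-form on $\mathcal N$. Let $D^\omega_q\mathcal N$ be the set of decomposable $z\in\Lambda^nT_q\mathcal N$ with $\langle z,\omega_q\rangle=1$; it is identified with the set $Gr^\omega_q\mathcal N$ of oriented $n$-planes in $T_q\mathcal N$ on which $\omega$ is positive. Let $L:D^\omega\mathcal N\to\mathbb R$ be smooth, and for $q\in\mathcal N$, $z\in D^\omega_q\mathcal N$, $p\in\Lambda^nT^*_q\mathcal N$ put $$W(q,z,p)=\langle z,p\rangle-L(q,z),\quad P_q(z)=\{p:\ \tfrac{\partial W}{\partial z}(q,z,p)=0\},\quad Z_q(p)=\{z\in D^\omega_q\mathcal N:\ p\in P_q(z)\},$$ where $\partial W/\partial z$ is the differential of $W(q,\cdot,p)$ on $T_zD^\omega_q\mathcal N$. Legendre Correspondence Hypothesis. $\mathcal M\subset\Lambda^nT^*\mathcal N$ is a smooth submanifold fibred over $\mathcal N$, whose fibres $\mathcal M_q\subset\Lambda^nT^*_q\mathcal N$ are submanifolds, possibly with boundary, of a fixed dimension $\ge1$,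 such that for every $(q,p)\in\mathcal M$: - $Z_q(p)$ is a non-empty connected smooth submanifold of $D^\omega_q\mathcal N$; - for every $z_0\in Z_q(p)$, $Z_q(p)=\{z\in D^\omega_q\mathcal N:\ \langle z-z_0,\dot p\rangle=0\ \ \forall \dot p\in T_p\mathcal M_q\}$; - $Z_q(p)$ depends smoothly on $(q,p)$: for every $z_0\in Z_q(p)$ there is a smooth map $(q',p')\mapsto\zeta(q',p')\in Z_{q'}(p')$, defined on a neighbourhood of $(q,p)$ in $\mathcal M$, with $\zeta(q,p)=z_0$. Then $W(q,\cdot,p)$ is constant on $Z_q(p)$ for $(q,p)\in\mathcal M$, and one sets $\mathcal H(q,p)=W(q,z,p)$ for $z\in Z_q(p)$. Let $\Pi:\Lambda^nT^*\mathcal N\to\mathcal N$ be the projection, write $\omega$ also for $\Pi^*\omega$, and let $\theta_{(q,p)}(X_1,\dots,X_n)=p(\Pi_*X_1,\dots,\Pi_*X_n)$. Submanifolds are immersed (in particular they may be embedded), and are given by parametrizations $X\to\mathcal N$ or $X\to\mathcal M$ by $n$-dimensional manifolds $X$. Let $\mathcal G^\omega$ (resp. $\widehat{\mathcal G}^\omega$)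 be the set of oriented $n$-dimensional submanifolds $G$ of $\mathcal N$ (resp. $\Gamma$ of $\mathcal M$) with $\omega|_G>0$ (resp. $\omega|_\Gamma>0$). A Legendre lift of $G\in\mathcal G^\omega$ is a $\Gamma\in\widehat{\mathcal G}^\omega$ with $\Pi(\Gamma)=G$ (as parametrized submanifolds) and $p\in P_q(T_qG)$ at every $(q,p)\in\Gamma$. Put $$\mathcal L[G]=\int_G L(q,T_qG)\,\omega,\qquad \mathcal I[\Gamma]=\int_\Gamma\theta-\mathcal H\,\omega .$$ A submanifold is a critical point of $\mathcal L$ (resp. $\mathcal I$) if, for every compact $K\subset X$ and every smooth family $(\sigma_s)_{s\ge0}$ of maps $X\to\mathcal N$ (resp. $X\to\mathcal M$) which starts at its parametrization and is constant in $s$ outside $K$, the derivative at $s=0^+$ of the part of the functional over $K$ vanishes. Theorem. Assume the Legendre Correspondence Hypothesis. (i) For any $G\in\mathcal G^\omega$ and any Legendre lift $\Gamma$ of $G$, $G$ is a critical point of $\mathcal L$ if and only if $\Gamma$ is a critical point of $\mathcal I$. (ii) For any $\Gamma\in\widehat{\mathcal G}^\omega$, if $\Gamma$ is a critical point of $\mathcal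 I$, then $\Pi(\Gamma)\in\mathcal G^\omega$, $\Gamma$ is a Legendre lift of $\Pi(\Gamma)$, and $\Pi(\Gamma)$ is a critical point of $\mathcal L$. -/

import Mathlib

open scoped Manifold ContDiff Topology Bundle
open Bundle Set

noncomputable section

namespace LepageDedecker

/-! ### Forms, multivectors and the bundles `ΛⁿT*N`, `ΛⁿTN` -/

section Bundles

variable (n k : ℕ) (N : Type*) [TopologicalSpace N]
  [ChartedSpace (EuclideanSpace ℝ (Fin (n + k))) N] [IsManifold (𝓡 (n + k)) ∞ N]

/-- The fibre `ΛⁿT*_q N`: alternating `n`-forms on the tangent space at `q`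
(`Bundle.Trivial N ℝ q` is `ℝ`). -/
abbrev FormFiber (q : N) : Type :=
  TangentSpace (𝓡 (n + k)) q [⋀^Fin n]→L[ℝ] Bundle.Trivial N ℝ q

/-- The model fibre of `ΛⁿT*N`. -/
abbrev FormModel : Type := EuclideanSpace ℝ (Fin (n + k)) [⋀^Fin n]→L[ℝ] ℝ

/-- The manifold `ΛⁿT*N`. A point is `μ = ⟨q, p⟩`, and `μ.proj = q` is the bundle projection `Π`. -/
abbrev FormBundle : Type _ := TotalSpace (FormModel n k) (FormFiber n k N)

/-- The fibre `ΛⁿT_q N` of `n`-vectors, as the dual space of `ΛⁿT*_q N` (everything is finite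
dimensional). The pairing `⟨z, p⟩` is `z p`. -/
abbrev MultiVecFiber (q : N) : Type := FormFiber n k N q →L[ℝ] Bundle.Trivial N ℝ q

/-- The model fibre of `ΛⁿTN`. -/
abbrev MultiVecModel : Type := FormModel n k →L[ℝ] ℝ

/-- The manifold `ΛⁿTN`. -/
abbrev MultiVecBundle : Type _ := TotalSpace (MultiVecModel n k) (MultiVecFiber n k N)

/-- The model with corners of the manifold `ΛⁿT*N`. -/
abbrev formI := (𝓡 (n + k)).prod 𝓘(ℝ, FormModel n k)

/-- The model with corners of the manifold `ΛⁿTN`. -/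
abbrev multiVecI := (𝓡 (n + k)).prod 𝓘(ℝ, MultiVecModel n k)

variable {n k N}

/-- The decomposable `n`-vector `v₁ ∧ ⋯ ∧ vₙ`, that is `p ↦ p (v₁, …, vₙ)`. -/
def wedge {q : N} (v : Fin n → TangentSpace (𝓡 (n + k)) q) : MultiVecFiber n k N q :=
  ContinuousAlternatingMap.apply ℝ (TangentSpace (𝓡 (n + k)) q) (Bundle.Trivial N ℝ q) v

end Bundles

/-! ### Differential forms on manifolds and their integrals -/

section Forms

variable {n : ℕ}

variable {E₁ H₁ X₁ : Type*} [NormedAddCommGroup E₁] [NormedSpace ℝ E₁] [TopologicalSpace H₁]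
  (I₁ : ModelWithCorners ℝ E₁ H₁) [TopologicalSpace X₁] [ChartedSpace H₁ X₁]
  {E₂ H₂ X₂ : Type*} [NormedAddCommGroup E₂] [NormedSpace ℝ E₂] [TopologicalSpace H₂]
  (I₂ : ModelWithCorners ℝ E₂ H₂) [TopologicalSpace X₂] [ChartedSpace H₂ X₂]

/-- The pull-back `f^*η` of an `n`-form `η` by a map `f`. -/
def pullbackForm (f : X₁ → X₂) (η : ∀ y : X₂, TangentSpace I₂ y [⋀^Fin n]→L[ℝ] ℝ) (x : X₁) :
    TangentSpace I₁ x [⋀^Fin n]→L[ℝ] ℝ :=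
  (η (f x)).compContinuousLinearMap (mfderiv I₁ I₂ f x)

variable {X : Type*} [TopologicalSpace X] [ChartedSpace (EuclideanSpace ℝ (Fin n)) X]

/-- The standard basis of `T_xX` (in the preferred chart at `x`). -/
def stdFrame (x : X) (i : Fin n) : TangentSpace (𝓡 n) x :=
  (EuclideanSpace.single i (1 : ℝ) : EuclideanSpace ℝ (Fin n))

/-- The coefficient of the `n`-form `η` in the chart at `c`: there,
`η = (formCoeff η c) dy¹ ∧ ⋯ ∧ dyⁿ`. -/
def formCoeff (η : ∀ x : X, TangentSpace (𝓡 n) x [⋀^Fin n]→L[ℝ] ℝ) (c : X)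
    (y : EuclideanSpace ℝ (Fin n)) : ℝ :=
  pullbackForm 𝓘(ℝ, EuclideanSpace ℝ (Fin n)) (𝓡 n) (extChartAt (𝓡 n) c).symm η y
    (fun i => (EuclideanSpace.single i (1 : ℝ) : EuclideanSpace ℝ (Fin n)))

variable [IsManifold (𝓡 n) ∞ X] [T2Space X] [SigmaCompactSpace X]

variable (n X) in
/-- A smooth partition of unity on `X` subordinate to the cover by chart domains. -/
def chartPartition : SmoothPartitionOfUnity X (𝓡 n) X univ :=
  (SmoothPartitionOfUnity.exists_isSubordinate_chartAt_source (I := 𝓡 n) X).choose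

/-- The integral over `K ⊆ X` of the `n`-form `η`, where the `n`-manifold `X` is oriented by
the nowhere vanishing `n`-form `ν`: the sum over the charts `c` of the integrals of `ρ_c η`
in the chart `c`, where `(ρ_c)` is a partition of unity. (For compact `K` the sum is finite.) -/
def formIntegral (ν η : ∀ x : X, TangentSpace (𝓡 n) x [⋀^Fin n]→L[ℝ] ℝ) (K : Set X) : ℝ :=
  ∑ᶠ c : X, ∫ y in (extChartAt (𝓡 n) c).target ∩ (extChartAt (𝓡 n) c).symm ⁻¹' K,
    chartPartition n X c ((extChartAt (𝓡 n) c).symm y) *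
      (Real.sign (formCoeff ν c y) * formCoeff η c y)

end Forms

/-! ### The Lagrangian side -/

section Lagrangian

variable {n k : ℕ} {N : Type*} [TopologicalSpace N]
  [ChartedSpace (EuclideanSpace ℝ (Fin (n + k))) N] [IsManifold (𝓡 (n + k)) ∞ N]

/-- `ω` is a smooth, closed, nowhere vanishing `n`-form on `N`. -/
structure IsSpaceTimeVolume (vol : ∀ q : N, FormFiber n k N q) : Prop where
  smooth : ContMDiff (𝓡 (n + k)) (formI n k) ∞ (fun q => (⟨q, vol q⟩ : FormBundle n k N))
  closed : ∀ c : N, ∀ y ∈ (extChartAt (𝓡 (n + k)) c).target,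
    extDeriv (fun y : EuclideanSpace ℝ (Fin (n + k)) =>
      (pullbackForm 𝓘(ℝ, EuclideanSpace ℝ (Fin (n + k))) (𝓡 (n + k))
        (extChartAt (𝓡 (n + k)) c).symm vol y : FormModel n k)) y = 0
  ne_zero : ∀ q, vol q ≠ 0

/-- `D^ω_q N`: decomposable `n`-vectors `z` at `q` with `ω(z) = 1`. It is identified with the set
`Gr^ω_q N` of oriented `n`-planes on which `ω` is positive. -/
def DOmega (vol : ∀ q : N, FormFiber n k N q) (q : N) : Set (MultiVecFiber n k N q) :=
  {z | (∃ v, z = wedge v) ∧ z (vol q) = 1}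

/-- The total space `D^ω N ≃ Gr^ω N`, as a subset of `ΛⁿTN`. -/
def DOmegaTotal (vol : ∀ q : N, FormFiber n k N q) : Set (MultiVecBundle n k N) :=
  {ζ | ζ.2 ∈ DOmega vol ζ.proj}

/-- `L` is a Lagrangian density: a smooth function on `Gr^ω N ≃ D^ω N`
(its values elsewhere play no role). -/
def IsLagrangian (vol : ∀ q : N, FormFiber n k N q) (L : MultiVecBundle n k N → ℝ) : Prop :=
  ContMDiffOn (multiVecI n k) 𝓘(ℝ, ℝ) ∞ L (DOmegaTotal vol)

variable {X : Type*} [TopologicalSpace X] [ChartedSpace (EuclideanSpace ℝ (Fin n)) X]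

/-- `g : X → N` is (the parametrization of) an element of `𝒢^ω`: an immersed `n`-dimensional
submanifold on which `ω` vanishes nowhere, oriented in such a way that `ω > 0` on it.
(That `g` is an immersion follows from `g^*ω ≠ 0`.) -/
structure IsOmegaSubmanifold (vol : ∀ q : N, FormFiber n k N q) (g : X → N) : Prop where
  smooth : ContMDiff (𝓡 n) (𝓡 (n + k)) ∞ g
  pos : ∀ x, pullbackForm (𝓡 n) (𝓡 (n + k)) g vol x ≠ 0

/-- The unique element of `D^ω N` which spans the tangent plane of `g` at `g x`. -/
def tangentMultiVec (vol : ∀ q : N, FormFiber n k N q) (g : X → N) (x : X) :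
    MultiVecFiber n k N (g x) :=
  (pullbackForm (𝓡 n) (𝓡 (n + k)) g vol x (stdFrame x))⁻¹ •
    wedge (fun i => mfderiv (𝓡 n) (𝓡 (n + k)) g x (stdFrame x i))

variable [IsManifold (𝓡 n) ∞ X] [T2Space X] [SigmaCompactSpace X]

/-- `𝓛_K[G] = ∫_{G ∩ K} L(q, T_qG) ω`, for the submanifold `G` parametrized by `g`. -/
def lagrangianAction (vol : ∀ q : N, FormFiber n k N q) (L : MultiVecBundle n k N → ℝ)
    (K : Set X) (g : X → N) : ℝ :=
  formIntegral (pullbackForm (𝓡 n) (𝓡 (n + k)) g vol)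
    (fun x => L ⟨g x, tangentMultiVec vol g x⟩ • pullbackForm (𝓡 n) (𝓡 (n + k)) g vol x) K

end Lagrangian

/-! ### Critical points -/

section Critical

variable (n : ℕ) {X : Type*} [TopologicalSpace X] [ChartedSpace (EuclideanSpace ℝ (Fin n)) X]
  {E H B : Type*} [NormedAddCommGroup E] [NormedSpace ℝ E] [TopologicalSpace H]
  (J : ModelWithCorners ℝ E H) [TopologicalSpace B] [ChartedSpace H B]

/-- `σ` is a smooth variation of `f` inside `S ⊆ B` supported in `K`. The parameter `s` runs
through `[0, ∞)`, so that submanifolds which meet the boundary of `S` may be pushed inwards. -/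
structure IsVariation (S : Set B) (K : Set X) (f : X → B) (σ : ℝ → X → B) : Prop where
  smooth : ContMDiffOn (𝓘(ℝ, ℝ).prod (𝓡 n)) J ∞ (fun a : ℝ × X => σ a.1 a.2) (Ici 0 ×ˢ univ)
  init : σ 0 = f
  mem : ∀ s, 0 ≤ s → ∀ x, σ s x ∈ S
  support : ∀ s, 0 ≤ s → ∀ x, x ∉ K → σ s x = f x

/-- `f` is a critical point, among maps into `S`, of the functional `A` (where `A K` is the
part of the functional over `K`): for any compact `K`, the derivative at `s = 0` of `A K` vanishes
along any variation supported in `K`. -/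
def IsCriticalPoint (S : Set B) (A : Set X → (X → B) → ℝ) (f : X → B) : Prop :=
  ∀ K : Set X, IsCompact K → ∀ σ : ℝ → X → B, IsVariation n J S K f σ →
    HasDerivWithinAt (fun s => A K (σ s)) 0 (Ici 0) 0

end Critical

/-! ### The Legendre correspondence -/

section Legendre

variable {n k : ℕ} {N : Type*} [TopologicalSpace N]
  [ChartedSpace (EuclideanSpace ℝ (Fin (n + k))) N] [IsManifold (𝓡 (n + k)) ∞ N]

/-- `W(q, z, p) = ⟨z, p⟩ - L(q, z)`. -/
def pontryaginW (L : MultiVecBundle n k N → ℝ) (q : N) (z : MultiVecFiber n k N q)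
    (p : FormFiber n k N q) : ℝ :=
  z p - L ⟨q, z⟩

/-- `∂W/∂z (q, z, p) = 0`: the differential of `W(q, ·, p)` vanishes on `T_z D^ω_q N`, whose
elements are the velocities at `0` of the smooth curves in `D^ω_q N` through `z`. -/
def IsStationary (vol : ∀ q : N, FormFiber n k N q) (L : MultiVecBundle n k N → ℝ) (q : N)
    (z : MultiVecFiber n k N q) (p : FormFiber n k N q) : Prop :=
  ∀ c : ℝ → MultiVecFiber n k N q,
    ContMDiff 𝓘(ℝ, ℝ) (multiVecI n k) ∞ (fun t => (⟨q, c t⟩ : MultiVecBundle n k N)) →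
    (∀ t, c t ∈ DOmega vol q) → c 0 = z →
    HasDerivAt (fun t => pontryaginW L q (c t) p) 0 0

/-- The enlarged pseudofibre `P_q(z)`. -/
def pseudofibre (vol : ∀ q : N, FormFiber n k N q) (L : MultiVecBundle n k N → ℝ) (q : N)
    (z : MultiVecFiber n k N q) : Set (FormFiber n k N q) :=
  {p | IsStationary vol L q z p}

/-- `Z_q(p)`: the set of `z ∈ D^ω_q N` with `p ∈ P_q(z)`. -/
def legendreZ (vol : ∀ q : N, FormFiber n k N q) (L : MultiVecBundle n k N → ℝ) (q : N)
    (p : FormFiber n k N q) : Set (MultiVecFiber n k N q) :=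
  {z | z ∈ DOmega vol q ∧ p ∈ pseudofibre vol L q z}

/-- `S` is a smooth (embedded) submanifold of the vector space `F`. -/
def IsSmoothSubmanifold {F : Type*} [NormedAddCommGroup F] [NormedSpace ℝ F] (S : Set F) : Prop :=
  ∀ z ∈ S, ∃ (Φ : OpenPartialHomeomorph F F) (V : Submodule ℝ F), z ∈ Φ.source ∧
    ContDiffOn ℝ ∞ Φ Φ.source ∧ ContDiffOn ℝ ∞ Φ.symm Φ.target ∧
    ∀ w ∈ Φ.source, (w ∈ S ↔ Φ w ∈ V)

/-- The linear isomorphism of `ΛⁿT_q N` with the model fibre given by the preferred chart at `q`. -/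
def fibreCoord {q : N} (z : MultiVecFiber n k N q) : MultiVecModel n k :=
  (trivializationAt (MultiVecModel n k) (MultiVecFiber n k N) q ⟨q, z⟩).2

/-- `M ⊆ ΛⁿT*N` is a smooth submanifold fibred over `N`, with fibres of dimension `m` possibly with
boundary: near each of its points there are coordinates of `ΛⁿT*N` over `N` in which all fibres
become the same `m`-dimensional subspace `V`, or a half-space `{w ∈ V | 0 ≤ ℓ w}` of it
(interior points of the fibres are covered by `ℓ = 0`). -/
def IsFibredSubmanifold (m : ℕ) (M : Set (FormBundle n k N)) : Prop :=
  ∀ μ ∈ M, ∃ (Φ : OpenPartialHomeomorph (FormBundle n k N) (N × FormModel n k))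
    (V : Submodule ℝ (FormModel n k)) (ℓ : FormModel n k →L[ℝ] ℝ),
    μ ∈ Φ.source ∧ Module.finrank ℝ V = m ∧
    ContMDiffOn (formI n k) (formI n k) ∞ Φ Φ.source ∧
    ContMDiffOn (formI n k) (formI n k) ∞ Φ.symm Φ.target ∧
    ∀ μ' ∈ Φ.source, (Φ μ').1 = μ'.proj ∧ (μ' ∈ M ↔ (Φ μ').2 ∈ V ∧ 0 ≤ ℓ (Φ μ').2)

/-- `T_pM_q`, the tangent space at `p` of the fibre `M_q`, for `μ = (q, p)`. At a boundary point the
tangent cone is a half-space (or its union with the opposite one), hence the span. -/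
def fibreTangent (M : Set (FormBundle n k N)) (μ : FormBundle n k N) :
    Submodule ℝ (FormFiber n k N μ.proj) :=
  Submodule.span ℝ
    (tangentConeAt ℝ {p : FormFiber n k N μ.proj | (⟨μ.proj, p⟩ : FormBundle n k N) ∈ M} μ.2)

/-- The Legendre Correspondence Hypothesis for `M`. -/
structure LegendreCorrespondenceHypothesis (vol : ∀ q : N, FormFiber n k N q)
    (L : MultiVecBundle n k N → ℝ) (M : Set (FormBundle n k N)) : Prop where
  /-- `M` is fibred over `N`, with fibres of positive dimension. -/
  fibred : ∃ m : ℕ, 1 ≤ m ∧ IsFibredSubmanifold m M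
  /-- `Z_q(p)` is non-empty and connected. -/
  connected : ∀ μ ∈ M, IsConnected (legendreZ vol L μ.proj μ.2)
  /-- `Z_q(p)` is a smooth submanifold of `D^ω_q N`. -/
  submanifold : ∀ μ ∈ M, IsSmoothSubmanifold (fibreCoord '' legendreZ vol L μ.proj μ.2)
  /-- `Z_q(p)` is cut out in `D^ω_q N` by the orthogonality to `T_pM_q`. -/
  orthogonal : ∀ μ ∈ M, ∀ z₀ ∈ legendreZ vol L μ.proj μ.2,
    legendreZ vol L μ.proj μ.2 =
      {z | z ∈ DOmega vol μ.proj ∧ ∀ p' ∈ fibreTangent M μ, (z - z₀) p' = 0}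
  /-- `Z_q(p)` depends smoothly on `(q, p)`: through each of its points there passes a local smooth
  section `(q, p) ↦ ζ(q, p) ∈ Z_q(p)` over `M`. -/
  smooth_dependence : ∀ μ₀ ∈ M, ∀ z₀ ∈ legendreZ vol L μ₀.proj μ₀.2,
    ∃ U ∈ 𝓝 μ₀, ∃ ζ : ∀ μ : FormBundle n k N, MultiVecFiber n k N μ.proj, ζ μ₀ = z₀ ∧
      (∀ μ ∈ M ∩ U, ζ μ ∈ legendreZ vol L μ.proj μ.2) ∧
      ContMDiffOn (formI n k) (multiVecI n k) ∞
        (fun μ => (⟨μ.proj, ζ μ⟩ : MultiVecBundle n k N)) (M ∩ U)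

open Classical in
/-- The Hamiltonian `ℋ(q, p) = W(q, z, p)` for any `z ∈ Z_q(p)`. -/
def hamiltonian (vol : ∀ q : N, FormFiber n k N q) (L : MultiVecBundle n k N → ℝ)
    (μ : FormBundle n k N) : ℝ :=
  if h : (legendreZ vol L μ.proj μ.2).Nonempty then pontryaginW L μ.proj h.some μ.2 else 0

/-- The Poincaré–Cartan form `θ` on `ΛⁿT*N`: `θ_{(q,p)}(X₁, …, Xₙ) = p(Π_*X₁, …, Π_*Xₙ)`. -/
def poincareCartan (μ : FormBundle n k N) : TangentSpace (formI n k) μ [⋀^Fin n]→L[ℝ] ℝ :=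
  ContinuousAlternatingMap.compContinuousLinearMap (N := ℝ) μ.2
    (mfderiv (formI n k) (𝓡 (n + k)) (fun μ : FormBundle n k N => μ.proj) μ)

/-- The form `Π^*ω` on `ΛⁿT*N`. -/
def liftedVolume (vol : ∀ q : N, FormFiber n k N q) (μ : FormBundle n k N) :
    TangentSpace (formI n k) μ [⋀^Fin n]→L[ℝ] ℝ :=
  pullbackForm (formI n k) (𝓡 (n + k)) (fun μ : FormBundle n k N => μ.proj) vol μ

variable {X : Type*} [TopologicalSpace X] [ChartedSpace (EuclideanSpace ℝ (Fin n)) X]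

/-- `γ : X → ΛⁿT*N` is (the parametrization of) an element of `𝒢̂^ω`: an immersed `n`-dimensional
submanifold of `M` on which `ω ≃ Π^*ω` vanishes nowhere, oriented in such a way that `ω > 0`. -/
structure IsOmegaSubmanifoldLift (vol : ∀ q : N, FormFiber n k N q) (M : Set (FormBundle n k N))
    (γ : X → FormBundle n k N) : Prop where
  smooth : ContMDiff (𝓡 n) (formI n k) ∞ γ
  mem : ∀ x, γ x ∈ M
  pos : ∀ x, pullbackForm (𝓡 n) (formI n k) γ (liftedVolume vol) x ≠ 0

/-- `γ` is a Legendre lift in `M` of the submanifold `g : X → N`: it is an element of `𝒢̂^ω` that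
projects to `g` and satisfies `p ∈ P_q(T_qG)` at each of its points `(q, p)`. -/
structure IsLegendreLift (vol : ∀ q : N, FormFiber n k N q) (L : MultiVecBundle n k N → ℝ)
    (M : Set (FormBundle n k N)) (g : X → N) (γ : X → FormBundle n k N) : Prop where
  lift : IsOmegaSubmanifoldLift vol M γ
  proj_eq : ∀ x, (γ x).proj = g x
  contact : ∀ x, (γ x).2 ∈ pseudofibre vol L (γ x).proj
    (tangentMultiVec vol (fun x => (γ x).proj) x)

variable [IsManifold (𝓡 n) ∞ X] [T2Space X] [SigmaCompactSpace X]

/-- `𝓘_K[Γ] = ∫_{Γ ∩ K} θ - ℋω`, for the submanifold `Γ` parametrized by `γ`. -/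
def hamiltonianAction (vol : ∀ q : N, FormFiber n k N q) (L : MultiVecBundle n k N → ℝ)
    (K : Set X) (γ : X → FormBundle n k N) : ℝ :=
  formIntegral (pullbackForm (𝓡 n) (formI n k) γ (liftedVolume vol))
    (pullbackForm (𝓡 n) (formI n k) γ
      (fun μ => poincareCartan μ - hamiltonian vol L μ • liftedVolume vol μ)) K

end Legendre

end LepageDedecker

end

set_option linter.unusedSectionVars false
open scoped Manifold ContDiff Topology Bundle
open Bundle Set
noncomputable section
namespace LepageDedecker

/-! ### Alternating forms on finite-dimensional spaces -/

section Alternating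

variable {ι E F : Type*} [Fintype ι] [NormedAddCommGroup E] [NormedSpace ℝ E]
  [NormedAddCommGroup F] [NormedSpace ℝ F]

/-! Let `z` be the multivector of the tangent plane of `G`, normalized by `ω(z) = 1`. On a
submanifold of `M` over `G` the pull-back of `θ` is `⟨z, p⟩ ω`, so the two actions differ by the
integral of `W(q, z, p) - ℋ(q, p)` against `ω`. For a Legendre lift this density is zero, and it
stays zero to first order along every variation in `M`. Indeed, a local smooth section `ζ(q, p) ∈
Z_q(p)` through the initial `z` turns it into `W(q, z, p) - W(q, ζ, p)`. The two terms agree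
initially, their variations in `q` and `p` cancel, and what remains is a derivative of `W` along
`D^ω`, which vanishes by stationarity (`hasDerivWithinAt_pontryaginW_sub`). The same argument along
paths in the connected set `Z_q(p)` shows that `W` is constant there
(`pontryaginW_eq_of_mem_legendreZ`). First-order estimates that are uniform on compact sets carry
the pointwise statement to the integrals
(`hasDerivWithinAt_hamiltonianAction_sub_lagrangianAction`).

For (i) it remains to match variations. Those of `Γ` project to variations of `G`. Those of `G` lift
because `M` is fibred: fibre coordinates are kept while the base point moves, one fibred chart at a
time, following a partition of unity (`IsVariation.exists_lift`).

For (ii), vary `Γ` vertically, over a fixed base. The first variation of the density is `⟨z - ζ₀,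
p'⟩`, where `ζ₀ ∈ Z_q(p)` is arbitrary and `p'` is the velocity. Localized by a bump function, it
must vanish at every point (`IsPartialLift.vertical_deriv_eq_zero`). So `z - ζ₀` annihilates
`T_pM_q`, and the orthogonality clause of the hypothesis puts `z` in `Z_q(p)`
(`IsCriticalPoint.isLegendreLift`). Then (i) applies.

Two devices recur. `D^ω N` is never made into a manifold: a smooth local retraction onto it
(`exists_decomposable_retraction`) extends `L` to open sets. And since fibres of `M` may have a
boundary, time runs through `[0, ∞)` and vertical directions point inwards. -/

/-- Evaluation of alternating maps on the tuples of basis vectors. -/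
def basisEval (ι E F : Type*) [Fintype ι] [NormedAddCommGroup E] [NormedSpace ℝ E]
    [NormedAddCommGroup F] [NormedSpace ℝ F] [FiniteDimensional ℝ E] :
    (E [⋀^ι]→L[ℝ] F) →ₗ[ℝ] ((ι → Fin (Module.finrank ℝ E)) → F) where
  toFun f a := f fun i => Module.finBasis ℝ E (a i)
  map_add' _ _ := rfl
  map_smul' _ _ := rfl

theorem basisEval_injective [FiniteDimensional ℝ E] : Function.Injective (basisEval ι E F) := by
  intro f g h
  apply ContinuousAlternatingMap.toAlternatingMap_injective
  refine Module.Basis.ext_alternating (Module.finBasis ℝ E) fun v _ => ?_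
  exact congrFun h v

instance finiteDimensional_continuousAlternatingMap [FiniteDimensional ℝ E]
    [FiniteDimensional ℝ F] : FiniteDimensional ℝ (E [⋀^ι]→L[ℝ] F) :=
  Module.Finite.of_injective (basisEval ι E F) basisEval_injective

/-- `basisEval` has a linear left inverse, continuous in finite dimension, so `f` is recovered
smoothly from its values on basis vectors. -/
theorem contDiff_alternating_of_apply [FiniteDimensional ℝ E] [FiniteDimensional ℝ F]
    {D : Type*} [NormedAddCommGroup D] [NormedSpace ℝ D] {m : ℕ∞ω} {f : D → E [⋀^ι]→L[ℝ] F}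
    (h : ∀ v, ContDiff ℝ m fun x => f x v) : ContDiff ℝ m f := by
  classical
  obtain ⟨g, hg⟩ := (basisEval ι E F).exists_leftInverse_of_injective
    (LinearMap.ker_eq_bot.2 basisEval_injective)
  have : f = fun x => LinearMap.toContinuousLinearMap g (basisEval ι E F (f x)) := by
    funext x
    exact (LinearMap.congr_fun hg (f x)).symm
  rw [this]
  refine (LinearMap.toContinuousLinearMap g).contDiff.comp (contDiff_pi.2 fun a => h _)

theorem contDiff_alternating_apply (f : E [⋀^ι]→L[ℝ] F) {m : ℕ∞ω} : ContDiff ℝ m f :=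
  f.toContinuousMultilinearMap.contDiff

/-- On a fixed form and fixed vectors this is `A.2` applied to the form at the vectors `A.1 (v i)`,
which is polynomial in the pair. It is what makes the transition functions of `ΛⁿT*N` smooth. -/
theorem contDiff_alternatingMapCongr {E' F' : Type*} [NormedAddCommGroup E']
    [NormedSpace ℝ E'] [NormedAddCommGroup F'] [NormedSpace ℝ F'] [FiniteDimensional ℝ E]
    [FiniteDimensional ℝ E'] [FiniteDimensional ℝ F] [FiniteDimensional ℝ F'] {m : ℕ∞ω} :
    ContDiff ℝ m (fun A : (E →L[ℝ] E') × (F →L[ℝ] F') =>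
      (((ContinuousLinearMap.compContinuousAlternatingMapCLM ℝ E F F' ι) A.2).comp
        (ContinuousAlternatingMap.compContinuousLinearMapCLM A.1) :
        (E' [⋀^ι]→L[ℝ] F) →L[ℝ] (E [⋀^ι]→L[ℝ] F'))) := by
  rw [contDiff_clm_apply_iff]
  intro f
  refine contDiff_alternating_of_apply fun v => ?_
  refine contDiff_snd.clm_apply
    ((contDiff_alternating_apply f).comp (contDiff_pi.2 fun i => ?_))
  exact contDiff_fst.clm_apply contDiff_const

theorem contDiff_alternating_eval [FiniteDimensional ℝ E] [FiniteDimensional ℝ F] {m : ℕ∞ω} :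
    ContDiff ℝ m (fun v : ι → E => ContinuousAlternatingMap.apply ℝ E F v) := by
  rw [contDiff_clm_apply_iff]
  exact fun f => contDiff_alternating_apply f

end Alternating

/-! ### The bundle of alternating maps is smooth -/

section SmoothBundle

variable {ι B F₁ F₂ : Type*} [Fintype ι] {m : ℕ∞ω}
  {E₁ : B → Type*} {E₂ : B → Type*}
  [∀ x, AddCommGroup (E₁ x)] [∀ x, Module ℝ (E₁ x)] [NormedAddCommGroup F₁] [NormedSpace ℝ F₁]
  [TopologicalSpace (TotalSpace F₁ E₁)] [∀ x, TopologicalSpace (E₁ x)] [∀ x, AddCommGroup (E₂ x)]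
  [∀ x, Module ℝ (E₂ x)] [NormedAddCommGroup F₂] [NormedSpace ℝ F₂]
  [TopologicalSpace (TotalSpace F₂ E₂)] [∀ x, TopologicalSpace (E₂ x)]
  {EB : Type*}
  [NormedAddCommGroup EB] [NormedSpace ℝ EB] {HB : Type*} [TopologicalSpace HB]
  {IB : ModelWithCorners ℝ EB HB} [TopologicalSpace B] [ChartedSpace HB B]
  [FiberBundle F₁ E₁] [VectorBundle ℝ F₁ E₁]
  [FiberBundle F₂ E₂] [VectorBundle ℝ F₂ E₂]
  [FiniteDimensional ℝ F₁] [FiniteDimensional ℝ F₂]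

set_option synthInstance.maxHeartbeats 200000 in
theorem contMDiffOn_continuousAlternatingMapCoordChange
    [ContMDiffVectorBundle m F₁ E₁ IB] [ContMDiffVectorBundle m F₂ E₂ IB]
    {e₁ e₁' : Trivialization F₁ (π F₁ E₁)} {e₂ e₂' : Trivialization F₂ (π F₂ E₂)}
    [MemTrivializationAtlas e₁] [MemTrivializationAtlas e₁']
    [MemTrivializationAtlas e₂] [MemTrivializationAtlas e₂'] :
    ContMDiffOn IB 𝓘(ℝ, (F₁ [⋀^ι]→L[ℝ] F₂) →L[ℝ] (F₁ [⋀^ι]→L[ℝ] F₂)) m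
      (Pretrivialization.continuousAlternatingMapCoordChange ℝ ι e₁ e₁' e₂ e₂')
      (e₁.baseSet ∩ e₂.baseSet ∩ (e₁'.baseSet ∩ e₂'.baseSet)) := by
  -- Forms are contravariant in `E₁`, so its coordinate change enters in the reverse direction.
  have h₁ := contMDiffOn_coordChangeL (IB := IB) e₁' e₁ (n := m)
  have h₂ := contMDiffOn_coordChangeL (IB := IB) e₂ e₂' (n := m)
  simp +unfoldPartialApp only [Pretrivialization.continuousAlternatingMapCoordChange,
    ContinuousLinearEquiv.coe_continuousAlternatingMapCongr, ContinuousLinearEquiv.symm_symm]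
  have hs₁ : e₁.baseSet ∩ e₂.baseSet ∩ (e₁'.baseSet ∩ e₂'.baseSet) ⊆ e₁'.baseSet ∩ e₁.baseSet :=
    fun x hx => ⟨hx.2.1, hx.1.1⟩
  have hs₂ : e₁.baseSet ∩ e₂.baseSet ∩ (e₁'.baseSet ∩ e₂'.baseSet) ⊆ e₂.baseSet ∩ e₂'.baseSet :=
    fun x hx => ⟨hx.1.2, hx.2.2⟩
  have h := (h₁.mono hs₁).prodMk_space (h₂.mono hs₂)
  exact (contDiff_alternatingMapCongr (ι := ι) (m := m)).contMDiff.comp_contMDiffOn h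

variable [∀ x, IsTopologicalAddGroup (E₂ x)] [∀ x, ContinuousSMul ℝ (E₂ x)]
  [ContMDiffVectorBundle m F₁ E₁ IB] [ContMDiffVectorBundle m F₂ E₂ IB]

instance isContMDiff_continuousAlternatingMap_vectorPrebundle :
    (Bundle.ContinuousAlternatingMap.vectorPrebundle ℝ ι F₁ E₁ F₂ E₂).IsContMDiff IB m where
  exists_contMDiffCoordChange := by
    rintro _ ⟨e₁, e₂, he₁, he₂, rfl⟩ _ ⟨e₁', e₂', he₁', he₂', rfl⟩
    exact ⟨Pretrivialization.continuousAlternatingMapCoordChange ℝ ι e₁ e₁' e₂ e₂',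
      contMDiffOn_continuousAlternatingMapCoordChange,
      Pretrivialization.continuousAlternatingMapCoordChange_apply⟩

/-- With this, `ΛⁿT*N` and its dual bundle `ΛⁿTN` are smooth vector bundles, so smoothness of maps
into them can be tested in trivializations. -/
instance contMDiffVectorBundle_continuousAlternatingMap :
    ContMDiffVectorBundle m (F₁ [⋀^ι]→L[ℝ] F₂) (fun b : B => E₁ b [⋀^ι]→L[ℝ] E₂ b) IB :=
  (Bundle.ContinuousAlternatingMap.vectorPrebundle ℝ ι F₁ E₁ F₂ E₂).contMDiffVectorBundle IB

end SmoothBundle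

/-! ### Coordinates on `ΛⁿT*N` and `ΛⁿTN` over a chart of `N`. -/

section Coord

variable {n k : ℕ} {N : Type*} [TopologicalSpace N]
  [ChartedSpace (EuclideanSpace ℝ (Fin (n + k))) N] [IsManifold (𝓡 (n + k)) ∞ N]

/-- The coordinate isomorphism `T_qN → ℝ^{n+k}` given by the chart at `q₀`. -/
abbrev tanCoord (q₀ q : N) : TangentSpace (𝓡 (n + k)) q →L[ℝ] EuclideanSpace ℝ (Fin (n + k)) :=
  (trivializationAt (EuclideanSpace ℝ (Fin (n + k)))
    (TangentSpace (𝓡 (n + k)) : N → Type _) q₀).continuousLinearMapAt ℝ q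

/-- The inverse of `tanCoord`. -/
abbrev tanCoordSymm (q₀ q : N) :
    EuclideanSpace ℝ (Fin (n + k)) →L[ℝ] TangentSpace (𝓡 (n + k)) q :=
  (trivializationAt (EuclideanSpace ℝ (Fin (n + k)))
    (TangentSpace (𝓡 (n + k)) : N → Type _) q₀).symmL ℝ q

/-- The coordinate of a form in the trivialization at `q₀`. -/
def formCoord (q₀ : N) (μ : FormBundle n k N) : FormModel n k :=
  (trivializationAt (FormModel n k) (FormFiber n k N) q₀ μ).2

/-- The coordinate of a multivector in the trivialization at `q₀`. -/
def mvCoord (q₀ : N) (z : MultiVecBundle n k N) : MultiVecModel n k :=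
  (trivializationAt (MultiVecModel n k) (MultiVecFiber n k N) q₀ z).2

theorem formCoord_apply (q₀ q : N) (p : FormFiber n k N q) (v) :
    formCoord q₀ ⟨q, p⟩ v = p (fun i => tanCoordSymm q₀ q (v i)) := by
  rw [formCoord, FiberBundle.trivializationAt_continuousAlternatingMap_apply]
  simp only [ContinuousAlternatingMap.inCoordinates]
  simp
  rfl

variable {q₀ q : N}

theorem tanCoord_tanCoordSymm
    (h : q ∈ (chartAt (EuclideanSpace ℝ (Fin (n + k))) q₀).source)
    (v : EuclideanSpace ℝ (Fin (n + k))) :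
    tanCoord q₀ q (tanCoordSymm q₀ q v) = v := by
  apply Trivialization.continuousLinearMapAt_symmL
  simpa using h

theorem tanCoordSymm_tanCoord
    (h : q ∈ (chartAt (EuclideanSpace ℝ (Fin (n + k))) q₀).source)
    (v : TangentSpace (𝓡 (n + k)) q) :
    tanCoordSymm q₀ q (tanCoord q₀ q v) = v := by
  apply Trivialization.symmL_continuousLinearMapAt
  simpa using h

/-- The form at `q` with given coordinate in the trivialization at `q₀`. -/
def formOfCoord (q₀ q : N) (f : FormModel n k) : FormFiber n k N q :=
  ContinuousAlternatingMap.compContinuousLinearMap (N := ℝ) f (tanCoord q₀ q)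

/-- The multivector at `q` with given coordinate in the trivialization at `q₀`. -/
def mvOfCoord (q₀ q : N) (z : MultiVecModel n k) : MultiVecFiber n k N q :=
  (trivializationAt (MultiVecModel n k) (MultiVecFiber n k N) q₀).symm q z

theorem formOfCoord_formCoord
    (h : q ∈ (chartAt (EuclideanSpace ℝ (Fin (n + k))) q₀).source) (p : FormFiber n k N q) :
    formOfCoord q₀ q (formCoord q₀ ⟨q, p⟩) = p := by
  ext v
  change formCoord q₀ ⟨q, p⟩ (fun i => tanCoord q₀ q (v i)) = p v
  rw [formCoord_apply]
  simp only [tanCoordSymm_tanCoord h]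

theorem formCoord_formOfCoord
    (h : q ∈ (chartAt (EuclideanSpace ℝ (Fin (n + k))) q₀).source) (f : FormModel n k) :
    formCoord q₀ ⟨q, formOfCoord q₀ q f⟩ = f := by
  ext v
  rw [formCoord_apply]
  change f (fun i => tanCoord q₀ q (tanCoordSymm q₀ q (v i))) = f v
  simp only [tanCoord_tanCoordSymm h]

theorem mem_formTriv_baseSet :
    q ∈ (trivializationAt (FormModel n k) (FormFiber n k N) q₀).baseSet ↔
      q ∈ (chartAt (EuclideanSpace ℝ (Fin (n + k))) q₀).source := by
  simp

theorem mem_mvTriv_baseSet :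
    q ∈ (trivializationAt (MultiVecModel n k) (MultiVecFiber n k N) q₀).baseSet ↔
      q ∈ (chartAt (EuclideanSpace ℝ (Fin (n + k))) q₀).source := by
  simp

/-- The trivialization of the dual bundle is the inverse transpose of that of `ΛⁿT*N`. -/
theorem mvCoord_pairing (h : q ∈ (chartAt (EuclideanSpace ℝ (Fin (n + k))) q₀).source)
    (z : MultiVecFiber n k N q) (p : FormFiber n k N q) :
    mvCoord q₀ ⟨q, z⟩ (formCoord q₀ ⟨q, p⟩) = z p := by
  rw [mvCoord, hom_trivializationAt_apply]
  rw [ContinuousLinearMap.inCoordinates_eq (mem_formTriv_baseSet.2 h) (mem_univ _)]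
  simp only [ContinuousLinearMap.coe_comp, Function.comp_apply, ContinuousLinearEquiv.coe_coe]
  refine congrArg z ?_
  rw [ContinuousLinearEquiv.symm_apply_eq]
  rfl

theorem mvCoord_apply (h : q ∈ (chartAt (EuclideanSpace ℝ (Fin (n + k))) q₀).source)
    (z : MultiVecFiber n k N q) (f : FormModel n k) :
    mvCoord q₀ ⟨q, z⟩ f = z (formOfCoord q₀ q f) := by
  rw [← mvCoord_pairing h, formCoord_formOfCoord h]

theorem mvCoord_wedge (h : q ∈ (chartAt (EuclideanSpace ℝ (Fin (n + k))) q₀).source)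
    (v : Fin n → TangentSpace (𝓡 (n + k)) q) :
    mvCoord q₀ ⟨q, wedge v⟩ =
      ContinuousAlternatingMap.apply ℝ (EuclideanSpace ℝ (Fin (n + k))) ℝ
        (fun i => tanCoord q₀ q (v i)) := by
  ext f
  rw [mvCoord_apply h]
  rfl

theorem mvOfCoord_mvCoord
    (h : q ∈ (chartAt (EuclideanSpace ℝ (Fin (n + k))) q₀).source) (z : MultiVecFiber n k N q) :
    mvOfCoord q₀ q (mvCoord q₀ ⟨q, z⟩) = z :=
  Trivialization.symm_apply_apply_mk _ (mem_mvTriv_baseSet.2 h) _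

theorem mvCoord_mvOfCoord
    (h : q ∈ (chartAt (EuclideanSpace ℝ (Fin (n + k))) q₀).source) (z : MultiVecModel n k) :
    mvCoord q₀ ⟨q, mvOfCoord q₀ q z⟩ = z := by
  have := Trivialization.apply_mk_symm _ (mem_mvTriv_baseSet.2 h) z
  exact congrArg Prod.snd this

theorem mvCoord_injective
    (h : q ∈ (chartAt (EuclideanSpace ℝ (Fin (n + k))) q₀).source) {z z' : MultiVecFiber n k N q}
    (hz : mvCoord q₀ ⟨q, z⟩ = mvCoord q₀ ⟨q, z'⟩) : z = z' := by
  rw [← mvOfCoord_mvCoord h z, hz, mvOfCoord_mvCoord h z']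

theorem mvCoord_smul
    (h : q ∈ (chartAt (EuclideanSpace ℝ (Fin (n + k))) q₀).source) (c : ℝ)
    (z : MultiVecFiber n k N q) :
    mvCoord q₀ ⟨q, c • z⟩ = c • mvCoord q₀ ⟨q, z⟩ := by
  ext f
  rw [mvCoord_apply h]
  change c • z (formOfCoord q₀ q f) = c • mvCoord q₀ ⟨q, z⟩ f
  rw [mvCoord_apply h]

section Smooth

variable {E' H' A : Type*} [NormedAddCommGroup E'] [NormedSpace ℝ E'] [TopologicalSpace H']
  {I' : ModelWithCorners ℝ E' H'} [TopologicalSpace A] [ChartedSpace H' A] {s : Set A} {a₀ : A}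
  {m : ℕ∞ω} [ENat.LEInfty m]

theorem contMDiffWithinAt_form_iff {f : A → FormBundle n k N}
    (h : (f a₀).proj ∈ (chartAt (EuclideanSpace ℝ (Fin (n + k))) q₀).source) :
    ContMDiffWithinAt I' (formI n k) m f s a₀ ↔
      ContMDiffWithinAt I' (𝓡 (n + k)) m (fun a => (f a).proj) s a₀ ∧
        ContMDiffWithinAt I' 𝓘(ℝ, FormModel n k) m (fun a => formCoord q₀ (f a)) s a₀ :=
  have hs : f a₀ ∈ (trivializationAt (FormModel n k) (FormFiber n k N) q₀).source :=
    (Trivialization.mem_source _).2 (mem_formTriv_baseSet.2 h)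
  Trivialization.contMDiffWithinAt_iff hs

theorem contMDiffWithinAt_mv_iff {f : A → MultiVecBundle n k N}
    (h : (f a₀).proj ∈ (chartAt (EuclideanSpace ℝ (Fin (n + k))) q₀).source) :
    ContMDiffWithinAt I' (multiVecI n k) m f s a₀ ↔
      ContMDiffWithinAt I' (𝓡 (n + k)) m (fun a => (f a).proj) s a₀ ∧
        ContMDiffWithinAt I' 𝓘(ℝ, MultiVecModel n k) m (fun a => mvCoord q₀ (f a)) s a₀ :=
  have hs : f a₀ ∈ (trivializationAt (MultiVecModel n k) (MultiVecFiber n k N) q₀).source :=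
    (Trivialization.mem_source _).2 (mem_mvTriv_baseSet.2 h)
  Trivialization.contMDiffWithinAt_iff hs

end Smooth

end Coord

/-! ### The smooth retraction onto normalized decomposable multivectors -/

section Retraction

variable {n : ℕ} {E : Type*} [NormedAddCommGroup E] [NormedSpace ℝ E]

/-- The form `α₁ ∧ ⋯ ∧ αₙ`. -/
def detForm (α : Fin n → E →L[ℝ] ℝ) : E [⋀^Fin n]→L[ℝ] ℝ :=
  { (Matrix.detRowAlternating (R := ℝ) (n := Fin n)).compLinearMap
      (LinearMap.pi fun j => (α j : E →ₗ[ℝ] ℝ)) with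
    cont := by
      change Continuous fun v : Fin n → E => Matrix.det (Matrix.of fun i j => α j (v i))
      refine Continuous.matrix_det ?_
      fun_prop }

theorem detForm_apply (α : Fin n → E →L[ℝ] ℝ) (v : Fin n → E) :
    detForm α v = Matrix.det (Matrix.of fun i j => α j (v i)) := rfl

/-- Pulled back to `ℝⁿ` by `e_j ↦ u j`, the form `f` becomes a top form, hence a multiple of the
determinant. -/
theorem alternating_map_linearCombination (f : E [⋀^Fin n]→L[ℝ] ℝ) (u : Fin n → E)
    (M : Matrix (Fin n) (Fin n) ℝ) :
    f (fun i => ∑ j, M i j • u j) = M.det * f u := by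
  have h := ((f.toAlternatingMap.compLinearMap (Fintype.linearCombination ℝ u))).eq_smul_basis_det
    (Pi.basisFun ℝ (Fin n))
  have h' := congrArg (fun g => g M) h
  rw [Pi.basisFun_det] at h'
  change f (fun i => Fintype.linearCombination ℝ u (M i)) =
    f (fun i => Fintype.linearCombination ℝ u (Pi.basisFun ℝ (Fin n) i)) * M.det at h'
  simpa [Fintype.linearCombination_apply, mul_comm, Pi.single_apply] using h'

theorem alternating_apply_smul_single (f : E [⋀^Fin n]→L[ℝ] ℝ) (u : Fin n → E) (i : Fin n)
    (c : ℝ) : f (Function.update u i (c • u i)) = c * f u := by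
  rw [f.map_update_smul, Function.update_eq_self, smul_eq_mul]

variable [FiniteDimensional ℝ E]

/-- The frame of the plane of the decomposable multivector `z` that is dual to `α`. -/
def planeFrame (α : Fin n → E →L[ℝ] ℝ) (z : (E [⋀^Fin n]→L[ℝ] ℝ) →L[ℝ] ℝ) (i : Fin n) : E :=
  (z (detForm α))⁻¹ • ∑ b, z (detForm (Function.update α i
    (LinearMap.toContinuousLinearMap ((Module.finBasis ℝ E).coord b)))) • Module.finBasis ℝ E b

/-- With `M i j = α j (w i)`, Cramer's rule identifies the `i`-th vector of the frame with `∑ j, M⁻¹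
i j • w j`, so the wedge of the frame is the wedge of `w` divided by `det M`. A decomposable
multivector thus determines, by a rational formula, a frame of its plane. -/
theorem apply_planeFrame (α : Fin n → E →L[ℝ] ℝ) (w : Fin n → E) (hw : detForm α w ≠ 0)
    (f : E [⋀^Fin n]→L[ℝ] ℝ) :
    f w = detForm α w * f (planeFrame α (ContinuousAlternatingMap.apply ℝ E ℝ w)) := by
  set M : Matrix (Fin n) (Fin n) ℝ := Matrix.of fun i j => α j (w i) with hM
  have hd : detForm α w = M.det := rfl
  have hu : ∀ i, planeFrame α (ContinuousAlternatingMap.apply ℝ E ℝ w) i =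
      ∑ j, (M⁻¹ i j) • w j := by
    intro i
    -- Replacing the `i`-th covector replaces the `i`-th column of `M`.
    have hcr : ∀ β : E →L[ℝ] ℝ, detForm (Function.update α i β) w =
        ∑ j, M.adjugate i j * β (w j) := by
      intro β
      have h1 : detForm (Function.update α i β) w = (M.updateCol i fun j => β (w j)).det := by
        rw [detForm_apply]
        congr 1
        ext a b
        by_cases hb : b = i
        · subst hb; simp
        · simp [hb, hM]
      rw [h1, ← Matrix.cramer_apply, Matrix.cramer_eq_adjugate_mulVec]
      rfl
    have h2 : ∀ j, w j = ∑ b, (Module.finBasis ℝ E).coord b (w j) • Module.finBasis ℝ E b :=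
      fun j => ((Module.finBasis ℝ E).sum_repr (w j)).symm
    change (detForm α w)⁻¹ • ∑ b, detForm (Function.update α i
      (LinearMap.toContinuousLinearMap ((Module.finBasis ℝ E).coord b))) w •
        Module.finBasis ℝ E b = _
    simp only [hcr, hd, Matrix.inv_def, Ring.inverse_eq_inv']
    conv_rhs => enter [2, j]; rw [h2 j]
    simp only [Finset.smul_sum, Finset.sum_smul]
    rw [Finset.sum_comm]
    refine Finset.sum_congr rfl fun j _ => Finset.sum_congr rfl fun b _ => ?_
    simp [smul_smul, mul_assoc]
  have hfu : f (planeFrame α (ContinuousAlternatingMap.apply ℝ E ℝ w)) = M⁻¹.det * f w := by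
    rw [← alternating_map_linearCombination]
    exact congrArg f (funext hu)
  rw [hfu, hd, ← mul_assoc, Matrix.det_nonsing_inv, Ring.inverse_eq_inv',
    mul_inv_cancel₀ (hd ▸ hw), one_mul]

theorem contDiffAt_planeFrame (α : Fin n → E →L[ℝ] ℝ) {z : (E [⋀^Fin n]→L[ℝ] ℝ) →L[ℝ] ℝ}
    (hz : z (detForm α) ≠ 0) {m : ℕ∞ω} : ContDiffAt ℝ m (planeFrame α) z := by
  have he : ∀ f : E [⋀^Fin n]→L[ℝ] ℝ, ContDiffAt ℝ m
      (fun z : (E [⋀^Fin n]→L[ℝ] ℝ) →L[ℝ] ℝ => z f) z := fun f =>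
    (contDiff_id.clm_apply contDiff_const).contDiffAt
  refine contDiffAt_pi.2 fun i => ?_
  exact ((he _).inv hz).smul (ContDiffAt.sum fun b _ => (he _).smul contDiffAt_const)

theorem exists_dual_covectors {v : Fin n → E} (hv : LinearIndependent ℝ v) :
    ∃ α : Fin n → E →L[ℝ] ℝ, detForm α v = 1 := by
  obtain ⟨g, hg⟩ := (Fintype.linearCombination ℝ v).exists_leftInverse_of_injective
    (LinearMap.ker_eq_bot.2 (linearIndependent_iff_injective_fintypeLinearCombination.1 hv))
  refine ⟨fun j => LinearMap.toContinuousLinearMap ((LinearMap.proj j).comp g), ?_⟩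
  rw [detForm_apply]
  have : (Matrix.of fun i j => LinearMap.toContinuousLinearMap ((LinearMap.proj j).comp g) (v i))
      = (1 : Matrix (Fin n) (Fin n) ℝ) := by
    ext i j
    have h := LinearMap.congr_fun hg (Pi.single i 1)
    simp at h
    simp [h, Matrix.one_apply, Pi.single_apply, eq_comm]
  rw [this, Matrix.det_one]

/-- Rebuild a frame from the multivector by `planeFrame`, rescale its first vector so that the form
takes the value `1` on the frame, and wedge. The result is decomposable and normalized for every
nearby multivector, and `apply_planeFrame` shows that nothing changes if it already was. The form is
a variable as well, because `ω` varies with the base point. -/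
theorem exists_decomposable_retraction (hn : 1 ≤ n) (v₀ : Fin n → E)
    (ω₀ : E [⋀^Fin n]→L[ℝ] ℝ) (h₀ : ω₀ v₀ = 1) {m : ℕ∞ω} :
    ∃ ρ : (E [⋀^Fin n]→L[ℝ] ℝ) × ((E [⋀^Fin n]→L[ℝ] ℝ) →L[ℝ] ℝ) →
        ((E [⋀^Fin n]→L[ℝ] ℝ) →L[ℝ] ℝ),
      ∀ᶠ a in 𝓝 (ω₀, ContinuousAlternatingMap.apply ℝ E ℝ v₀),
        ContDiffAt ℝ m ρ a ∧ (∃ w, ρ a = ContinuousAlternatingMap.apply ℝ E ℝ w) ∧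
        ρ a a.1 = 1 ∧
        ((∃ w, a.2 = ContinuousAlternatingMap.apply ℝ E ℝ w) → a.2 a.1 = 1 → ρ a = a.2) := by
  have hli : LinearIndependent ℝ v₀ := by
    by_contra hc
    have := ω₀.toAlternatingMap.map_linearDependent v₀ hc
    rw [ContinuousAlternatingMap.coe_toAlternatingMap, h₀] at this
    exact one_ne_zero this
  obtain ⟨α, hα⟩ := exists_dual_covectors hli
  set z₀ := ContinuousAlternatingMap.apply ℝ E ℝ v₀ with hz₀
  have hα' : z₀ (detForm α) = 1 := hα
  refine ⟨fun a => ContinuousAlternatingMap.apply ℝ E ℝ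
    (Function.update (planeFrame α a.2) ⟨0, hn⟩
      ((a.1 (planeFrame α a.2))⁻¹ • planeFrame α a.2 ⟨0, hn⟩)), ?_⟩
  have hpair : ContDiff ℝ m (fun b : (E [⋀^Fin n]→L[ℝ] ℝ) × (Fin n → E) => b.1 b.2) := by
    have : (fun b : (E [⋀^Fin n]→L[ℝ] ℝ) × (Fin n → E) => b.1 b.2) =
      fun b => ContinuousAlternatingMap.apply ℝ E ℝ b.2 b.1 := rfl
    rw [this]
    exact (contDiff_alternating_eval.comp contDiff_snd).clm_apply contDiff_fst
  have hopen : ∀ᶠ a in 𝓝 (ω₀, z₀), a.2 (detForm α) ≠ 0 := by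
    have : Continuous fun a : (E [⋀^Fin n]→L[ℝ] ℝ) × ((E [⋀^Fin n]→L[ℝ] ℝ) →L[ℝ] ℝ) =>
        a.2 (detForm α) := by fun_prop
    exact this.continuousAt.eventually_ne (by rw [hα']; exact one_ne_zero)
  have hsm : ∀ a : (E [⋀^Fin n]→L[ℝ] ℝ) × ((E [⋀^Fin n]→L[ℝ] ℝ) →L[ℝ] ℝ),
      a.2 (detForm α) ≠ 0 → ContDiffAt ℝ m (fun a => a.1 (planeFrame α a.2)) a := by
    intro a ha
    exact hpair.contDiffAt.comp a (contDiffAt_fst.prodMk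
      ((contDiffAt_planeFrame α ha).comp a contDiffAt_snd))
  have hopen' : ∀ᶠ a in 𝓝 (ω₀, z₀), a.1 (planeFrame α a.2) ≠ 0 := by
    refine (hsm (ω₀, z₀) (by rw [hα']; exact one_ne_zero)).continuousAt.eventually_ne ?_
    have := apply_planeFrame α v₀ (by rw [hα]; exact one_ne_zero) ω₀
    rw [h₀, hα, one_mul] at this
    exact this ▸ one_ne_zero
  filter_upwards [hopen, hopen'] with a ha ha'
  refine ⟨?_, ?_, ?_, ?_⟩
  · refine contDiff_alternating_eval.contDiffAt.comp a (contDiffAt_pi.2 fun i => ?_)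
    have hpf : ContDiffAt ℝ m (fun a : (E [⋀^Fin n]→L[ℝ] ℝ) ×
        ((E [⋀^Fin n]→L[ℝ] ℝ) →L[ℝ] ℝ) => planeFrame α a.2) a :=
      (contDiffAt_planeFrame α ha).comp a contDiffAt_snd
    by_cases hi : i = ⟨0, hn⟩
    · subst hi
      simp only [Function.update_self]
      exact ((hsm a ha).inv ha').smul (contDiffAt_pi.1 hpf _)
    · simpa [hi] using contDiffAt_pi.1 hpf i
  · exact ⟨_, rfl⟩
  · exact (alternating_apply_smul_single a.1 _ _ _).trans (inv_mul_cancel₀ ha')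
  · rintro ⟨w, hw⟩ h1
    have hd : detForm α w ≠ 0 := by rw [hw] at ha; exact ha
    have key := apply_planeFrame α w hd
    rw [← hw] at key
    -- Normalization identifies the rescaling factor with `detForm α w`, exactly the factor in
    -- `key`.
    have h1' : detForm α w * a.1 (planeFrame α a.2) = 1 := by
      rw [← key]
      rw [hw] at h1
      exact h1
    ext f
    refine (alternating_apply_smul_single f _ _ _).trans ?_
    rw [inv_eq_of_mul_eq_one_left h1', ← key, hw]
    rfl

end Retraction

/-! ### Differentiation of `W` along `D^ω N` -/

/-- The neighbourhood filter of `(y, z)` in a product of normed spaces, for the norm topologies. -/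
abbrev nhdsPair {E F : Type*} [NormedAddCommGroup E] [NormedAddCommGroup F] (y : E) (z : F) :
    Filter (E × F) := 𝓝 (y, z)

section Pontryagin

variable {n k : ℕ} {N : Type*} [TopologicalSpace N]
  [ChartedSpace (EuclideanSpace ℝ (Fin (n + k))) N] [IsManifold (𝓡 (n + k)) ∞ N]

/-- Linear coordinates on `T_qN` carry wedges to wedges in both directions and preserve the pairing.
-/
theorem mem_DOmega_iff_coord {vol : ∀ q : N, FormFiber n k N q} {q₀ q : N}
    (h : q ∈ (chartAt (EuclideanSpace ℝ (Fin (n + k))) q₀).source) {z : MultiVecFiber n k N q} :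
    z ∈ DOmega vol q ↔
      (∃ w, mvCoord q₀ ⟨q, z⟩ =
        ContinuousAlternatingMap.apply ℝ (EuclideanSpace ℝ (Fin (n + k))) ℝ w) ∧
      mvCoord q₀ ⟨q, z⟩ (formCoord q₀ ⟨q, vol q⟩) = 1 := by
  rw [mvCoord_pairing h]
  refine and_congr ⟨?_, ?_⟩ Iff.rfl
  · rintro ⟨v, rfl⟩
    exact ⟨_, mvCoord_wedge h v⟩
  · rintro ⟨w, hw⟩
    refine ⟨fun i => tanCoordSymm q₀ q (w i), mvCoord_injective h ?_⟩
    rw [hw, mvCoord_wedge h]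
    simp only [tanCoord_tanCoordSymm h]

/-- The point of `ΛⁿTN` with coordinates `(y, z)` in the chart at `q₀`. -/
def mvPoint (q₀ : N) (y : EuclideanSpace ℝ (Fin (n + k))) (z : MultiVecModel n k) :
    MultiVecBundle n k N :=
  ⟨(extChartAt (𝓡 (n + k)) q₀).symm y, mvOfCoord q₀ _ z⟩

/-- The coordinate of a section of `ΛⁿT*N` in the chart at `q₀`. -/
def localForm (vol : ∀ q : N, FormFiber n k N q) (q₀ : N)
    (y : EuclideanSpace ℝ (Fin (n + k))) : FormModel n k :=
  formCoord q₀ ⟨(extChartAt (𝓡 (n + k)) q₀).symm y, vol _⟩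

variable {vol : ∀ q : N, FormFiber n k N q} {L : MultiVecBundle n k N → ℝ} {q₀ : N}
  {y : EuclideanSpace ℝ (Fin (n + k))}

theorem extChartAt_symm_mem_source (hy : y ∈ (extChartAt (𝓡 (n + k)) q₀).target) :
    (extChartAt (𝓡 (n + k)) q₀).symm y ∈
      (chartAt (EuclideanSpace ℝ (Fin (n + k))) q₀).source := by
  simpa using (extChartAt (𝓡 (n + k)) q₀).map_target hy

theorem contMDiffAt_extChartAt_symm_target (hy : y ∈ (extChartAt (𝓡 (n + k)) q₀).target) :
    ContMDiffAt 𝓘(ℝ, EuclideanSpace ℝ (Fin (n + k))) (𝓡 (n + k)) ∞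
      (extChartAt (𝓡 (n + k)) q₀).symm y :=
  (contMDiffOn_extChartAt_symm q₀).contMDiffAt
    ((isOpen_extChartAt_target q₀).mem_nhds hy)

theorem contDiffAt_localForm (hvol : IsSpaceTimeVolume vol)
    (hy : y ∈ (extChartAt (𝓡 (n + k)) q₀).target) : ContDiffAt ℝ ∞ (localForm vol q₀) y := by
  have h1 := (hvol.smooth _).comp y (contMDiffAt_extChartAt_symm_target hy)
  have h2 := (contMDiffWithinAt_form_iff (m := ∞) (q₀ := q₀) (s := univ)
    (extChartAt_symm_mem_source hy)).1 h1.contMDiffWithinAt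
  exact (contMDiffWithinAt_univ.1 h2.2).contDiffAt

theorem contMDiffAt_mvPoint {F : Type*} [NormedAddCommGroup F] [NormedSpace ℝ F]
    {f : F → EuclideanSpace ℝ (Fin (n + k))} {g : F → MultiVecModel n k} {a : F}
    (hf : ContDiffAt ℝ ∞ f a) (hg : ContDiffAt ℝ ∞ g a)
    (hy : f a ∈ (extChartAt (𝓡 (n + k)) q₀).target) :
    ContMDiffAt 𝓘(ℝ, F) (multiVecI n k) ∞
      (fun b => mvPoint q₀ (f b) (g b) : F → MultiVecBundle n k N) a := by
  refine contMDiffWithinAt_univ.1 ((contMDiffWithinAt_mv_iff (q₀ := q₀)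
    (extChartAt_symm_mem_source hy)).2 ⟨?_, ?_⟩)
  · exact ((contMDiffAt_extChartAt_symm_target hy).comp a hf.contMDiffAt).contMDiffWithinAt
  · refine (hg.contMDiffAt.congr_of_eventuallyEq ?_).contMDiffWithinAt
    filter_upwards [hf.continuousAt.preimage_mem_nhds
      ((isOpen_extChartAt_target (I := 𝓡 (n + k)) q₀).mem_nhds hy)] with b hb
    exact mvCoord_mvOfCoord (extChartAt_symm_mem_source hb) _

theorem mvPoint_extChartAt {q : N} (h : q ∈ (chartAt (EuclideanSpace ℝ (Fin (n + k))) q₀).source)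
    (z : MultiVecFiber n k N q) :
    mvPoint q₀ (extChartAt (𝓡 (n + k)) q₀ q) (mvCoord q₀ ⟨q, z⟩) = ⟨q, z⟩ := by
  have hq : (extChartAt (𝓡 (n + k)) q₀).symm (extChartAt (𝓡 (n + k)) q₀ q) = q :=
    (extChartAt (𝓡 (n + k)) q₀).left_inv (by simpa using h)
  have : ∀ q' : N, q' = q → (⟨q', mvOfCoord q₀ q' (mvCoord q₀ ⟨q, z⟩)⟩ : MultiVecBundle n k N) =
      ⟨q, z⟩ := by
    rintro q' rfl
    rw [mvOfCoord_mvCoord h]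
  exact this _ hq

theorem mvPoint_extChartAt' {q : N} (h : q ∈ (chartAt (EuclideanSpace ℝ (Fin (n + k))) q₀).source)
    (z : MultiVecModel n k) :
    mvPoint q₀ (extChartAt (𝓡 (n + k)) q₀ q) z = ⟨q, mvOfCoord q₀ q z⟩ := by
  rw [← mvPoint_extChartAt h, mvCoord_mvOfCoord h]

theorem localForm_extChartAt {q : N}
    (h : q ∈ (chartAt (EuclideanSpace ℝ (Fin (n + k))) q₀).source) :
    localForm vol q₀ (extChartAt (𝓡 (n + k)) q₀ q) = formCoord q₀ ⟨q, vol q⟩ := by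
  have hq : (extChartAt (𝓡 (n + k)) q₀).symm (extChartAt (𝓡 (n + k)) q₀ q) = q :=
    (extChartAt (𝓡 (n + k)) q₀).left_inv (by simpa using h)
  rw [localForm, hq]

theorem mvPoint_mem_DOmegaTotal (hy : y ∈ (extChartAt (𝓡 (n + k)) q₀).target)
    {z : MultiVecModel n k}
    (hw : ∃ w, z = ContinuousAlternatingMap.apply ℝ (EuclideanSpace ℝ (Fin (n + k))) ℝ w)
    (h1 : z (localForm vol q₀ y) = 1) : mvPoint q₀ y z ∈ DOmegaTotal vol := by
  have h := extChartAt_symm_mem_source hy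
  refine (mem_DOmega_iff_coord h).2 ?_
  change (∃ w, mvCoord q₀ ⟨_, mvOfCoord q₀ _ z⟩ = _) ∧ mvCoord q₀ ⟨_, mvOfCoord q₀ _ z⟩ _ = 1
  rw [mvCoord_mvOfCoord h]
  exact ⟨hw, h1⟩

/-- In coordinates, there is a smooth local retraction onto `D^ω N` over `N`. -/
theorem exists_local_retraction (hn : 1 ≤ n) (hvol : IsSpaceTimeVolume vol)
    {z₀ : MultiVecFiber n k N q₀} (hz₀ : z₀ ∈ DOmega vol q₀) :
    ∃ r : EuclideanSpace ℝ (Fin (n + k)) × MultiVecModel n k → MultiVecModel n k,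
      ∀ᶠ a in nhdsPair (extChartAt (𝓡 (n + k)) q₀ q₀) (mvCoord q₀ ⟨q₀, z₀⟩),
        a.1 ∈ (extChartAt (𝓡 (n + k)) q₀).target ∧ ContDiffAt ℝ ∞ r a ∧
        mvPoint q₀ a.1 (r a) ∈ DOmegaTotal vol ∧
        (mvPoint q₀ a.1 a.2 ∈ DOmegaTotal vol → r a = a.2) := by
  have hs := mem_chart_source (EuclideanSpace ℝ (Fin (n + k))) q₀
  obtain ⟨⟨v₀, hv₀⟩, h1⟩ := (mem_DOmega_iff_coord hs).1 hz₀
  set y₀ := extChartAt (𝓡 (n + k)) q₀ q₀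
  have hy₀ : y₀ ∈ (extChartAt (𝓡 (n + k)) q₀).target := mem_extChartAt_target q₀
  rw [← localForm_extChartAt hs, hv₀] at h1
  obtain ⟨ρ, hρ⟩ := exists_decomposable_retraction hn v₀ (localForm vol q₀ y₀) h1 (m := ∞)
  rw [← hv₀] at hρ
  refine ⟨fun a => ρ (localForm vol q₀ a.1, a.2), ?_⟩
  have hc : ContinuousAt (fun a : EuclideanSpace ℝ (Fin (n + k)) × MultiVecModel n k =>
      (localForm vol q₀ a.1, a.2)) (y₀, mvCoord q₀ ⟨q₀, z₀⟩) :=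
    ((contDiffAt_localForm hvol hy₀).continuousAt.comp_of_eq continuousAt_fst rfl).prodMk
      continuousAt_snd
  have hy : ∀ᶠ a in 𝓝 (y₀, mvCoord q₀ ⟨q₀, z₀⟩), a.1 ∈ (extChartAt (𝓡 (n + k)) q₀).target :=
    continuousAt_fst.preimage_mem_nhds ((isOpen_extChartAt_target q₀).mem_nhds hy₀)
  filter_upwards [hy, hc.eventually hρ] with a ha ⟨h1, h2, h3, h4⟩
  refine ⟨ha, ?_, mvPoint_mem_DOmegaTotal ha h2 h3, fun hD => ?_⟩
  · exact h1.comp a (((contDiffAt_localForm hvol ha).comp a contDiffAt_fst).prodMk contDiffAt_snd)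
  · have h := extChartAt_symm_mem_source ha
    obtain ⟨h5, h6⟩ := (mem_DOmega_iff_coord h).1 hD
    change (∃ w, mvCoord q₀ ⟨_, mvOfCoord q₀ _ a.2⟩ = _) at h5
    change mvCoord q₀ ⟨_, mvOfCoord q₀ _ a.2⟩ _ = 1 at h6
    rw [mvCoord_mvOfCoord h] at h5 h6
    exact h4 h5 h6

end Pontryagin

/-! ### Calculus in normed spaces: vertical curves and vertical derivatives. -/

section Generic

variable {E F Λ : Type*} [NormedAddCommGroup E] [NormedSpace ℝ E]
  [NormedAddCommGroup F] [NormedSpace ℝ F] [NormedAddCommGroup Λ] [NormedSpace ℝ Λ]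

/-- A global smooth curve with prescribed velocity that stays in a vertical neighbourhood. -/
theorem exists_vertical_curve {P : E × F → Prop} {y : E} {z : F} (hP : ∀ᶠ a in nhdsPair y z, P a)
    (w : F) : ∃ a : ℝ → F, ContDiff ℝ ∞ a ∧ (∀ t, P (y, a t)) ∧ a 0 = z ∧ HasDerivAt a w 0 := by
  have hline : ContinuousAt (fun τ : ℝ => (y, z + τ • w)) 0 := by fun_prop
  have hev := hline.eventually (by simpa using hP)
  obtain ⟨ε, hε, hball⟩ := Metric.eventually_nhds_iff.1 hev
  -- A reparametrization bounded by `ε / 2` with `ψ 0 = 0` and `ψ' 0 = 1`: stationarity is tested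
  -- only on curves that stay in `D^ω` for all times.
  set ψ : ℝ → ℝ := fun t => (ε / 2) * Real.sin (t / (ε / 2)) with hψ
  have hψb : ∀ t, dist (ψ t) 0 < ε := by
    intro t
    rw [dist_zero_right, hψ, Real.norm_eq_abs, abs_mul, abs_of_pos (half_pos hε)]
    nlinarith [Real.abs_sin_le_one (t / (ε / 2))]
  have hψd : HasDerivAt ψ 1 0 := by
    have := ((Real.hasDerivAt_sin (0 / (ε / 2))).comp 0
      ((hasDerivAt_id (0 : ℝ)).div_const (ε / 2))).const_mul (ε / 2)
    refine this.congr_deriv ?_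
    simp [hε.ne']
  have hψs : ContDiff ℝ ∞ ψ :=
    contDiff_const.mul (Real.contDiff_sin.comp (contDiff_id.div_const _))
  refine ⟨fun t => z + ψ t • w, contDiff_const.add (hψs.smul contDiff_const),
    fun t => hball (hψb t), by simp [hψ], ?_⟩
  simpa using (hψd.smul_const w).const_add z

/-- The derivative of `G` at `(y, z)` in the vertical direction `(0, w)`. -/
def verticalDeriv (G : E × F → ℝ) (y : E) (z w : F) : ℝ := fderiv ℝ G (y, z) (0, w)

theorem contDiffAt_pairing_sub {r : E × (Λ →L[ℝ] ℝ) → Λ →L[ℝ] ℝ}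
    {ℓ : E × (Λ →L[ℝ] ℝ) → ℝ} {a : E × (Λ →L[ℝ] ℝ)} (hr : ContDiffAt ℝ ∞ r a)
    (hℓ : ContDiffAt ℝ ∞ ℓ a) (f : Λ) : ContDiffAt ℝ ∞ (fun b => r b f - ℓ b) a :=
  (hr.clm_apply contDiffAt_const).sub hℓ

theorem contDiffAt_comp_vertical {r : E × F → F} {y : E} {z : ℝ → F} (hz : ContDiff ℝ ∞ z) {t : ℝ}
    (hr : ContDiffAt ℝ ∞ r (y, z t)) : ContDiffAt ℝ ∞ (fun t => r (y, z t)) t :=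
  hr.comp t (contDiffAt_const.prodMk hz.contDiffAt)

theorem verticalDeriv_eq_zero {G : E × F → ℝ} {y : E} {z : ℝ → F} {z₀ w : F}
    (hG : ContDiffAt ℝ ∞ G (y, z₀)) (hz : HasDerivAt z w 0) (h0 : z 0 = z₀)
    (h : HasDerivAt (fun t => G (y, z t)) 0 0) : verticalDeriv G y z₀ w = 0 := by
  subst h0
  have hcomp := HasFDerivAt.comp_hasDerivAt (l := G) (f := fun t => (y, z t)) (0 : ℝ)
    (hG.differentiableAt (by simp)).hasFDerivAt ((hasDerivAt_const _ _).prodMk hz)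
  exact (h.unique hcomp).symm

theorem eventually_of_nhdsPair {P : E × F → Prop} {y : ℝ → E} {z : ℝ → F} {S : Set ℝ} {t : ℝ}
    (hP : ∀ᶠ a in nhdsPair (y t) (z t), P a) (hy : ContDiffWithinAt ℝ 1 y S t)
    (hz : ContDiffWithinAt ℝ 1 z S t) : ∀ᶠ s in 𝓝[S] t, P (y s, z s) :=
  (hy.continuousWithinAt.prodMk hz.continuousWithinAt).eventually hP

/-- The curves `z` and `ζ` meet at `t` over the same base curve, so the contributions of `y` and `f`
to the two derivatives cancel and the difference of velocities is vertical, where `G` has derivative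
zero. -/
theorem hasDerivWithinAt_pairing_sub {G : E × (Λ →L[ℝ] ℝ) → ℝ} {y : ℝ → E}
    {z ζ : ℝ → Λ →L[ℝ] ℝ} {f : ℝ → Λ} {S : Set ℝ} {t : ℝ}
    (hG : ContDiffAt ℝ ∞ G (y t, z t)) (hGv : ∀ w, verticalDeriv G (y t) (z t) w = 0)
    (hy : ContDiffWithinAt ℝ 1 y S t) (hz : ContDiffWithinAt ℝ 1 z S t)
    (hζ : ContDiffWithinAt ℝ 1 ζ S t) (hf : ContDiffWithinAt ℝ 1 f S t)
    (h0 : z t = ζ t) :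
    HasDerivWithinAt (fun s => (G (y s, z s) + z s (f s - f t)) -
      (G (y s, ζ s) + ζ s (f s - f t))) 0 S t := by
  replace hG := hG.differentiableAt (by simp)
  replace hy := hy.differentiableWithinAt one_ne_zero
  replace hz := hz.differentiableWithinAt one_ne_zero
  replace hζ := hζ.differentiableWithinAt one_ne_zero
  replace hf := hf.differentiableWithinAt one_ne_zero
  have d1 := HasFDerivAt.comp_hasDerivWithinAt (l := G) t (f := fun s => (y s, z s))
    hG.hasFDerivAt (hy.hasDerivWithinAt.prodMk hz.hasDerivWithinAt)
  have d2 := HasFDerivAt.comp_hasDerivWithinAt (l := G) t (f := fun s => (y s, ζ s))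
    (by rw [← h0]; exact hG.hasFDerivAt) (hy.hasDerivWithinAt.prodMk hζ.hasDerivWithinAt)
  have d3 := hz.hasDerivWithinAt.clm_apply (hf.hasDerivWithinAt.sub_const (f t))
  have d4 := hζ.hasDerivWithinAt.clm_apply (hf.hasDerivWithinAt.sub_const (f t))
  refine ((d1.add d3).sub (d2.add d4)).congr_deriv ?_
  have hv := hGv (derivWithin z S t - derivWithin ζ S t)
  have : fderiv ℝ G (y t, z t) (derivWithin y S t, derivWithin z S t) -
      fderiv ℝ G (y t, z t) (derivWithin y S t, derivWithin ζ S t) = 0 := by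
    rw [← map_sub, Prod.mk_sub_mk, sub_self]
    exact hv
  simp only [sub_self, map_zero, h0] at this ⊢
  linarith

end Generic

/-! ### Stationarity of `W` in coordinates and along curves. -/

section PontryaginDeriv

variable {n k : ℕ} {N : Type*} [TopologicalSpace N]
  [ChartedSpace (EuclideanSpace ℝ (Fin (n + k))) N] [IsManifold (𝓡 (n + k)) ∞ N]
  {vol : ∀ q : N, FormFiber n k N q} {L : MultiVecBundle n k N → ℝ} {q₀ : N}

theorem contMDiffWithinAt_comp_of_eventually_mem {E₁ H₁ A E₂ H₂ B : Type*}
    [NormedAddCommGroup E₁] [NormedSpace ℝ E₁] [TopologicalSpace H₁]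
    {I₁ : ModelWithCorners ℝ E₁ H₁} [TopologicalSpace A] [ChartedSpace H₁ A]
    [NormedAddCommGroup E₂] [NormedSpace ℝ E₂] [TopologicalSpace H₂]
    {I₂ : ModelWithCorners ℝ E₂ H₂} [TopologicalSpace B] [ChartedSpace H₂ B]
    {E₃ H₃ C : Type*} [NormedAddCommGroup E₃] [NormedSpace ℝ E₃] [TopologicalSpace H₃]
    {I₃ : ModelWithCorners ℝ E₃ H₃} [TopologicalSpace C] [ChartedSpace H₃ C]
    {m : ℕ∞ω} {g : B → C} {f : A → B} {s : Set A} {t : Set B} {a : A}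
    (hg : ContMDiffWithinAt I₂ I₃ m g t (f a)) (hf : ContMDiffWithinAt I₁ I₂ m f s a)
    (h : ∀ᶠ b in 𝓝[s] a, f b ∈ t) : ContMDiffWithinAt I₁ I₃ m (fun b => g (f b)) s a := by
  have h1 : ContMDiffWithinAt I₁ I₃ m (g ∘ f) (s ∩ f ⁻¹' t) a :=
    hg.comp a (hf.mono inter_subset_left) fun x hx => hx.2
  exact h1.mono_of_mem_nhdsWithin (Filter.inter_mem self_mem_nhdsWithin h)

theorem contMDiffWithinAt_lagrangian_comp (hL : IsLagrangian vol L) {E' H' A : Type*}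
    [NormedAddCommGroup E'] [NormedSpace ℝ E'] [TopologicalSpace H']
    {I' : ModelWithCorners ℝ E' H'} [TopologicalSpace A] [ChartedSpace H' A] {s : Set A} {a : A}
    {m : ℕ∞ω} [ENat.LEInfty m] {f : A → MultiVecBundle n k N}
    (hf : ContMDiffWithinAt I' (multiVecI n k) m f s a) (ha : f a ∈ DOmegaTotal vol)
    (h : ∀ᶠ b in 𝓝[s] a, f b ∈ DOmegaTotal vol) :
    ContMDiffWithinAt I' 𝓘(ℝ, ℝ) m (fun b => L (f b)) s a :=
  contMDiffWithinAt_comp_of_eventually_mem ((hL _ ha).of_le ENat.LEInfty.out) hf h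

/-- In coordinates, `W(·, ·, p₀)` composed with the retraction is differentiable, and its vertical
derivative vanishes if `p₀` is stationary. -/
theorem exists_local_pontryagin (hn : 1 ≤ n) (hvol : IsSpaceTimeVolume vol)
    (hL : IsLagrangian vol L) {z₀ : MultiVecFiber n k N q₀} (hz₀ : z₀ ∈ DOmega vol q₀)
    {p₀ : FormFiber n k N q₀} (hst : IsStationary vol L q₀ z₀ p₀) :
    ∃ G : EuclideanSpace ℝ (Fin (n + k)) × MultiVecModel n k → ℝ,
      ContDiffAt ℝ ∞ G (extChartAt (𝓡 (n + k)) q₀ q₀, mvCoord q₀ ⟨q₀, z₀⟩) ∧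
      (∀ w, verticalDeriv G (extChartAt (𝓡 (n + k)) q₀ q₀) (mvCoord q₀ ⟨q₀, z₀⟩) w = 0) ∧
      ∀ᶠ a in nhdsPair (extChartAt (𝓡 (n + k)) q₀ q₀) (mvCoord q₀ ⟨q₀, z₀⟩),
        mvPoint q₀ a.1 a.2 ∈ DOmegaTotal vol →
          G a = a.2 (formCoord q₀ ⟨q₀, p₀⟩) - L (mvPoint q₀ a.1 a.2) := by
  have hs := mem_chart_source (EuclideanSpace ℝ (Fin (n + k))) q₀
  obtain ⟨r, hr⟩ := exists_local_retraction hn hvol hz₀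
  set y₀ := extChartAt (𝓡 (n + k)) q₀ q₀ with hy₀
  set z' := mvCoord q₀ ⟨q₀, z₀⟩ with hz'
  set f₀ := formCoord q₀ ⟨q₀, p₀⟩ with hf₀
  obtain ⟨h1, h2, h3, h4⟩ := hr.self_of_nhds
  have h5 : mvPoint q₀ y₀ z' = ⟨q₀, z₀⟩ := mvPoint_extChartAt hs z₀
  have h6 : r (y₀, z') = z' := h4 (by change mvPoint q₀ y₀ z' ∈ _; rw [h5]; exact hz₀)
  -- `W` with frozen covector, precomposed with the retraction: it is smooth near the point because
  -- `L` is evaluated only on `D^ω N`.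
  set G : EuclideanSpace ℝ (Fin (n + k)) × MultiVecModel n k → ℝ :=
    fun a => r a f₀ - L (mvPoint q₀ a.1 (r a)) with hG
  have hGd : ContDiffAt ℝ ∞ G (y₀, z') := by
    have hp := contMDiffAt_mvPoint (q₀ := q₀) (a := (y₀, z')) contDiffAt_fst h2 h1
    have hLd := contMDiffWithinAt_lagrangian_comp hL (s := univ) hp.contMDiffWithinAt h3
      (by rw [nhdsWithin_univ]; filter_upwards [hr] with a ha using ha.2.2.1)
    have hLd' := (contMDiffWithinAt_univ.1 hLd).contDiffAt
    exact contDiffAt_pairing_sub h2 hLd' f₀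
  refine ⟨G, hGd, fun w => ?_, ?_⟩
  -- The ambient curve `a` has velocity `w`; its retraction `c` is an admissible test curve, and `W`
  -- along `c` is `G` along `a`.
  · obtain ⟨a, has, hgood, ha0, had⟩ := exists_vertical_curve hr w
    set c : ℝ → MultiVecFiber n k N q₀ := fun t => mvOfCoord q₀ q₀ (r (y₀, a t)) with hc
    have hpt : ∀ t, mvPoint q₀ y₀ (r (y₀, a t)) = ⟨q₀, c t⟩ := fun t => mvPoint_extChartAt' hs _
    have hsm : ContMDiff 𝓘(ℝ, ℝ) (multiVecI n k) ∞
        (fun t => (⟨q₀, c t⟩ : MultiVecBundle n k N)) := by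
      intro t
      have := contMDiffAt_mvPoint (q₀ := q₀) (f := fun _ => y₀) (g := fun t => r (y₀, a t)) (a := t)
        contDiffAt_const (contDiffAt_comp_vertical has (hgood t).2.1) h1
      simpa only [hpt] using this
    have hcD : ∀ t, c t ∈ DOmega vol q₀ := by
      intro t
      have := (hgood t).2.2.1
      change mvPoint q₀ y₀ (r (y₀, a t)) ∈ _ at this
      rw [hpt] at this
      exact this
    have hc0 : c 0 = z₀ := by
      change mvOfCoord q₀ q₀ (r (y₀, a 0)) = z₀
      rw [ha0, h6, hz', mvOfCoord_mvCoord hs]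
    have hst' := hst c hsm hcD hc0
    have hWG : (fun t => pontryaginW L q₀ (c t) p₀) = fun t => G (y₀, a t) := by
      funext t
      change c t p₀ - L ⟨q₀, c t⟩ = r (y₀, a t) f₀ - L (mvPoint q₀ y₀ (r (y₀, a t)))
      rw [hpt, ← mvCoord_pairing hs (c t) p₀, mvCoord_mvOfCoord hs]
    rw [hWG] at hst'
    exact verticalDeriv_eq_zero hGd had ha0 hst'
  · filter_upwards [hr] with a ha hD
    change r a f₀ - L (mvPoint q₀ a.1 (r a)) = _
    rw [ha.2.2.2 hD]

theorem contDiffWithinAt_coord_of_contMDiffWithinAt {q : ℝ → N} {z : ∀ s, MultiVecFiber n k N (q s)}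
    {S : Set ℝ} {t : ℝ} (hz : ContMDiffWithinAt 𝓘(ℝ, ℝ) (multiVecI n k) 1
      (fun s => (⟨q s, z s⟩ : MultiVecBundle n k N)) S t) :
    ContDiffWithinAt ℝ 1 (fun s => mvCoord (q t) ⟨q s, z s⟩) S t ∧
      ContDiffWithinAt ℝ 1 (fun s => extChartAt (𝓡 (n + k)) (q t) (q s)) S t := by
  obtain ⟨h1, h2⟩ := (contMDiffWithinAt_mv_iff (q₀ := q t)
    (mem_chart_source (EuclideanSpace ℝ (Fin (n + k))) (q t))).1 hz
  refine ⟨h2.contDiffWithinAt, ?_⟩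
  have h3 := (contMDiffAt_extChartAt (I := 𝓡 (n + k)) (n := 1) (x := q t)).comp_contMDiffWithinAt
    t h1
  exact h3.contDiffWithinAt

/-- The envelope argument. At a stationary `z t`, the derivative of `W` does not see how the
multivector moves inside `D^ω N`; only the motion of `(q, p)` counts, and both families share it. -/
theorem hasDerivWithinAt_pontryaginW_sub (hn : 1 ≤ n) (hvol : IsSpaceTimeVolume vol)
    (hL : IsLagrangian vol L) {q : ℝ → N} {z ζ : ∀ s, MultiVecFiber n k N (q s)}
    {p : ∀ s, FormFiber n k N (q s)} {S : Set ℝ} {t : ℝ} (ht : t ∈ S)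
    (hz : ContMDiffWithinAt 𝓘(ℝ, ℝ) (multiVecI n k) 1
      (fun s => (⟨q s, z s⟩ : MultiVecBundle n k N)) S t)
    (hζ : ContMDiffWithinAt 𝓘(ℝ, ℝ) (multiVecI n k) 1
      (fun s => (⟨q s, ζ s⟩ : MultiVecBundle n k N)) S t)
    (hp : ContMDiffWithinAt 𝓘(ℝ, ℝ) (formI n k) 1
      (fun s => (⟨q s, p s⟩ : FormBundle n k N)) S t)
    (hzD : ∀ᶠ s in 𝓝[S] t, z s ∈ DOmega vol (q s))
    (hζD : ∀ᶠ s in 𝓝[S] t, ζ s ∈ DOmega vol (q s))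
    (h0 : z t = ζ t) (hst : IsStationary vol L (q t) (z t) (p t)) :
    HasDerivWithinAt
      (fun s => pontryaginW L (q s) (z s) (p s) - pontryaginW L (q s) (ζ s) (p s)) 0 S t := by
  have hs := mem_chart_source (EuclideanSpace ℝ (Fin (n + k))) (q t)
  obtain ⟨G, hG, hGv, hGe⟩ := exists_local_pontryagin hn hvol hL (hzD.self_of_nhdsWithin ht) hst
  obtain ⟨hz1, hy⟩ := contDiffWithinAt_coord_of_contMDiffWithinAt hz
  obtain ⟨hζ1, -⟩ := contDiffWithinAt_coord_of_contMDiffWithinAt hζ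
  obtain ⟨hq, hp1⟩ := (contMDiffWithinAt_form_iff (q₀ := q t) hs).1 hp
  have hp2 : ContDiffWithinAt ℝ 1 (fun s => formCoord (q t) ⟨q s, p s⟩) S t :=
    hp1.contDiffWithinAt
  set y := fun s => extChartAt (𝓡 (n + k)) (q t) (q s) with hydef
  set z' := fun s => mvCoord (q t) ⟨q s, z s⟩ with hz'
  set ζ' := fun s => mvCoord (q t) ⟨q s, ζ s⟩ with hζ'
  set f := fun s => formCoord (q t) ⟨q s, p s⟩ with hf
  have hzz : ζ' t = z' t := by simp only [hz', hζ', h0]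
  have hsrc : ∀ᶠ s in 𝓝[S] t, q s ∈ (chartAt (EuclideanSpace ℝ (Fin (n + k))) (q t)).source :=
    hq.continuousWithinAt.preimage_mem_nhdsWithin
      ((chartAt (EuclideanSpace ℝ (Fin (n + k))) (q t)).open_source.mem_nhds hs)
  -- `G` uses the covector frozen at time `t`; the pairing with `f s - f t` restores the moving one.
  have e1 : ∀ᶠ s in 𝓝[S] t, pontryaginW L (q s) (z s) (p s) =
      G (y s, z' s) + z' s (f s - f t) := by
    filter_upwards [eventually_of_nhdsPair hGe hy hz1, hzD,
      hsrc] with s h1 h2 h3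
    have h4 : mvPoint (q t) (y s) (z' s) = ⟨q s, z s⟩ := mvPoint_extChartAt h3 _
    have h5 := h1 (by rw [h4]; exact h2)
    change G (y s, z' s) = z' s (f t) - L (mvPoint (q t) (y s) (z' s)) at h5
    rw [h5, h4, pontryaginW, ← mvCoord_pairing h3 (z s) (p s), map_sub]
    ring
  have e2 : ∀ᶠ s in 𝓝[S] t, pontryaginW L (q s) (ζ s) (p s) =
      G (y s, ζ' s) + ζ' s (f s - f t) := by
    have hGe' : ∀ᶠ a in nhdsPair (y t) (ζ' t), mvPoint (q t) a.1 a.2 ∈ DOmegaTotal vol →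
          G a = a.2 (f t) - L (mvPoint (q t) a.1 a.2) := by rw [hzz]; exact hGe
    filter_upwards [eventually_of_nhdsPair hGe' hy hζ1, hζD,
      hsrc] with s h1 h2 h3
    have h4 : mvPoint (q t) (y s) (ζ' s) = ⟨q s, ζ s⟩ := mvPoint_extChartAt h3 _
    have h5 := h1 (by rw [h4]; exact h2)
    change G (y s, ζ' s) = ζ' s (f t) - L (mvPoint (q t) (y s) (ζ' s)) at h5
    rw [h5, h4, pontryaginW, ← mvCoord_pairing h3 (ζ s) (p s), map_sub]
    ring
  have hval : ∀ᶠ s in 𝓝[S] t,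
      pontryaginW L (q s) (z s) (p s) - pontryaginW L (q s) (ζ s) (p s) =
      (G (y s, z' s) + z' s (f s - f t)) - (G (y s, ζ' s) + ζ' s (f s - f t)) := by
    filter_upwards [e1, e2] with s h1 h2
    rw [h1, h2]
  exact (hasDerivWithinAt_pairing_sub hG hGv hy hz1 hζ1 hp2 hzz.symm).congr_of_eventuallyEq hval
    (hval.self_of_nhdsWithin ht)

end PontryaginDeriv

/-! ### Smooth paths in submanifolds of a vector space. -/

section Generic

variable {F : Type*} [NormedAddCommGroup F] [NormedSpace ℝ F]

/-- The neighbourhood filter of the norm topology. -/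
abbrev nhdsNorm {F : Type*} [NormedAddCommGroup F] (z : F) : Filter F := 𝓝 z

/-- In a straightening chart join the two points by a segment; it stays in a ball inside the target
and in the subspace `V`. -/
theorem IsSmoothSubmanifold.exists_path {T : Set F} (hT : IsSmoothSubmanifold T) {z₀ : F}
    (hz₀ : z₀ ∈ T) : ∀ᶠ w in nhdsNorm z₀, w ∈ T → ∃ c : ℝ → F,
      (∀ t ∈ Icc (0 : ℝ) 1, ContDiffAt ℝ ∞ c t ∧ c t ∈ T) ∧ c 0 = z₀ ∧ c 1 = w := by
  obtain ⟨Φ, V, hs, -, hsymm, hV⟩ := hT z₀ hz₀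
  obtain ⟨r, hr, hball⟩ := Metric.isOpen_iff.1 Φ.open_target _ (Φ.map_source hs)
  have h1 : ∀ᶠ w in 𝓝 z₀, w ∈ Φ.source := Φ.open_source.mem_nhds hs
  have h2 : ∀ᶠ w in 𝓝 z₀, Φ w ∈ Metric.ball (Φ z₀) r :=
    (Φ.continuousAt hs).eventually (Metric.ball_mem_nhds _ hr)
  filter_upwards [h1, h2] with w hw hwb hwT
  have hseg : ∀ t ∈ Icc (0 : ℝ) 1, Φ z₀ + t • (Φ w - Φ z₀) ∈ Metric.ball (Φ z₀) r := by
    intro t ht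
    have := (convex_ball (Φ z₀) r).add_smul_sub_mem (Metric.mem_ball_self hr) hwb ht
    exact this
  refine ⟨fun t => Φ.symm (Φ z₀ + t • (Φ w - Φ z₀)), fun t ht => ⟨?_, ?_⟩, ?_, ?_⟩
  · have hline : ContDiffAt ℝ ∞ (fun t : ℝ => Φ z₀ + t • (Φ w - Φ z₀)) t :=
      contDiffAt_const.add (contDiffAt_id.smul contDiffAt_const)
    have hmem := hball (hseg t ht)
    exact (hsymm.contDiffAt (Φ.open_target.mem_nhds hmem)).comp t hline
  · have hmem := hball (hseg t ht)
    rw [hV _ (Φ.map_target hmem), Φ.right_inv hmem]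
    exact V.add_mem ((hV _ hs).1 hz₀)
      (V.smul_mem _ (V.sub_mem ((hV _ hw).1 hwT) ((hV _ hs).1 hz₀)))
  · simp [Φ.left_inv hs]
  · simp [Φ.left_inv hw]

end Generic

/-! ### Constancy of `W` on `Z_q(p)` and smoothness of `ℋ`. -/

section Hamiltonian

variable {n k : ℕ} {N : Type*} [TopologicalSpace N]
  [ChartedSpace (EuclideanSpace ℝ (Fin (n + k))) N] [IsManifold (𝓡 (n + k)) ∞ N]
  {vol : ∀ q : N, FormFiber n k N q} {L : MultiVecBundle n k N → ℝ}
  {M : Set (FormBundle n k N)}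

theorem tendsto_mvCoord (q : N) (z₀ : MultiVecFiber n k N q) :
    Filter.Tendsto (fun z : MultiVecFiber n k N q => mvCoord q ⟨q, z⟩) (𝓝 z₀)
      (nhdsNorm (mvCoord q ⟨q, z₀⟩)) := by
  have h1 : Continuous (fun z : MultiVecFiber n k N q => (⟨q, z⟩ : MultiVecBundle n k N)) :=
    FiberBundle.continuous_totalSpaceMk (MultiVecModel n k) (MultiVecFiber n k N) q
  have h2 : ContinuousAt (trivializationAt (MultiVecModel n k) (MultiVecFiber n k N) q) ⟨q, z₀⟩ :=
    (trivializationAt (MultiVecModel n k) (MultiVecFiber n k N) q).continuousAt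
      ((Trivialization.mem_source _).2 (FiberBundle.mem_baseSet_trivializationAt' q))
  exact (continuous_snd.continuousAt.comp h2).comp h1.continuousAt

theorem contMDiffAt_mv_const {E' H' A : Type*} [NormedAddCommGroup E'] [NormedSpace ℝ E']
    [TopologicalSpace H'] {I' : ModelWithCorners ℝ E' H'} [TopologicalSpace A]
    [ChartedSpace H' A] {s : Set A} {a : A} {m : ℕ∞ω} [ENat.LEInfty m] (q : N)
    {c : A → MultiVecModel n k} (hc : ContMDiffWithinAt I' 𝓘(ℝ, MultiVecModel n k) m c s a) :
    ContMDiffWithinAt I' (multiVecI n k) m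
      (fun t => (⟨q, mvOfCoord q q (c t)⟩ : MultiVecBundle n k N)) s a := by
  have hs := mem_chart_source (EuclideanSpace ℝ (Fin (n + k))) q
  refine (contMDiffWithinAt_mv_iff (q₀ := q) hs).2 ⟨contMDiffWithinAt_const, ?_⟩
  simpa only [mvCoord_mvOfCoord hs] using hc

/-- Every point of a smooth path in `Z_q(p)` is stationary, so `W(q, ·, p)` has derivative zero
along it. Hence `W` is locally constant on `Z_q(p)`, and connectedness does the rest. -/
theorem pontryaginW_eq_of_mem_legendreZ (hn : 1 ≤ n) (hvol : IsSpaceTimeVolume vol)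
    (hL : IsLagrangian vol L) (hM : LegendreCorrespondenceHypothesis vol L M)
    {q : N} {p : FormFiber n k N q} (hμ : (⟨q, p⟩ : FormBundle n k N) ∈ M)
    {z₁ z₂ : MultiVecFiber n k N q}
    (hz₁ : z₁ ∈ legendreZ vol L q p) (hz₂ : z₂ ∈ legendreZ vol L q p) :
    pontryaginW L q z₁ p = pontryaginW L q z₂ p := by
  have hs := mem_chart_source (EuclideanSpace ℝ (Fin (n + k))) q
  refine (hM.connected _ hμ).isPreconnected.induction₂
    (fun z₁ z₂ => pontryaginW L q z₁ p = pontryaginW L q z₂ p) ?_ (fun _ _ _ _ _ _ h h' => h.trans h')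
    (fun _ _ _ _ h => h.symm) hz₁ hz₂
  intro z₀ hz₀
  have hpath := (hM.submanifold _ hμ).exists_path (mem_image_of_mem fibreCoord hz₀)
  filter_upwards [nhdsWithin_le_nhds ((tendsto_mvCoord q z₀).eventually hpath),
    self_mem_nhdsWithin] with w hw hwZ
  obtain ⟨c, hc, hc0, hc1⟩ := hw (mem_image_of_mem fibreCoord hwZ)
  set z : ℝ → MultiVecFiber n k N q := fun t => mvOfCoord q q (c t) with hz
  have hz0 : z 0 = z₀ := by rw [hz]; simp only [hc0]; exact mvOfCoord_mvCoord hs z₀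
  have hz1 : z 1 = w := by rw [hz]; simp only [hc1]; exact mvOfCoord_mvCoord hs w
  have hzZ : ∀ t ∈ Icc (0 : ℝ) 1, z t ∈ legendreZ vol L q p := by
    intro t ht
    obtain ⟨w', hw', he⟩ := (hc t ht).2
    have : z t = w' := by
      change mvOfCoord q q (c t) = w'
      rw [← he]
      exact mvOfCoord_mvCoord hs w'
    exact this ▸ hw'
  have hder : ∀ t ∈ Icc (0 : ℝ) 1,
      HasDerivWithinAt (fun s => pontryaginW L q (z s) p) 0 (Icc 0 1) t := by
    intro t ht
    have hzs : ContMDiffWithinAt 𝓘(ℝ, ℝ) (multiVecI n k) 1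
        (fun s => (⟨q, z s⟩ : MultiVecBundle n k N)) (Icc 0 1) t :=
      contMDiffAt_mv_const q
        (((hc t ht).1.of_le (by exact_mod_cast le_top)).contMDiffAt.contMDiffWithinAt)
    have hD : ∀ᶠ s in 𝓝[Icc (0 : ℝ) 1] t, z s ∈ DOmega vol q := by
      filter_upwards [self_mem_nhdsWithin] with s hs using (hzZ s hs).1
    -- The path is compared with the constant family at `z t`, with `(q, p)` fixed.
    have := hasDerivWithinAt_pontryaginW_sub hn hvol hL (q := fun _ => q) (z := z)
      (ζ := fun _ => z t) (p := fun _ => p) ht hzs contMDiffWithinAt_const contMDiffWithinAt_const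
      hD (Filter.Eventually.of_forall fun _ => (hzZ t ht).1) rfl (hzZ t ht).2
    simpa using this.add_const (pontryaginW L q (z t) p)
  have hconst := constant_of_derivWithin_zero (f := fun s => pontryaginW L q (z s) p)
    (fun t ht => (hder t ht).differentiableWithinAt)
    (fun t ht => (hder t (Ico_subset_Icc_self ht)).derivWithin
      (uniqueDiffOn_Icc zero_lt_one t (Ico_subset_Icc_self ht))) 1 (right_mem_Icc.2 zero_le_one)
  simp only [hz0, hz1] at hconst
  exact hconst.symm

theorem hamiltonian_eq (hn : 1 ≤ n) (hvol : IsSpaceTimeVolume vol)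
    (hL : IsLagrangian vol L) (hM : LegendreCorrespondenceHypothesis vol L M)
    {q : N} {p : FormFiber n k N q} (hμ : (⟨q, p⟩ : FormBundle n k N) ∈ M)
    {z : MultiVecFiber n k N q} (hz : z ∈ legendreZ vol L q p) :
    hamiltonian vol L ⟨q, p⟩ = pontryaginW L q z p := by
  have h : (legendreZ vol L q p).Nonempty := ⟨z, hz⟩
  rw [hamiltonian, dif_pos h]
  exact pontryaginW_eq_of_mem_legendreZ hn hvol hL hM hμ h.some_mem hz

section Smooth

variable {E' H' A : Type*} [NormedAddCommGroup E'] [NormedSpace ℝ E'] [TopologicalSpace H']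
  {I' : ModelWithCorners ℝ E' H'} [TopologicalSpace A] [ChartedSpace H' A] {s : Set A} {a : A}
  {m : ℕ∞ω} [ENat.LEInfty m]

theorem contMDiffWithinAt_model_apply {F : Type*} [NormedAddCommGroup F] [NormedSpace ℝ F]
    {z : A → F →L[ℝ] ℝ} {f : A → F} (hz : ContMDiffWithinAt I' 𝓘(ℝ, F →L[ℝ] ℝ) m z s a)
    (hf : ContMDiffWithinAt I' 𝓘(ℝ, F) m f s a) :
    ContMDiffWithinAt I' 𝓘(ℝ, ℝ) m (fun b => z b (f b)) s a := hz.clm_apply hf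

theorem contMDiffWithinAt_pairing {q : A → N} {z : ∀ b, MultiVecFiber n k N (q b)}
    {p : ∀ b, FormFiber n k N (q b)}
    (hz : ContMDiffWithinAt I' (multiVecI n k) m (fun b => (⟨q b, z b⟩ : MultiVecBundle n k N)) s a)
    (hp : ContMDiffWithinAt I' (formI n k) m (fun b => (⟨q b, p b⟩ : FormBundle n k N)) s a)
    (ha : a ∈ s) :
    ContMDiffWithinAt I' 𝓘(ℝ, ℝ) m (fun b => (z b (p b) : ℝ)) s a := by
  have hs := mem_chart_source (EuclideanSpace ℝ (Fin (n + k))) (q a)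
  obtain ⟨hq, hz1⟩ := (contMDiffWithinAt_mv_iff (q₀ := q a) hs).1 hz
  obtain ⟨-, hp1⟩ := (contMDiffWithinAt_form_iff (q₀ := q a) hs).1 hp
  refine (contMDiffWithinAt_model_apply hz1 hp1).congr_of_eventuallyEq_of_mem ?_ ha
  filter_upwards [hq.continuousWithinAt.preimage_mem_nhdsWithin
    ((chartAt (EuclideanSpace ℝ (Fin (n + k))) (q a)).open_source.mem_nhds hs)] with b hb
  exact (mvCoord_pairing hb (z b) (p b)).symm

theorem contMDiffWithinAt_pontryaginW (hL : IsLagrangian vol L) {q : A → N}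
    {z : ∀ b, MultiVecFiber n k N (q b)} {p : ∀ b, FormFiber n k N (q b)}
    (hz : ContMDiffWithinAt I' (multiVecI n k) m (fun b => (⟨q b, z b⟩ : MultiVecBundle n k N)) s a)
    (hp : ContMDiffWithinAt I' (formI n k) m (fun b => (⟨q b, p b⟩ : FormBundle n k N)) s a)
    (ha : a ∈ s) (hD : ∀ᶠ b in 𝓝[s] a, z b ∈ DOmega vol (q b)) :
    ContMDiffWithinAt I' 𝓘(ℝ, ℝ) m (fun b => pontryaginW L (q b) (z b) (p b)) s a :=
  (contMDiffWithinAt_pairing hz hp ha).sub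
    (contMDiffWithinAt_lagrangian_comp hL hz (hD.self_of_nhdsWithin ha) hD)

/-- A smooth family in `M` has, near any of its points, a smooth choice of `z ∈ Z_q(p)`. -/
theorem exists_smooth_legendreZ (hM : LegendreCorrespondenceHypothesis vol L M)
    {q : A → N} {p : ∀ b, FormFiber n k N (q b)}
    (hp : ContMDiffWithinAt I' (formI n k) m (fun b => (⟨q b, p b⟩ : FormBundle n k N)) s a)
    (ha : a ∈ s) (hmem : ∀ᶠ b in 𝓝[s] a, (⟨q b, p b⟩ : FormBundle n k N) ∈ M)
    {z₀ : MultiVecFiber n k N (q a)} (hz₀ : z₀ ∈ legendreZ vol L (q a) (p a)) :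
    ∃ ζ : ∀ b, MultiVecFiber n k N (q b), ζ a = z₀ ∧
      (∀ᶠ b in 𝓝[s] a, ζ b ∈ legendreZ vol L (q b) (p b)) ∧
      ContMDiffWithinAt I' (multiVecI n k) m
        (fun b => (⟨q b, ζ b⟩ : MultiVecBundle n k N)) s a := by
  obtain ⟨U, hU, ζ, hζ0, hζZ, hζs⟩ := hM.smooth_dependence ⟨q a, p a⟩
    (hmem.self_of_nhdsWithin ha) z₀ hz₀
  have hev : ∀ᶠ b in 𝓝[s] a, (⟨q b, p b⟩ : FormBundle n k N) ∈ M ∩ U := by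
    filter_upwards [hmem, hp.continuousWithinAt.preimage_mem_nhdsWithin hU] with b h1 h2
      using ⟨h1, h2⟩
  refine ⟨fun b => ζ ⟨q b, p b⟩, hζ0, ?_, ?_⟩
  · filter_upwards [hev] with b hb using hζZ _ hb
  · exact contMDiffWithinAt_comp_of_eventually_mem
      (f := fun b => (⟨q b, p b⟩ : FormBundle n k N)) (a := a)
      ((hζs _ (hev.self_of_nhdsWithin ha)).of_le ENat.LEInfty.out) hp hev

/-- The arbitrary choice in `hamiltonian` is harmless: on `M` it can be replaced, near a given
point, by the smooth choice `ζ`. -/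
theorem contMDiffWithinAt_hamiltonian (hn : 1 ≤ n) (hvol : IsSpaceTimeVolume vol)
    (hL : IsLagrangian vol L) (hM : LegendreCorrespondenceHypothesis vol L M)
    {f : A → FormBundle n k N} (hf : ContMDiffWithinAt I' (formI n k) m f s a)
    (ha : a ∈ s) (hmem : ∀ᶠ b in 𝓝[s] a, f b ∈ M) :
    ContMDiffWithinAt I' 𝓘(ℝ, ℝ) m (fun b => hamiltonian vol L (f b)) s a := by
  obtain ⟨z₀, hz₀⟩ := (hM.connected _ (hmem.self_of_nhdsWithin ha)).nonempty
  obtain ⟨ζ, -, hζZ, hζs⟩ := exists_smooth_legendreZ (q := fun b => (f b).proj)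
    (p := fun b => (f b).2) hM hf ha hmem hz₀
  refine (contMDiffWithinAt_pontryaginW hL hζs (p := fun b => (f b).2) hf ha
    (hζZ.mono fun b hb => hb.1)).congr_of_eventuallyEq_of_mem ?_ ha
  filter_upwards [hζZ, hmem] with b h1 h2
  exact hamiltonian_eq hn hvol hL hM h2 h1

end Smooth

/-- `W - ℋ` vanishes to first order along any curve which starts at a point of contact. -/
theorem hasDerivWithinAt_pontryaginW_sub_hamiltonian (hn : 1 ≤ n) (hvol : IsSpaceTimeVolume vol)
    (hL : IsLagrangian vol L) (hM : LegendreCorrespondenceHypothesis vol L M)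
    {q : ℝ → N} {z : ∀ s, MultiVecFiber n k N (q s)}
    {p : ∀ s, FormFiber n k N (q s)} {S : Set ℝ} {t : ℝ} (ht : t ∈ S)
    (hz : ContMDiffWithinAt 𝓘(ℝ, ℝ) (multiVecI n k) 1
      (fun s => (⟨q s, z s⟩ : MultiVecBundle n k N)) S t)
    (hp : ContMDiffWithinAt 𝓘(ℝ, ℝ) (formI n k) 1
      (fun s => (⟨q s, p s⟩ : FormBundle n k N)) S t)
    (hzD : ∀ᶠ s in 𝓝[S] t, z s ∈ DOmega vol (q s))
    (hmem : ∀ᶠ s in 𝓝[S] t, (⟨q s, p s⟩ : FormBundle n k N) ∈ M)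
    (h0 : z t ∈ legendreZ vol L (q t) (p t)) :
    HasDerivWithinAt
      (fun s => pontryaginW L (q s) (z s) (p s) - hamiltonian vol L ⟨q s, p s⟩) 0 S t := by
  obtain ⟨ζ, hζ0, hζZ, hζs⟩ := exists_smooth_legendreZ hM hp ht hmem h0
  have hev : ∀ᶠ s in 𝓝[S] t,
      pontryaginW L (q s) (z s) (p s) - hamiltonian vol L ⟨q s, p s⟩ =
        pontryaginW L (q s) (z s) (p s) - pontryaginW L (q s) (ζ s) (p s) := by
    filter_upwards [hζZ, hmem] with s h1 h2
    rw [hamiltonian_eq hn hvol hL hM h2 h1]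
  exact (hasDerivWithinAt_pontryaginW_sub hn hvol hL ht hz hζs hp hzD
    (hζZ.mono fun s hs => hs.1) hζ0.symm h0.2).congr_of_eventuallyEq hev
    (hev.self_of_nhdsWithin ht)

end Hamiltonian

/-! ### Integration of forms `f • ν` over compact sets -/

section Integration

open MeasureTheory

variable {n : ℕ} {X : Type*} [TopologicalSpace X] [ChartedSpace (EuclideanSpace ℝ (Fin n)) X]
  [IsManifold (𝓡 n) ∞ X] [T2Space X] [SigmaCompactSpace X]

theorem sign_mul_self_eq_abs (r : ℝ) : Real.sign r * r = |r| := by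
  rcases lt_trichotomy r 0 with h | rfl | h
  · rw [Real.sign_of_neg h, abs_of_neg h, neg_one_mul]
  · simp
  · rw [Real.sign_of_pos h, abs_of_pos h, one_mul]

theorem chartPartition_tsupport_subset (c : X) :
    tsupport (chartPartition n X c) ⊆ (extChartAt (𝓡 n) c).source := by
  rw [extChartAt_source]
  exact (SmoothPartitionOfUnity.exists_isSubordinate_chartAt_source (I := 𝓡 n) X).choose_spec c

/-- The part of the support of `ρ_c` in `K`, seen in the chart at `c`. -/
def chartPiece (n : ℕ) {X : Type*} [TopologicalSpace X]
    [ChartedSpace (EuclideanSpace ℝ (Fin n)) X] [IsManifold (𝓡 n) ∞ X] [T2Space X]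
    [SigmaCompactSpace X] (K : Set X) (c : X) : Set (EuclideanSpace ℝ (Fin n)) :=
  extChartAt (𝓡 n) c '' (K ∩ tsupport (chartPartition n X c))

theorem isCompact_chartPiece {K : Set X} (hK : IsCompact K) (c : X) :
    IsCompact (chartPiece n K c) :=
  (hK.inter_right (isClosed_tsupport _)).image_of_continuousOn
    ((continuousOn_extChartAt c).mono
      (inter_subset_right.trans (chartPartition_tsupport_subset c)))

theorem chartPiece_subset_target (K : Set X) (c : X) :
    chartPiece n K c ⊆ (extChartAt (𝓡 n) c).target := by
  rintro _ ⟨x, hx, rfl⟩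
  exact (extChartAt (𝓡 n) c).map_source (chartPartition_tsupport_subset c hx.2)

theorem symm_mem_of_mem_chartPiece {K : Set X} {c : X} {y : EuclideanSpace ℝ (Fin n)}
    (hy : y ∈ chartPiece n K c) : (extChartAt (𝓡 n) c).symm y ∈ K := by
  obtain ⟨x, hx, rfl⟩ := hy
  rw [(extChartAt (𝓡 n) c).left_inv (chartPartition_tsupport_subset c hx.2)]
  exact hx.1

theorem measurableSet_target_inter {K : Set X} (hK : IsCompact K) (c : X) :
    MeasurableSet ((extChartAt (𝓡 n) c).target ∩ (extChartAt (𝓡 n) c).symm ⁻¹' K) := by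
  obtain ⟨u, hu, he⟩ := continuousOn_iff_isClosed.1
    (continuousOn_extChartAt_symm (I := 𝓡 n) c) K hK.isClosed
  rw [inter_comm, he]
  exact hu.measurableSet.inter (isOpen_extChartAt_target c).measurableSet

theorem finite_charts {K : Set X} (hK : IsCompact K) :
    {c : X | (Function.support (chartPartition n X c) ∩ K).Nonempty}.Finite :=
  (chartPartition n X).locallyFinite.finite_nonempty_inter_compact hK

theorem formIntegral_congr {K : Set X} (hK : IsCompact K)
    {ν η ν' η' : ∀ x : X, TangentSpace (𝓡 n) x [⋀^Fin n]→L[ℝ] ℝ}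
    (hν : ∀ x ∈ K, ν x = ν' x) (hη : ∀ x ∈ K, η x = η' x) :
    formIntegral ν η K = formIntegral ν' η' K := by
  refine finsum_congr fun c => ?_
  refine setIntegral_congr_fun (measurableSet_target_inter hK c) fun y hy => ?_
  have h1 : formCoeff ν c y = formCoeff ν' c y := by
    simp only [formCoeff, pullbackForm, hν _ hy.2]
  have h2 : formCoeff η c y = formCoeff η' c y := by
    simp only [formCoeff, pullbackForm, hη _ hy.2]
  simp only [h1, h2]

theorem formCoeff_smul (f : X → ℝ) (ν : ∀ x : X, TangentSpace (𝓡 n) x [⋀^Fin n]→L[ℝ] ℝ) (c : X)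
    (y : EuclideanSpace ℝ (Fin n)) :
    formCoeff (fun x => f x • ν x) c y = f ((extChartAt (𝓡 n) c).symm y) * formCoeff ν c y := rfl

/-- If the form is a multiple of the orienting form `ν`, sign times coefficient gives the density
`|formCoeff ν c y|`. Each `ρ_c` vanishes outside its support, so only compact pieces and finitely
many charts contribute; linearity, monotonicity and bounds follow from those of ordinary integrals.
-/
theorem formIntegral_smul {K : Set X} (hK : IsCompact K) (f : X → ℝ)
    (ν : ∀ x : X, TangentSpace (𝓡 n) x [⋀^Fin n]→L[ℝ] ℝ) :
    formIntegral ν (fun x => f x • ν x) K = ∑ c ∈ (finite_charts (n := n) hK).toFinset,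
      ∫ y in chartPiece n K c, chartPartition n X c ((extChartAt (𝓡 n) c).symm y) *
        (f ((extChartAt (𝓡 n) c).symm y) * |formCoeff ν c y|) := by
  have hsub : ∀ c, chartPiece n K c ⊆
      (extChartAt (𝓡 n) c).target ∩ (extChartAt (𝓡 n) c).symm ⁻¹' K :=
    fun c y hy => ⟨chartPiece_subset_target K c hy, symm_mem_of_mem_chartPiece hy⟩
  have hint : ∀ c, ∫ y in (extChartAt (𝓡 n) c).target ∩ (extChartAt (𝓡 n) c).symm ⁻¹' K,
      chartPartition n X c ((extChartAt (𝓡 n) c).symm y) *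
        (Real.sign (formCoeff ν c y) * formCoeff (fun x => f x • ν x) c y) =
      ∫ y in chartPiece n K c, chartPartition n X c ((extChartAt (𝓡 n) c).symm y) *
        (f ((extChartAt (𝓡 n) c).symm y) * |formCoeff ν c y|) := by
    intro c
    rw [setIntegral_eq_of_subset_of_forall_sdiff_eq_zero (measurableSet_target_inter hK c) (hsub c)]
    · refine integral_congr_ae (Filter.Eventually.of_forall fun y => ?_)
      simp only [formCoeff_smul]
      rw [← sign_mul_self_eq_abs]
      ring
    · intro y hy
      have : (extChartAt (𝓡 n) c).symm y ∉ tsupport (chartPartition n X c) := by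
        intro h
        exact hy.2 ⟨_, ⟨hy.1.2, h⟩, (extChartAt (𝓡 n) c).right_inv hy.1.1⟩
      rw [image_eq_zero_of_notMem_tsupport this, zero_mul]
  rw [formIntegral]
  simp only [hint]
  refine finsum_eq_sum_of_support_subset _ fun c hc => ?_
  rw [Finite.coe_toFinset, mem_ofPred_eq]
  by_contra hne
  refine hc (setIntegral_eq_zero_of_forall_eq_zero fun y hy => ?_)
  have : chartPartition n X c ((extChartAt (𝓡 n) c).symm y) = 0 := by
    by_contra h
    exact hne ⟨_, h, symm_mem_of_mem_chartPiece hy⟩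
  rw [this, zero_mul]

variable {K : Set X} {ν : ∀ x : X, TangentSpace (𝓡 n) x [⋀^Fin n]→L[ℝ] ℝ} {f g : X → ℝ}

theorem integrableOn_chartPiece (hK : IsCompact K)
    (hν : ∀ c : X, ContinuousOn (formCoeff ν c) (chartPiece n K c)) (hf : ContinuousOn f K) (c : X) :
    IntegrableOn (fun y => chartPartition n X c ((extChartAt (𝓡 n) c).symm y) *
        (f ((extChartAt (𝓡 n) c).symm y) * |formCoeff ν c y|)) (chartPiece n K c) := by
  refine ContinuousOn.integrableOn_compact (isCompact_chartPiece hK c) ?_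
  have hs : ContinuousOn (extChartAt (𝓡 n) c).symm (chartPiece n K c) :=
    (continuousOn_extChartAt_symm c).mono (chartPiece_subset_target K c)
  exact ((chartPartition n X c).contMDiff.continuous.comp_continuousOn hs).mul
    ((hf.comp hs fun y hy => symm_mem_of_mem_chartPiece hy).mul (hν c).abs)

theorem formIntegral_smul_sub (hK : IsCompact K)
    (hν : ∀ c : X, ContinuousOn (formCoeff ν c) (chartPiece n K c))
    (hf : ContinuousOn f K) (hg : ContinuousOn g K) :
    formIntegral ν (fun x => f x • ν x) K - formIntegral ν (fun x => g x • ν x) K =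
      formIntegral ν (fun x => (f x - g x) • ν x) K := by
  rw [formIntegral_smul hK, formIntegral_smul hK, formIntegral_smul hK, ← Finset.sum_sub_distrib]
  refine Finset.sum_congr rfl fun c _ => ?_
  rw [← integral_sub (integrableOn_chartPiece hK hν hf c) (integrableOn_chartPiece hK hν hg c)]
  refine integral_congr_ae (Filter.Eventually.of_forall fun y => ?_)
  simp only
  ring

theorem formIntegral_const_mul (hK : IsCompact K) (a : ℝ) :
    formIntegral ν (fun x => (a * f x) • ν x) K = a * formIntegral ν (fun x => f x • ν x) K := by
  rw [formIntegral_smul hK, formIntegral_smul hK, Finset.mul_sum]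
  refine Finset.sum_congr rfl fun c _ => ?_
  rw [← integral_const_mul]
  refine integral_congr_ae (Filter.Eventually.of_forall fun y => ?_)
  simp only
  ring

theorem formIntegral_smul_mono (hK : IsCompact K)
    (hν : ∀ c : X, ContinuousOn (formCoeff ν c) (chartPiece n K c))
    (hf : ContinuousOn f K) (hg : ContinuousOn g K) (hfg : ∀ x ∈ K, f x ≤ g x) :
    formIntegral ν (fun x => f x • ν x) K ≤ formIntegral ν (fun x => g x • ν x) K := by
  rw [formIntegral_smul hK, formIntegral_smul hK]
  refine Finset.sum_le_sum fun c _ => ?_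
  refine setIntegral_mono_on (integrableOn_chartPiece hK hν hf c)
    (integrableOn_chartPiece hK hν hg c) (isCompact_chartPiece hK c).measurableSet fun y hy => ?_
  have := (chartPartition n X).nonneg c ((extChartAt (𝓡 n) c).symm y)
  have := hfg _ (symm_mem_of_mem_chartPiece (n := n) hy)
  gcongr

theorem abs_formIntegral_smul_le (hK : IsCompact K) {δ : ℝ} (hδ : ∀ x ∈ K, |f x| ≤ δ)
    {B : X → ℝ} (hB : ∀ c, ∀ y ∈ chartPiece n K c, |formCoeff ν c y| ≤ B c) :
    |formIntegral ν (fun x => f x • ν x) K| ≤ δ *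
      ∑ c ∈ (finite_charts (n := n) hK).toFinset, |B c| * volume.real (chartPiece n K c) := by
  rw [formIntegral_smul hK, Finset.mul_sum]
  refine (Finset.abs_sum_le_sum_abs _ _).trans (Finset.sum_le_sum fun c _ => ?_)
  rw [← mul_assoc]
  refine norm_setIntegral_le_of_norm_le_const (μ := volume) (s := chartPiece n K c)
    (C := δ * |B c|) (E := ℝ) (isCompact_chartPiece hK c).measure_lt_top fun y hy => ?_
  have h0 := (chartPartition n X).nonneg c ((extChartAt (𝓡 n) c).symm y)
  have h1 := (chartPartition n X).le_one c ((extChartAt (𝓡 n) c).symm y)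
  have h2 := hδ _ (symm_mem_of_mem_chartPiece (n := n) hy)
  rw [Real.norm_eq_abs, abs_mul, abs_mul, abs_abs, abs_of_nonneg h0]
  have h3 := (hB c y hy).trans (le_abs_self _)
  have h4 : 0 ≤ δ := (abs_nonneg _).trans h2
  calc _ ≤ 1 * (δ * |B c|) := by gcongr
    _ = _ := one_mul _

/-- All pieces are nonnegative. A chart whose partition function is positive at `x₀` has an
integrand that is nonzero on a neighbourhood of the image of `x₀`, hence on a set of positive
measure. -/
theorem formIntegral_smul_pos (hK : IsCompact K)
    (hν : ∀ c : X, ContinuousOn (formCoeff ν c) (chartPiece n K c))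
    (hf : ContinuousOn f K) (hf0 : ∀ x ∈ K, 0 ≤ f x) {x₀ : X} (hx₀ : K ∈ 𝓝 x₀) (hfx₀ : 0 < f x₀)
    (hνx₀ : ∀ c, x₀ ∈ (extChartAt (𝓡 n) c).source → formCoeff ν c (extChartAt (𝓡 n) c x₀) ≠ 0) :
    0 < formIntegral ν (fun x => f x • ν x) K := by
  rw [formIntegral_smul hK]
  have hnn : ∀ c, ∀ y ∈ chartPiece n K c,
      0 ≤ chartPartition n X c ((extChartAt (𝓡 n) c).symm y) *
        (f ((extChartAt (𝓡 n) c).symm y) * |formCoeff ν c y|) := fun c y hy =>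
    mul_nonneg ((chartPartition n X).nonneg c _)
      (mul_nonneg (hf0 _ (symm_mem_of_mem_chartPiece hy)) (abs_nonneg _))
  obtain ⟨c, hc⟩ := (chartPartition n X).exists_pos_of_mem (mem_univ x₀)
  have hcs : x₀ ∈ (extChartAt (𝓡 n) c).source :=
    chartPartition_tsupport_subset c (subset_tsupport _ hc.ne')
  refine Finset.sum_pos' (fun c _ => setIntegral_nonneg (isCompact_chartPiece hK c).measurableSet
    (hnn c)) ⟨c, ?_, ?_⟩
  · rw [Finite.mem_toFinset]
    exact ⟨x₀, hc.ne', mem_of_mem_nhds hx₀⟩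
  · rw [setIntegral_pos_iff_support_of_nonneg_ae
      ((ae_restrict_iff' (isCompact_chartPiece hK c).measurableSet).2
        (Filter.Eventually.of_forall fun y hy => hnn c y hy)) (integrableOn_chartPiece hK hν hf c)]
    set y₀ := extChartAt (𝓡 n) c x₀
    have hy₀ : (extChartAt (𝓡 n) c).symm y₀ = x₀ := (extChartAt (𝓡 n) c).left_inv hcs
    have hyt : y₀ ∈ (extChartAt (𝓡 n) c).target := (extChartAt (𝓡 n) c).map_source hcs
    have hsupp : Function.support (chartPartition n X c) ∈ 𝓝 x₀ :=
      ((chartPartition n X c).contMDiff.continuous.isOpen_support).mem_nhds hc.ne'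
    have hcont : ContinuousAt (extChartAt (𝓡 n) c).symm y₀ :=
      continuousAt_extChartAt_symm'' hyt
    have hpiece : chartPiece n K c ∈ 𝓝 y₀ := by
      have h1 := hcont.preimage_mem_nhds (by rw [hy₀]; exact Filter.inter_mem hx₀ hsupp)
      filter_upwards [h1, (isOpen_extChartAt_target c).mem_nhds hyt] with y hy hy'
      exact ⟨_, ⟨hy.1, subset_tsupport _ hy.2⟩, (extChartAt (𝓡 n) c).right_inv hy'⟩
    have hev : ∀ᶠ y in 𝓝 y₀, chartPartition n X c ((extChartAt (𝓡 n) c).symm y) *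
        (f ((extChartAt (𝓡 n) c).symm y) * |formCoeff ν c y|) ≠ 0 := by
      refine ContinuousAt.eventually_ne ?_ ?_
      · have h1 : ContinuousAt (fun y => chartPartition n X c ((extChartAt (𝓡 n) c).symm y)) y₀ :=
          (chartPartition n X c).contMDiff.continuous.continuousAt.comp hcont
        have h2 : ContinuousAt (fun y => f ((extChartAt (𝓡 n) c).symm y)) y₀ :=
          (hy₀.symm ▸ hf.continuousAt hx₀ : ContinuousAt f _).comp hcont
        exact h1.mul (h2.mul ((hν c).continuousAt hpiece).abs)
      · rw [hy₀]
        exact mul_ne_zero hc.ne' (mul_ne_zero hfx₀.ne' (abs_ne_zero.2 (hνx₀ c hcs)))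
    exact Measure.measure_pos_of_mem_nhds volume (Filter.inter_mem hev hpiece)

end Integration

/-! ### Tangent multivectors of families of maps -/

section Frame

variable {n : ℕ} {X : Type*} [TopologicalSpace X] [ChartedSpace (EuclideanSpace ℝ (Fin n)) X]
  [IsManifold (𝓡 n) ∞ X]

/-- The frame of the chart at `c`. -/
def chartFrame (c x : X) (i : Fin n) : TangentSpace (𝓡 n) x :=
  (trivializationAt (EuclideanSpace ℝ (Fin n)) (TangentSpace (𝓡 n) : X → Type _) c).symmL ℝ x
    (EuclideanSpace.single i (1 : ℝ) : EuclideanSpace ℝ (Fin n))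

theorem mfderiv_extChartAt_symm_single {c x : X} (hx : x ∈ (extChartAt (𝓡 n) c).source)
    (i : Fin n) :
    mfderiv 𝓘(ℝ, EuclideanSpace ℝ (Fin n)) (𝓡 n) (extChartAt (𝓡 n) c).symm (extChartAt (𝓡 n) c x)
      (EuclideanSpace.single i (1 : ℝ) : EuclideanSpace ℝ (Fin n)) = chartFrame c x i := by
  rw [chartFrame, TangentBundle.symmL_trivializationAt (by rwa [extChartAt_source] at hx)]
  rw [ModelWithCorners.range_eq_univ, mfderivWithin_univ]
  rfl

theorem mfderiv_symm_single {c : X} {y : EuclideanSpace ℝ (Fin n)}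
    (hy : y ∈ (extChartAt (𝓡 n) c).target) (i : Fin n) :
    mfderiv 𝓘(ℝ, EuclideanSpace ℝ (Fin n)) (𝓡 n) (extChartAt (𝓡 n) c).symm y
      (EuclideanSpace.single i (1 : ℝ) : EuclideanSpace ℝ (Fin n)) =
        chartFrame c ((extChartAt (𝓡 n) c).symm y) i := by
  rw [← mfderiv_extChartAt_symm_single ((extChartAt (𝓡 n) c).map_target hy),
    (extChartAt (𝓡 n) c).right_inv hy]

end Frame

section TangentMultiVec

variable {n k : ℕ} {N : Type*} [TopologicalSpace N]
  [ChartedSpace (EuclideanSpace ℝ (Fin (n + k))) N] [IsManifold (𝓡 (n + k)) ∞ N]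

theorem contMDiffWithinAt_wedge_clm {E' H' A : Type*} [NormedAddCommGroup E'] [NormedSpace ℝ E']
    [TopologicalSpace H'] {I' : ModelWithCorners ℝ E' H'} [TopologicalSpace A] [ChartedSpace H' A]
    {s : Set A} {a : A} {F G : Type*} [NormedAddCommGroup F] [NormedSpace ℝ F]
    [FiniteDimensional ℝ F] [NormedAddCommGroup G] [NormedSpace ℝ G] {ℓ : A → G →L[ℝ] F}
    {ι : Type*} [Fintype ι] [DecidableEq ι]
    (hℓ : ContMDiffWithinAt I' 𝓘(ℝ, G →L[ℝ] F) ∞ ℓ s a) (v : ι → G) :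
    ContMDiffWithinAt I' 𝓘(ℝ, (F [⋀^ι]→L[ℝ] ℝ) →L[ℝ] ℝ) ∞
      (fun b => ContinuousAlternatingMap.apply ℝ F ℝ (fun i => ℓ b (v i))) s a := by
  have h : ContDiff ℝ ∞ (fun ℓ : G →L[ℝ] F =>
      ContinuousAlternatingMap.apply ℝ F ℝ (fun i => ℓ (v i))) :=
    contDiff_alternating_eval.comp (contDiff_pi.2 fun i => contDiff_id.clm_apply contDiff_const)
  exact h.contMDiff.contMDiffAt.comp_contMDiffWithinAt a hℓ

/-- In coordinates the partial differential in `y` is smooth in `(s, y)`, and the wedge of its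
columns depends polynomially on it. -/
theorem contMDiffWithinAt_wedge_model {f : ℝ → EuclideanSpace ℝ (Fin n) → N} {S : Set ℝ} {s₀ : ℝ}
    {y₀ : EuclideanSpace ℝ (Fin n)} (hs₀ : s₀ ∈ S)
    (hf : ContMDiffWithinAt (𝓘(ℝ, ℝ).prod (𝓡 n)) (𝓡 (n + k)) ∞
      (fun a : ℝ × EuclideanSpace ℝ (Fin n) => f a.1 a.2) (S ×ˢ univ) (s₀, y₀)) :
    ContMDiffWithinAt (𝓘(ℝ, ℝ).prod (𝓡 n)) (multiVecI n k) ∞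
      (fun a : ℝ × EuclideanSpace ℝ (Fin n) => (⟨f a.1 a.2, wedge fun i =>
        mfderiv (𝓡 n) (𝓡 (n + k)) (f a.1) a.2 (EuclideanSpace.single i (1 : ℝ))⟩ :
          MultiVecBundle n k N)) (S ×ˢ univ) (s₀, y₀) := by
  have hs := mem_chart_source (EuclideanSpace ℝ (Fin (n + k))) (f s₀ y₀)
  rw [contMDiffWithinAt_mv_iff (q₀ := f s₀ y₀) hs]
  refine ⟨hf, ?_⟩
  have hd : ContMDiffWithinAt (𝓘(ℝ, ℝ).prod (𝓡 n))
      𝓘(ℝ, EuclideanSpace ℝ (Fin n) →L[ℝ] EuclideanSpace ℝ (Fin (n + k))) ∞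
      (inTangentCoordinates (𝓡 n) (𝓡 (n + k)) Prod.snd
        (fun a : ℝ × EuclideanSpace ℝ (Fin n) => f a.1 a.2)
        (fun a => mfderivWithin (𝓡 n) (𝓡 (n + k)) (f a.1) univ a.2) (s₀, y₀))
      (S ×ˢ univ) (s₀, y₀) := by
    refine ContMDiffWithinAt.mfderivWithin (n := ∞) (u := univ)
      (f := fun a : ℝ × EuclideanSpace ℝ (Fin n) => f a.1) (g := Prod.snd) ?_
      contMDiffWithinAt_snd ⟨hs₀, mem_univ _⟩ (mapsTo_univ _ _) le_rfl uniqueMDiffOn_univ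
    refine contMDiffWithinAt_comp_of_eventually_mem
      (I₂ := 𝓘(ℝ, ℝ).prod (𝓡 n)) (g := fun a : ℝ × EuclideanSpace ℝ (Fin n) => f a.1 a.2)
      (f := fun b : (ℝ × EuclideanSpace ℝ (Fin n)) × EuclideanSpace ℝ (Fin n) => (b.1.1, b.2))
      (a := ((s₀, y₀), y₀)) hf ?_ ?_
    · have h1 : ContMDiff ((𝓘(ℝ, ℝ).prod (𝓡 n)).prod (𝓡 n)) 𝓘(ℝ, ℝ) ∞
          (fun b : (ℝ × EuclideanSpace ℝ (Fin n)) × EuclideanSpace ℝ (Fin n) => b.1.1) :=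
        contMDiff_fst.comp contMDiff_fst
      exact h1.contMDiffAt.contMDiffWithinAt.prodMk contMDiffWithinAt_snd
    · filter_upwards [self_mem_nhdsWithin] with b hb using ⟨hb.1.1, mem_univ _⟩
  refine (contMDiffWithinAt_wedge_clm hd
    (fun i : Fin n => EuclideanSpace.single i (1 : ℝ))).congr_of_eventuallyEq_of_mem ?_
      (mk_mem_prod hs₀ (mem_univ y₀))
  filter_upwards [hf.continuousWithinAt.preimage_mem_nhdsWithin
    ((chartAt (EuclideanSpace ℝ (Fin (n + k))) (f s₀ y₀)).open_source.mem_nhds hs)] with b hb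
  rw [mvCoord_wedge hb]
  refine congrArg _ (funext fun i => ?_)
  simp only [inTangentCoordinates, ContinuousLinearMap.inCoordinates, mfderivWithin_univ]
  rw [TangentBundle.symmL_model_space]
  rfl

variable {X : Type*} [TopologicalSpace X] [ChartedSpace (EuclideanSpace ℝ (Fin n)) X]
  [IsManifold (𝓡 n) ∞ X]

theorem contMDiffWithinAt_slice {f : ℝ → X → N} {S : Set ℝ}
    (hf : ContMDiffOn (𝓘(ℝ, ℝ).prod (𝓡 n)) (𝓡 (n + k)) ∞
      (fun a : ℝ × X => f a.1 a.2) (S ×ˢ univ)) {s : ℝ} (hs : s ∈ S) :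
    ContMDiff (𝓡 n) (𝓡 (n + k)) ∞ (f s) := fun x =>
  contMDiffWithinAt_univ.1 (contMDiffWithinAt_comp_of_eventually_mem
    (f := fun x : X => (s, x)) (a := x) (hf (s, x) ⟨hs, mem_univ _⟩)
    (contMDiffWithinAt_const.prodMk contMDiffWithinAt_id)
    (Filter.Eventually.of_forall fun _ => ⟨hs, mem_univ _⟩))

/-- Reduction to the model space through the chart at `c`. The fixed chart matters: `stdFrame x`
uses the preferred chart at `x`, which may jump with `x`. -/
theorem contMDiffWithinAt_wedge_chartFrame {f : ℝ → X → N} {S : Set ℝ}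
    (hf : ContMDiffOn (𝓘(ℝ, ℝ).prod (𝓡 n)) (𝓡 (n + k)) ∞
      (fun a : ℝ × X => f a.1 a.2) (S ×ˢ univ)) {s₀ : ℝ} (hs₀ : s₀ ∈ S) {c x₀ : X}
    (hx₀ : x₀ ∈ (extChartAt (𝓡 n) c).source) :
    ContMDiffWithinAt (𝓘(ℝ, ℝ).prod (𝓡 n)) (multiVecI n k) ∞
      (fun a : ℝ × X => (⟨f a.1 a.2, wedge fun i =>
        mfderiv (𝓡 n) (𝓡 (n + k)) (f a.1) a.2 (chartFrame c a.2 i)⟩ : MultiVecBundle n k N))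
      (S ×ˢ univ) (s₀, x₀) := by
  set e := extChartAt (𝓡 n) c with he
  have hes : e.source ∈ 𝓝 x₀ := extChartAt_source_mem_nhds' hx₀
  have hf' : ContMDiffWithinAt (𝓘(ℝ, ℝ).prod (𝓡 n)) (𝓡 (n + k)) ∞
      (fun a : ℝ × EuclideanSpace ℝ (Fin n) => f a.1 (e.symm a.2)) (S ×ˢ univ) (s₀, e x₀) := by
    refine contMDiffWithinAt_comp_of_eventually_mem
      (f := fun a : ℝ × EuclideanSpace ℝ (Fin n) => (a.1, e.symm a.2)) (a := (s₀, e x₀))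
      (hf _ ⟨hs₀, mem_univ _⟩) ?_ ?_
    · refine contMDiffWithinAt_fst.prodMk (ContMDiffAt.comp_contMDiffWithinAt (I' := 𝓡 n)
        (s₀, e x₀) (g := e.symm) (f := Prod.snd) ?_ contMDiffWithinAt_snd)
      exact (contMDiffOn_extChartAt_symm c).contMDiffAt
        ((isOpen_extChartAt_target c).mem_nhds (e.map_source hx₀))
    · filter_upwards [self_mem_nhdsWithin] with b hb using ⟨hb.1, mem_univ _⟩
  have hw := contMDiffWithinAt_wedge_model (f := fun s y => f s (e.symm y)) hs₀ hf'
  have hcomp : ContMDiffWithinAt (𝓘(ℝ, ℝ).prod (𝓡 n)) (𝓘(ℝ, ℝ).prod (𝓡 n)) ∞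
      (fun a : ℝ × X => (a.1, e a.2)) (S ×ˢ univ) (s₀, x₀) := by
    refine contMDiffWithinAt_fst.prodMk (ContMDiffAt.comp_contMDiffWithinAt (I' := 𝓡 n)
      (s₀, x₀) (g := e) (f := Prod.snd) ?_ contMDiffWithinAt_snd)
    exact contMDiffAt_extChartAt' (by rwa [he, extChartAt_source] at hx₀)
  refine (contMDiffWithinAt_comp_of_eventually_mem
    (f := fun a : ℝ × X => (a.1, e a.2)) (a := (s₀, x₀)) hw hcomp ?_).congr_of_eventuallyEq_of_mem
      ?_ (mk_mem_prod hs₀ (mem_univ x₀))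
  · filter_upwards [self_mem_nhdsWithin] with b hb using ⟨hb.1, mem_univ _⟩
  · filter_upwards [self_mem_nhdsWithin, continuous_snd.continuousWithinAt.preimage_mem_nhdsWithin
      (x := (s₀, x₀)) (s := S ×ˢ univ) hes] with b hb hbe
    obtain ⟨s, x⟩ := b
    change x ∈ e.source at hbe
    have hx : e.symm (e x) = x := e.left_inv hbe
    have key : ∀ x', x' = x → (⟨f s x, wedge fun i => mfderiv (𝓡 n) (𝓡 (n + k)) (f s) x
        (chartFrame c x i)⟩ : MultiVecBundle n k N) = ⟨f s x', wedge fun i =>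
        mfderiv (𝓡 n) (𝓡 (n + k)) (f s) x' (chartFrame c x' i)⟩ := by
      rintro _ rfl
      rfl
    rw [key _ hx]
    refine congrArg (fun v => (⟨f s (e.symm (e x)), wedge v⟩ : MultiVecBundle n k N))
      (funext fun i => ?_)
    have h1 : MDifferentiableAt (𝓡 n) (𝓡 (n + k)) (f s) (e.symm (e x)) :=
      ((contMDiffWithinAt_slice hf hb.1).contMDiffAt).mdifferentiableAt (by simp)
    have h2 : MDifferentiableAt 𝓘(ℝ, EuclideanSpace ℝ (Fin n)) (𝓡 n) e.symm (e x) :=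
      ((contMDiffOn_extChartAt_symm (n := ∞) c).contMDiffAt
        ((isOpen_extChartAt_target c).mem_nhds (e.map_source hbe))).mdifferentiableAt (by simp)
    have h3 := mfderiv_comp (I' := 𝓡 n) (e x) h1 h2
    exact (congrArg (mfderiv (𝓡 n) (𝓡 (n + k)) (f s) (e.symm (e x)))
      (mfderiv_symm_single (e.map_source hbe) i).symm).trans
        (DFunLike.congr_fun h3 (EuclideanSpace.single i (1 : ℝ))).symm

end TangentMultiVec
-- Forms of top degree and comparison of frames.
section TopForms

variable {n : ℕ}

theorem alternating_apply_eq_det_mul (α : EuclideanSpace ℝ (Fin n) [⋀^Fin n]→L[ℝ] ℝ)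
    (v : Fin n → EuclideanSpace ℝ (Fin n)) :
    α v = Matrix.det (Matrix.of fun i j => v i j) * α fun i => EuclideanSpace.single i (1 : ℝ) := by
  rw [← alternating_map_linearCombination]
  refine congrArg α (funext fun i => ?_)
  ext j
  simp [Pi.single_apply]

theorem alternating_ext_single {α β : EuclideanSpace ℝ (Fin n) [⋀^Fin n]→L[ℝ] ℝ}
    (h : (α fun i => EuclideanSpace.single i (1 : ℝ)) = β fun i => EuclideanSpace.single i (1 : ℝ)) :
    α = β := by
  ext v
  rw [alternating_apply_eq_det_mul α, alternating_apply_eq_det_mul β, h]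

variable {X : Type*} [TopologicalSpace X] [ChartedSpace (EuclideanSpace ℝ (Fin n)) X]

theorem topForm_ext {x : X} {α β : TangentSpace (𝓡 n) x [⋀^Fin n]→L[ℝ] ℝ}
    (h : α (stdFrame x) = β (stdFrame x)) : α = β :=
  alternating_ext_single (α := α) (β := β) h

theorem topForm_ne_zero_iff {x : X} {α : TangentSpace (𝓡 n) x [⋀^Fin n]→L[ℝ] ℝ} :
    α ≠ 0 ↔ α (stdFrame x) ≠ 0 := by
  refine not_congr ⟨fun h => by rw [h]; rfl, fun h => topForm_ext h⟩

variable [IsManifold (𝓡 n) ∞ X]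

/-- The factor is the determinant of the chart frame in the standard frame. It is nonzero because
the standard volume form, pulled back by the coordinates at `c`, takes the value `1` on the chart
frame. -/
theorem exists_chartFrame_eq {c x : X} (hx : x ∈ (extChartAt (𝓡 n) c).source) :
    ∃ d : ℝ, d ≠ 0 ∧ ∀ α : TangentSpace (𝓡 n) x [⋀^Fin n]→L[ℝ] ℝ,
      α (chartFrame c x) = d * α (stdFrame x) := by
  refine ⟨_, ?_, fun α => alternating_apply_eq_det_mul α _⟩
  set α₀ : EuclideanSpace ℝ (Fin n) [⋀^Fin n]→L[ℝ] ℝ :=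
    detForm (fun j => EuclideanSpace.proj j) with hα₀
  set T := (trivializationAt (EuclideanSpace ℝ (Fin n))
    (TangentSpace (𝓡 n) : X → Type _) c).continuousLinearMapAt ℝ x with hT
  intro h0
  have h1 := alternating_apply_eq_det_mul (α₀.compContinuousLinearMap T) (chartFrame c x)
  rw [h0, zero_mul] at h1
  have h2 : ∀ i, T (chartFrame c x i) = (EuclideanSpace.single i (1 : ℝ)) := fun i =>
    Trivialization.continuousLinearMapAt_symmL _ (by simpa using hx) _
  have h3 : α₀ (fun i => T (chartFrame c x i)) = 0 := h1
  simp only [h2, hα₀, detForm_apply] at h3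
  have h4 : (Matrix.of fun i j : Fin n => (EuclideanSpace.proj j : EuclideanSpace ℝ (Fin n) →L[ℝ] ℝ)
      (EuclideanSpace.single i (1 : ℝ))) = 1 := by
    ext i j
    simp [Matrix.one_apply, eq_comm]
  rw [h4, Matrix.det_one] at h3
  exact one_ne_zero h3

theorem formCoeff_extChartAt {c x : X} (hx : x ∈ (extChartAt (𝓡 n) c).source)
    (η : ∀ x : X, TangentSpace (𝓡 n) x [⋀^Fin n]→L[ℝ] ℝ) :
    formCoeff η c (extChartAt (𝓡 n) c x) = η x (chartFrame c x) := by
  have h : ∀ x', x' = x → (η x') (chartFrame c x') = η x (chartFrame c x) := by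
    rintro _ rfl
    rfl
  rw [← h _ ((extChartAt (𝓡 n) c).left_inv hx)]
  refine congrArg (η _) (funext fun i => ?_)
  exact mfderiv_symm_single ((extChartAt (𝓡 n) c).map_source hx) i

end TopForms

/-! ### Normalized tangent multivectors and the pulled-back volume. -/

section Lifts

variable {n k : ℕ} {N : Type*} [TopologicalSpace N]
  [ChartedSpace (EuclideanSpace ℝ (Fin (n + k))) N] [IsManifold (𝓡 (n + k)) ∞ N]
  {X : Type*} [TopologicalSpace X] [ChartedSpace (EuclideanSpace ℝ (Fin n)) X]
  {vol : ∀ q : N, FormFiber n k N q}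

theorem smul_wedge (hn : 1 ≤ n) {q : N} (c : ℝ) (v : Fin n → TangentSpace (𝓡 (n + k)) q) :
    ∃ w : Fin n → TangentSpace (𝓡 (n + k)) q, c • wedge v = wedge w := by
  refine ⟨Function.update v ⟨0, hn⟩ (c • v ⟨0, hn⟩), ?_⟩
  ext p
  exact (alternating_apply_smul_single (E := EuclideanSpace ℝ (Fin (n + k))) p v ⟨0, hn⟩ c).symm

theorem tangentMultiVec_apply (g : X → N) (x : X) (p : FormFiber n k N (g x)) :
    (tangentMultiVec vol g x p : ℝ) = (pullbackForm (𝓡 n) (𝓡 (n + k)) g vol x (stdFrame x))⁻¹ *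
      p (fun i => mfderiv (𝓡 n) (𝓡 (n + k)) g x (stdFrame x i)) := rfl

theorem tangentMultiVec_mem_DOmega (hn : 1 ≤ n) {g : X → N} {x : X}
    (h : pullbackForm (𝓡 n) (𝓡 (n + k)) g vol x ≠ 0) : tangentMultiVec vol g x ∈ DOmega vol (g x) := by
  refine ⟨smul_wedge hn _ _, ?_⟩
  exact inv_mul_cancel₀ (topForm_ne_zero_iff.1 h)

/-- A form pulled back to a submanifold on which `ω ≠ 0` is a multiple of the pull-back of `ω`. -/
theorem compContinuousLinearMap_mfderiv_eq {g : X → N} {x : X}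
    (h : pullbackForm (𝓡 n) (𝓡 (n + k)) g vol x ≠ 0) (p : FormFiber n k N (g x)) :
    ContinuousAlternatingMap.compContinuousLinearMap (N := ℝ) p
        (mfderiv (𝓡 n) (𝓡 (n + k)) g x) =
      (tangentMultiVec vol g x p : ℝ) • pullbackForm (𝓡 n) (𝓡 (n + k)) g vol x := by
  refine topForm_ext ?_
  have h0 := topForm_ne_zero_iff.1 h
  change p (fun i => mfderiv (𝓡 n) (𝓡 (n + k)) g x (stdFrame x i)) =
    (tangentMultiVec vol g x p : ℝ) * pullbackForm (𝓡 n) (𝓡 (n + k)) g vol x (stdFrame x)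
  rw [tangentMultiVec_apply, mul_right_comm, inv_mul_cancel₀ h0, one_mul]

variable [IsManifold (𝓡 n) ∞ X]

/-- A change of frame multiplies the wedge and the normalizing value of `ω` by the same factor. So
the smooth chart frame may replace `stdFrame` in proofs of smoothness. -/
theorem tangentMultiVec_eq_chartFrame (g : X → N) {c x : X}
    (hx : x ∈ (extChartAt (𝓡 n) c).source) :
    tangentMultiVec vol g x = (pullbackForm (𝓡 n) (𝓡 (n + k)) g vol x (chartFrame c x))⁻¹ •
      wedge (fun i => mfderiv (𝓡 n) (𝓡 (n + k)) g x (chartFrame c x i)) := by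
  obtain ⟨d, hd, hα⟩ := exists_chartFrame_eq hx
  ext p
  have h1 := hα (ContinuousAlternatingMap.compContinuousLinearMap (N := ℝ) p
        (mfderiv (𝓡 n) (𝓡 (n + k)) g x))
  change _ = (pullbackForm (𝓡 n) (𝓡 (n + k)) g vol x (chartFrame c x))⁻¹ *
    p (fun i => mfderiv (𝓡 n) (𝓡 (n + k)) g x (chartFrame c x i))
  change p (fun i => mfderiv (𝓡 n) (𝓡 (n + k)) g x (chartFrame c x i)) =
    d * p (fun i => mfderiv (𝓡 n) (𝓡 (n + k)) g x (stdFrame x i)) at h1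
  rw [h1, hα, mul_inv, mul_mul_mul_comm, inv_mul_cancel₀ hd, one_mul]
  rfl

section Family

variable {f : ℝ → X → N} {S : Set ℝ}

theorem contMDiffWithinAt_pullbackForm_chartFrame (hvol : IsSpaceTimeVolume vol)
    (hf : ContMDiffOn (𝓘(ℝ, ℝ).prod (𝓡 n)) (𝓡 (n + k)) ∞
      (fun a : ℝ × X => f a.1 a.2) (S ×ˢ univ)) {s₀ : ℝ} (hs₀ : s₀ ∈ S) {c x₀ : X}
    (hx₀ : x₀ ∈ (extChartAt (𝓡 n) c).source) :
    ContMDiffWithinAt (𝓘(ℝ, ℝ).prod (𝓡 n)) 𝓘(ℝ, ℝ) ∞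
      (fun a : ℝ × X => pullbackForm (𝓡 n) (𝓡 (n + k)) (f a.1) vol a.2 (chartFrame c a.2))
      (S ×ˢ univ) (s₀, x₀) :=
  contMDiffWithinAt_pairing (q := fun a : ℝ × X => f a.1 a.2)
    (p := fun a => vol (f a.1 a.2))
    (contMDiffWithinAt_wedge_chartFrame hf hs₀ hx₀)
    (hvol.smooth.contMDiffAt.comp_contMDiffWithinAt (s₀, x₀) (hf (s₀, x₀) ⟨hs₀, mem_univ _⟩))
    ⟨hs₀, mem_univ _⟩

theorem contMDiffWithinAt_inv_smul {E' H' A : Type*} [NormedAddCommGroup E'] [NormedSpace ℝ E']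
    [TopologicalSpace H'] {I' : ModelWithCorners ℝ E' H'} [TopologicalSpace A] [ChartedSpace H' A]
    {s : Set A} {a : A} {F : Type*} [NormedAddCommGroup F] [NormedSpace ℝ F] {m : ℕ∞ω}
    {r : A → ℝ} {z : A → F} (hr : ContMDiffWithinAt I' 𝓘(ℝ, ℝ) m r s a)
    (hz : ContMDiffWithinAt I' 𝓘(ℝ, F) m z s a) (h0 : r a ≠ 0) :
    ContMDiffWithinAt I' 𝓘(ℝ, F) m (fun b => (r b)⁻¹ • z b) s a :=
  (((contDiffAt_inv ℝ h0).contMDiffAt).comp_contMDiffWithinAt a hr).smul hz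

theorem contMDiffWithinAt_tangentMultiVec (hvol : IsSpaceTimeVolume vol)
    (hf : ContMDiffOn (𝓘(ℝ, ℝ).prod (𝓡 n)) (𝓡 (n + k)) ∞
      (fun a : ℝ × X => f a.1 a.2) (S ×ˢ univ)) {s₀ : ℝ} (hs₀ : s₀ ∈ S) {x₀ : X}
    (h0 : pullbackForm (𝓡 n) (𝓡 (n + k)) (f s₀) vol x₀ ≠ 0) :
    ContMDiffWithinAt (𝓘(ℝ, ℝ).prod (𝓡 n)) (multiVecI n k) ∞
      (fun a : ℝ × X => (⟨f a.1 a.2, tangentMultiVec vol (f a.1) a.2⟩ : MultiVecBundle n k N))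
      (S ×ˢ univ) (s₀, x₀) := by
  have hx₀ := mem_extChartAt_source (I := 𝓡 n) x₀
  have hs := mem_chart_source (EuclideanSpace ℝ (Fin (n + k))) (f s₀ x₀)
  obtain ⟨hq, hw⟩ := (contMDiffWithinAt_mv_iff (q₀ := f s₀ x₀) hs).1
    (contMDiffWithinAt_wedge_chartFrame hf hs₀ hx₀)
  have hr := contMDiffWithinAt_pullbackForm_chartFrame hvol hf hs₀ hx₀
  rw [contMDiffWithinAt_mv_iff (q₀ := f s₀ x₀) hs]
  refine ⟨hq, ?_⟩
  obtain ⟨d, hd, hα⟩ := exists_chartFrame_eq hx₀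
  refine (contMDiffWithinAt_inv_smul hr hw ?_).congr_of_eventuallyEq_of_mem ?_
    (mk_mem_prod hs₀ (mem_univ x₀))
  · simp only
    rw [hα]
    exact mul_ne_zero hd (topForm_ne_zero_iff.1 h0)
  · filter_upwards [hq.continuousWithinAt.preimage_mem_nhdsWithin
      ((chartAt (EuclideanSpace ℝ (Fin (n + k))) (f s₀ x₀)).open_source.mem_nhds hs),
      continuous_snd.continuousWithinAt.preimage_mem_nhdsWithin (x := (s₀, x₀)) (s := S ×ˢ univ)
        (extChartAt_source_mem_nhds (I := 𝓡 n) x₀)] with b hb hbx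
    rw [tangentMultiVec_eq_chartFrame (f b.1) hbx, mvCoord_smul hb]

theorem eventually_pullbackForm_ne_zero (hvol : IsSpaceTimeVolume vol)
    (hf : ContMDiffOn (𝓘(ℝ, ℝ).prod (𝓡 n)) (𝓡 (n + k)) ∞
      (fun a : ℝ × X => f a.1 a.2) (S ×ˢ univ)) {s₀ : ℝ} (hs₀ : s₀ ∈ S) {x₀ : X}
    (h0 : pullbackForm (𝓡 n) (𝓡 (n + k)) (f s₀) vol x₀ ≠ 0) :
    ∀ᶠ a : ℝ × X in 𝓝[S ×ˢ univ] (s₀, x₀),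
      pullbackForm (𝓡 n) (𝓡 (n + k)) (f a.1) vol a.2 ≠ 0 := by
  have hx₀ := mem_extChartAt_source (I := 𝓡 n) x₀
  obtain ⟨d, hd, hα⟩ := exists_chartFrame_eq hx₀
  have hr := (contMDiffWithinAt_pullbackForm_chartFrame hvol hf hs₀ hx₀).continuousWithinAt
  have hne : pullbackForm (𝓡 n) (𝓡 (n + k)) (f s₀) vol x₀ (chartFrame x₀ x₀) ≠ 0 := by
    rw [hα]
    exact mul_ne_zero hd (topForm_ne_zero_iff.1 h0)
  filter_upwards [hr (isOpen_ne.mem_nhds hne)] with a ha h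
  exact ha (congrArg (fun α => α (chartFrame x₀ a.2)) h)

theorem continuousOn_formCoeff_family (hvol : IsSpaceTimeVolume vol)
    (hf : ContMDiffOn (𝓘(ℝ, ℝ).prod (𝓡 n)) (𝓡 (n + k)) ∞
      (fun a : ℝ × X => f a.1 a.2) (S ×ˢ univ)) (c : X) :
    ContinuousOn (fun a : ℝ × EuclideanSpace ℝ (Fin n) =>
      formCoeff (pullbackForm (𝓡 n) (𝓡 (n + k)) (f a.1) vol) c a.2)
      (S ×ˢ (extChartAt (𝓡 n) c).target) := by
  have h1 : ContinuousOn (fun a : ℝ × X =>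
      pullbackForm (𝓡 n) (𝓡 (n + k)) (f a.1) vol a.2 (chartFrame c a.2))
      (S ×ˢ (extChartAt (𝓡 n) c).source) := fun a ha =>
    (contMDiffWithinAt_pullbackForm_chartFrame hvol hf ha.1 ha.2).continuousWithinAt.mono
      (prod_mono le_rfl (subset_univ _))
  have h2 : ContinuousOn (fun a : ℝ × EuclideanSpace ℝ (Fin n) =>
      (a.1, (extChartAt (𝓡 n) c).symm a.2)) (S ×ˢ (extChartAt (𝓡 n) c).target) :=
    continuousOn_fst.prodMk ((continuousOn_extChartAt_symm c).comp continuousOn_snd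
      fun a ha => ha.2)
  refine (h1.comp h2 fun a ha => ⟨ha.1, (extChartAt (𝓡 n) c).map_target ha.2⟩).congr fun a ha => ?_
  change _ = pullbackForm (𝓡 n) (𝓡 (n + k)) (f a.1) vol ((extChartAt (𝓡 n) c).symm a.2) _
  rw [← formCoeff_extChartAt ((extChartAt (𝓡 n) c).map_target ha.2),
    (extChartAt (𝓡 n) c).right_inv ha.2]

end Family

end Lifts

/-! ### First variation: uniform estimates -/

section FirstOrder

/-- `A` is the time derivative at `y₀` only. The time derivative is jointly continuous, hence within
`δ` of `A` near `(0, y₀)`, and the mean value inequality in time, with `y` fixed, gives the bound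
for nearby `y` too. -/
theorem eventually_abs_sub_le_of_contDiffWithinAt {E : Type*} [NormedAddCommGroup E]
    [NormedSpace ℝ E] {f : ℝ × E → ℝ} {y₀ : E} {A δ : ℝ} (hδ : 0 < δ)
    (hf : ContDiffWithinAt ℝ 1 f (Ici 0 ×ˢ univ) (0, y₀))
    (hA : HasDerivWithinAt (fun s => f (s, y₀)) A (Ici 0) 0) :
    ∀ᶠ a : ℝ × E in 𝓝[Ici 0 ×ˢ univ] (0, y₀), |f a - f (0, a.2) - A * a.1| ≤ δ * a.1 := by
  have hmem : ((0 : ℝ), y₀) ∈ (Ici 0 ×ˢ univ : Set (ℝ × E)) := ⟨self_mem_Ici, mem_univ _⟩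
  rw [← zero_add (1 : ℕ∞ω)] at hf
  obtain ⟨u, hu, -, -, f', hf', hc⟩ :=
    (contDiffWithinAt_succ_iff_hasFDerivWithinAt' (by simp)).1 hf
  rw [insert_eq_of_mem hmem] at hu
  have hslice : ∀ a : ℝ × E, a ∈ u →
      HasDerivWithinAt (fun s => f (s, a.2)) (f' a (1, 0)) (Ici 0) a.1 := by
    intro a ha
    have h1 : HasDerivWithinAt (fun s : ℝ => (s, a.2)) ((1 : ℝ), (0 : E)) (Ici 0) a.1 :=
      (hasDerivWithinAt_id _ _).prodMk (hasDerivWithinAt_const _ _ _)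
    exact (hf' a ha).comp_hasDerivWithinAt a.1 h1 fun s hs => mk_mem_prod hs (mem_univ _)
  have hA' : A = f' (0, y₀) (1, 0) :=
    (uniqueDiffWithinAt_Ici (0 : ℝ)).eq_deriv _ hA (hslice (0, y₀) (mem_of_mem_nhdsWithin hmem hu))
  have hclose : ∀ᶠ a : ℝ × E in 𝓝[Ici 0 ×ˢ univ] (0, y₀),
      a ∈ u ∧ |f' a (1, 0) - A| ≤ δ := by
    refine Filter.inter_mem hu ?_
    have h1 : ContinuousWithinAt (fun a => |f' a (1, 0) - A|) (Ici 0 ×ˢ univ) (0, y₀) :=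
      ((hc.continuousWithinAt.clm_apply continuousWithinAt_const).sub
        continuousWithinAt_const).abs
    have h2 := h1 (Iio_mem_nhds (by simpa [← hA'] using hδ : |f' (0, y₀) (1, 0) - A| < δ))
    filter_upwards [h2] with a ha using (le_of_lt ha : |f' a (1, 0) - A| ≤ δ)
  rw [nhdsWithin_prod_eq, nhdsWithin_univ] at hclose ⊢
  obtain ⟨pa, hpa, pb, hpb, hab⟩ := Filter.eventually_prod_iff.1 hclose
  obtain ⟨ε, hε, hsub⟩ := mem_nhdsGE_iff_exists_Ico_subset.1 hpa
  refine Filter.eventually_prod_iff.2 ⟨fun s => s ∈ Ico 0 ε, Ico_mem_nhdsGE hε, pb, hpb, ?_⟩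
  intro s hs y hy
  have key := (convex_Ico 0 ε).norm_image_sub_le_of_norm_hasDerivWithin_le
    (f := fun r => f (r, y) - A * r) (f' := fun r => f' (r, y) (1, 0) - A) (C := δ)
    (fun r hr => by
      have h1 := (hslice (r, y) (hab (hsub hr) hy).1).mono (s := Ico 0 ε) fun t ht => ht.1
      have h2 : HasDerivWithinAt (fun r => A * r) A (Ico 0 ε) r := by
        simpa using (hasDerivWithinAt_id r (Ico 0 ε)).const_mul A
      exact h1.sub h2)
    (fun r hr => (hab (hsub hr) hy).2) ⟨le_rfl, hε⟩ hs
  simp only [mul_zero, sub_zero, Real.norm_eq_abs, abs_of_nonneg hs.1] at key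
  rwa [sub_right_comm]

variable {n : ℕ} {X : Type*} [TopologicalSpace X] [ChartedSpace (EuclideanSpace ℝ (Fin n)) X]
  [IsManifold (𝓡 n) ∞ X]

theorem eventually_abs_sub_le {f : ℝ × X → ℝ} {x₀ : X} {A δ : ℝ} (hδ : 0 < δ)
    (hf : ContMDiffWithinAt (𝓘(ℝ, ℝ).prod (𝓡 n)) 𝓘(ℝ, ℝ) ∞ f (Ici 0 ×ˢ univ) (0, x₀))
    (hA : HasDerivWithinAt (fun s => f (s, x₀)) A (Ici 0) 0) :
    ∀ᶠ a : ℝ × X in 𝓝[Ici 0 ×ˢ univ] (0, x₀), |f a - f (0, a.2) - A * a.1| ≤ δ * a.1 := by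
  set e := extChartAt (𝓡 n) x₀ with he
  have hx₀ : e.symm (e x₀) = x₀ := extChartAt_to_inv x₀
  have hsymm : ContMDiffAt (𝓡 n) (𝓡 n) ∞ e.symm (e x₀) :=
    (contMDiffOn_extChartAt_symm x₀).contMDiffAt (extChartAt_target_mem_nhds x₀)
  have h1 : ContMDiffWithinAt (𝓘(ℝ, ℝ).prod (𝓡 n)) 𝓘(ℝ, ℝ) ∞
      (fun a : ℝ × EuclideanSpace ℝ (Fin n) => f (a.1, e.symm a.2)) (Ici 0 ×ˢ univ)
      (0, e x₀) := by
    refine contMDiffWithinAt_comp_of_eventually_mem (I₂ := 𝓘(ℝ, ℝ).prod (𝓡 n))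
      (f := fun a : ℝ × EuclideanSpace ℝ (Fin n) => (a.1, e.symm a.2)) (a := (0, e x₀))
      (t := Ici 0 ×ˢ univ) (by rwa [hx₀]) ?_ ?_
    · exact contMDiffWithinAt_fst.prodMk (ContMDiffAt.comp_contMDiffWithinAt (I' := 𝓡 n)
        ((0 : ℝ), e x₀) (g := e.symm) (f := Prod.snd) hsymm contMDiffWithinAt_snd)
    · filter_upwards [self_mem_nhdsWithin] with b hb using ⟨hb.1, mem_univ _⟩
  rw [← modelWithCornersSelf_prod, chartedSpaceSelf_prod, contMDiffWithinAt_iff_contDiffWithinAt]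
    at h1
  have h2 := eventually_abs_sub_le_of_contDiffWithinAt (A := A) hδ (h1.of_le (by simp))
    (by simpa only [hx₀] using hA)
  rw [nhdsWithin_prod_eq, nhdsWithin_univ] at h2 ⊢
  have h3 : Filter.Tendsto (fun a : ℝ × X => (a.1, e a.2)) (𝓝[Ici 0] 0 ×ˢ 𝓝 x₀)
      (𝓝[Ici 0] 0 ×ˢ 𝓝 (e x₀)) :=
    Filter.tendsto_id.prodMap (continuousAt_extChartAt x₀)
  filter_upwards [h3.eventually h2,
    Filter.tendsto_snd.eventually (extChartAt_source_mem_nhds (I := 𝓡 n) x₀)] with a ha hax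
  have hinv : e.symm (e a.2) = a.2 := e.left_inv hax
  simpa only [hinv] using ha

/-- The tube lemma around `{0} × K`; it makes local estimates uniform on `K`. -/
theorem eventually_forall_mem_compact {Y : Type*} [TopologicalSpace Y] {K : Set Y}
    (hK : IsCompact K) {P : ℝ × Y → Prop}
    (h : ∀ x ∈ K, ∀ᶠ a in 𝓝[Ici 0 ×ˢ univ] ((0 : ℝ), x), P a) :
    ∀ᶠ s in 𝓝[Ici 0] (0 : ℝ), ∀ x ∈ K, P (s, x) := by
  have h1 : {a | P a} ∈ 𝓝[Ici 0] (0 : ℝ) ×ˢ 𝓝ˢ K := by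
    refine hK.mem_prod_nhdsSet_of_forall fun x hx => ?_
    have := h x hx
    rwa [nhdsWithin_prod_eq, nhdsWithin_univ] at this
  exact (Filter.Eventually.curry h1).mono fun s hs => hs.self_of_nhdsSet

end FirstOrder

/-! ### The two actions -/

section Actions

variable {n k : ℕ} {N : Type*} [TopologicalSpace N]
  [ChartedSpace (EuclideanSpace ℝ (Fin (n + k))) N] [IsManifold (𝓡 (n + k)) ∞ N]
  {X : Type*} [TopologicalSpace X] [ChartedSpace (EuclideanSpace ℝ (Fin n)) X]
  {vol : ∀ q : N, FormFiber n k N q} {L : MultiVecBundle n k N → ℝ}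

theorem contMDiff_formProj :
    ContMDiff (formI n k) (𝓡 (n + k)) ∞ (fun μ : FormBundle n k N => μ.proj) :=
  Bundle.contMDiff_proj (FormFiber n k N)

theorem mfderiv_proj_comp {γ : X → FormBundle n k N} {x : X}
    (hγ : MDifferentiableAt (𝓡 n) (formI n k) γ x) :
    mfderiv (𝓡 n) (𝓡 (n + k)) (fun x => (γ x).proj) x =
      (mfderiv (formI n k) (𝓡 (n + k)) (fun μ : FormBundle n k N => μ.proj) (γ x)).comp
        (mfderiv (𝓡 n) (formI n k) γ x) :=
  mfderiv_comp x (contMDiff_formProj.contMDiffAt.mdifferentiableAt (by simp)) hγ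

theorem pullbackForm_liftedVolume {γ : X → FormBundle n k N} {x : X}
    (hγ : MDifferentiableAt (𝓡 n) (formI n k) γ x) :
    pullbackForm (𝓡 n) (formI n k) γ (liftedVolume vol) x =
      pullbackForm (𝓡 n) (𝓡 (n + k)) (fun x => (γ x).proj) vol x := by
  unfold pullbackForm
  rw [mfderiv_proj_comp hγ]
  rfl

/-- By the chain rule the pull-back of `θ` is `p` pulled back along the projected map, hence `⟨z,
p⟩` times the pull-back of `ω`. -/
theorem pullbackForm_poincareCartan_sub {γ : X → FormBundle n k N} {x : X}
    (hγ : MDifferentiableAt (𝓡 n) (formI n k) γ x)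
    (h0 : pullbackForm (𝓡 n) (𝓡 (n + k)) (fun x => (γ x).proj) vol x ≠ 0) :
    pullbackForm (𝓡 n) (formI n k) γ
        (fun μ => poincareCartan μ - hamiltonian vol L μ • liftedVolume vol μ) x =
      ((tangentMultiVec vol (fun x => (γ x).proj) x (γ x).2 : ℝ) - hamiltonian vol L (γ x)) •
        pullbackForm (𝓡 n) (𝓡 (n + k)) (fun x => (γ x).proj) vol x := by
  have h1 := compContinuousLinearMap_mfderiv_eq h0 (γ x).2
  rw [mfderiv_proj_comp hγ] at h1
  refine topForm_ext ?_
  have h2 : _ = (tangentMultiVec vol (fun x => (γ x).proj) x (γ x).2 : ℝ) *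
      pullbackForm (𝓡 n) (𝓡 (n + k)) (fun x => (γ x).proj) vol x (stdFrame x) :=
    congrArg (fun α => α (stdFrame x)) h1
  have h3 := congrArg (fun α => α (stdFrame x)) (pullbackForm_liftedVolume (vol := vol) hγ)
  change _ = ((tangentMultiVec vol (fun x => (γ x).proj) x (γ x).2 : ℝ) -
    hamiltonian vol L (γ x)) * pullbackForm (𝓡 n) (𝓡 (n + k)) (fun x => (γ x).proj) vol x (stdFrame x)
  rw [sub_mul, ← h2]
  refine Eq.trans ?_ (congrArg (fun r => _ - hamiltonian vol L (γ x) * r) h3)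
  rfl

variable [IsManifold (𝓡 n) ∞ X] [T2Space X] [SigmaCompactSpace X]

theorem hamiltonianAction_eq {K : Set X} (hK : IsCompact K) {γ : X → FormBundle n k N}
    (hγ : ContMDiff (𝓡 n) (formI n k) ∞ γ)
    (h0 : ∀ x ∈ K, pullbackForm (𝓡 n) (𝓡 (n + k)) (fun x => (γ x).proj) vol x ≠ 0) :
    hamiltonianAction vol L K γ =
      formIntegral (pullbackForm (𝓡 n) (𝓡 (n + k)) (fun x => (γ x).proj) vol)
        (fun x => ((tangentMultiVec vol (fun x => (γ x).proj) x (γ x).2 : ℝ) -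
          hamiltonian vol L (γ x)) •
            pullbackForm (𝓡 n) (𝓡 (n + k)) (fun x => (γ x).proj) vol x) K :=
  formIntegral_congr hK
    (fun x _ => pullbackForm_liftedVolume (hγ.contMDiffAt.mdifferentiableAt (by simp)))
    (fun x hx => pullbackForm_poincareCartan_sub (hγ.contMDiffAt.mdifferentiableAt (by simp))
      (h0 x hx))

end Actions

/-! ### The difference of the two actions along variations of a Legendre lift -/

section Difference

open MeasureTheory

theorem hasDerivWithinAt_zero_of_abs_le {D : ℝ → ℝ}
    (h : ∀ c : ℝ, 0 < c → ∀ᶠ s in 𝓝[Ici 0] (0 : ℝ), |D s| ≤ c * s) :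
    HasDerivWithinAt D 0 (Ici 0) 0 := by
  have h0 : D 0 = 0 := by
    have := (h 1 one_pos).self_of_nhdsWithin self_mem_Ici
    simpa using this
  rw [hasDerivWithinAt_iff_isLittleO, Asymptotics.isLittleO_iff]
  intro c hc
  filter_upwards [h c hc] with s hs
  simp only [h0, sub_zero, smul_zero, Real.norm_eq_abs]
  exact hs.trans (mul_le_mul_of_nonneg_left (le_abs_self s) hc.le)

variable {n k : ℕ} {N : Type*} [TopologicalSpace N]
  [ChartedSpace (EuclideanSpace ℝ (Fin (n + k))) N] [IsManifold (𝓡 (n + k)) ∞ N]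
  {X : Type*} [TopologicalSpace X] [ChartedSpace (EuclideanSpace ℝ (Fin n)) X]
  [IsManifold (𝓡 n) ∞ X]
  {vol : ∀ q : N, FormFiber n k N q} {L : MultiVecBundle n k N → ℝ} {M : Set (FormBundle n k N)}

theorem continuousAt_slice {B : Type*} [TopologicalSpace B] {F : ℝ × X → B} {S : Set ℝ} {s : ℝ}
    {x : X} (hs : s ∈ S) (hF : ContinuousWithinAt F (S ×ˢ univ) (s, x)) :
    ContinuousAt (fun x => F (s, x)) x := by
  have h : ContinuousWithinAt (fun x : X => (s, x)) univ x :=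
    continuousWithinAt_const.prodMk continuousWithinAt_id
  exact continuousWithinAt_univ _ _ |>.1 (hF.comp h fun _ _ => mk_mem_prod hs (mem_univ _))

theorem contMDiffWithinAt_curve {E' H' B : Type*} [NormedAddCommGroup E'] [NormedSpace ℝ E']
    [TopologicalSpace H'] {I' : ModelWithCorners ℝ E' H'} [TopologicalSpace B] [ChartedSpace H' B]
    {F : ℝ × X → B} {S : Set ℝ} {s : ℝ} {x : X} {m : ℕ∞ω}
    (hF : ContMDiffWithinAt (𝓘(ℝ, ℝ).prod (𝓡 n)) I' m F (S ×ˢ univ) (s, x)) :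
    ContMDiffWithinAt 𝓘(ℝ, ℝ) I' m (fun t => F (t, x)) S s :=
  contMDiffWithinAt_comp_of_eventually_mem (f := fun t : ℝ => (t, x)) (a := s) hF
    (contMDiffWithinAt_id.prodMk contMDiffWithinAt_const)
    (by filter_upwards [self_mem_nhdsWithin] with t ht using ⟨ht, mem_univ _⟩)

section Family

variable {σ : ℝ → X → FormBundle n k N} {f : ℝ → X → N} {S : Set ℝ} {s₀ : ℝ} {x₀ : X}

theorem contMDiffOn_proj_family
    (hσ : ContMDiffOn (𝓘(ℝ, ℝ).prod (𝓡 n)) (formI n k) ∞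
      (fun a : ℝ × X => σ a.1 a.2) (S ×ˢ univ)) :
    ContMDiffOn (𝓘(ℝ, ℝ).prod (𝓡 n)) (𝓡 (n + k)) ∞
      (fun a : ℝ × X => (σ a.1 a.2).proj) (S ×ˢ univ) :=
  contMDiff_formProj.comp_contMDiffOn hσ

theorem contMDiffWithinAt_lagrangian_family (hn : 1 ≤ n) (hvol : IsSpaceTimeVolume vol)
    (hL : IsLagrangian vol L)
    (hf : ContMDiffOn (𝓘(ℝ, ℝ).prod (𝓡 n)) (𝓡 (n + k)) ∞
      (fun a : ℝ × X => f a.1 a.2) (S ×ˢ univ)) (hs₀ : s₀ ∈ S)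
    (h0 : pullbackForm (𝓡 n) (𝓡 (n + k)) (f s₀) vol x₀ ≠ 0) :
    ContMDiffWithinAt (𝓘(ℝ, ℝ).prod (𝓡 n)) 𝓘(ℝ, ℝ) ∞
      (fun a : ℝ × X => L ⟨f a.1 a.2, tangentMultiVec vol (f a.1) a.2⟩) (S ×ˢ univ) (s₀, x₀) := by
  refine contMDiffWithinAt_lagrangian_comp hL
    (contMDiffWithinAt_tangentMultiVec hvol hf hs₀ h0) (tangentMultiVec_mem_DOmega hn h0) ?_
  filter_upwards [eventually_pullbackForm_ne_zero hvol hf hs₀ h0] with a ha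
    using tangentMultiVec_mem_DOmega hn ha

theorem contMDiffWithinAt_hamiltonian_family (hn : 1 ≤ n) (hvol : IsSpaceTimeVolume vol)
    (hL : IsLagrangian vol L) (hM : LegendreCorrespondenceHypothesis vol L M)
    (hσ : ContMDiffOn (𝓘(ℝ, ℝ).prod (𝓡 n)) (formI n k) ∞
      (fun a : ℝ × X => σ a.1 a.2) (S ×ˢ univ)) (hσM : ∀ s ∈ S, ∀ x, σ s x ∈ M) (hs₀ : s₀ ∈ S)
    (h0 : pullbackForm (𝓡 n) (𝓡 (n + k)) (fun x => (σ s₀ x).proj) vol x₀ ≠ 0) :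
    ContMDiffWithinAt (𝓘(ℝ, ℝ).prod (𝓡 n)) 𝓘(ℝ, ℝ) ∞
      (fun a : ℝ × X => (tangentMultiVec vol (fun x => (σ a.1 x).proj) a.2 (σ a.1 a.2).2 : ℝ) -
        hamiltonian vol L (σ a.1 a.2)) (S ×ˢ univ) (s₀, x₀) := by
  have hmem : (s₀, x₀) ∈ S ×ˢ (univ : Set X) := ⟨hs₀, mem_univ _⟩
  have h1 := contMDiffWithinAt_tangentMultiVec (f := fun s x => (σ s x).proj) hvol
    (contMDiffOn_proj_family hσ) hs₀ h0
  have h2 := contMDiffWithinAt_pairing (q := fun a : ℝ × X => (σ a.1 a.2).proj)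
    (p := fun a => (σ a.1 a.2).2) h1 (hσ _ hmem) hmem
  have h3 := contMDiffWithinAt_hamiltonian hn hvol hL hM (hσ _ hmem) hmem
    (by filter_upwards [self_mem_nhdsWithin] with a ha using hσM _ ha.1 _)
  exact h2.sub h3

end Family

theorem continuousOn_formCoeff_chartPiece [T2Space X] [SigmaCompactSpace X] {f : ℝ → X → N}
    {S : Set ℝ} (hvol : IsSpaceTimeVolume vol)
    (hf : ContMDiffOn (𝓘(ℝ, ℝ).prod (𝓡 n)) (𝓡 (n + k)) ∞
      (fun a : ℝ × X => f a.1 a.2) (S ×ˢ univ)) {s : ℝ} (hs : s ∈ S) (K : Set X) (c : X) :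
    ContinuousOn (formCoeff (pullbackForm (𝓡 n) (𝓡 (n + k)) (f s) vol) c) (chartPiece n K c) :=
  (continuousOn_formCoeff_family hvol hf c).comp (f := fun y => (s, y))
    (continuousOn_const.prodMk continuousOn_id)
    fun _ hy => ⟨hs, chartPiece_subset_target K c hy⟩

theorem IsOmegaSubmanifoldLift.pullbackForm_proj_ne_zero {γ : X → FormBundle n k N}
    (hγ : IsOmegaSubmanifoldLift vol M γ) (x : X) :
    pullbackForm (𝓡 n) (𝓡 (n + k)) (fun x => (γ x).proj) vol x ≠ 0 := by
  rw [← pullbackForm_liftedVolume (hγ.smooth.contMDiffAt.mdifferentiableAt (by simp))]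
  exact hγ.pos x

theorem IsLegendreLift.mem_legendreZ (hn : 1 ≤ n) {γ : X → FormBundle n k N}
    (hγ : IsLegendreLift vol L M (fun x => (γ x).proj) γ) (x : X) :
    tangentMultiVec vol (fun x => (γ x).proj) x ∈ legendreZ vol L (γ x).proj (γ x).2 :=
  ⟨tangentMultiVec_mem_DOmega (g := fun x => (γ x).proj) hn
    (hγ.lift.pullbackForm_proj_ne_zero x), hγ.contact x⟩

variable [T2Space X] [SigmaCompactSpace X]

/-- The density `F = W - ℋ` and its time derivative vanish at time `0` at each point. By compactness
`|F| ≤ δ s` on `K` for small `s`, while the volume densities stay bounded, so the difference of the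
actions is `o(s)`. -/
theorem hasDerivWithinAt_hamiltonianAction_sub_lagrangianAction (hn : 1 ≤ n)
    (hvol : IsSpaceTimeVolume vol) (hL : IsLagrangian vol L)
    (hM : LegendreCorrespondenceHypothesis vol L M) {γ : X → FormBundle n k N}
    (hγ : IsLegendreLift vol L M (fun x => (γ x).proj) γ) {K : Set X} (hK : IsCompact K)
    {σ : ℝ → X → FormBundle n k N} (hσ : IsVariation n (formI n k) M K γ σ) :
    HasDerivWithinAt (fun s => hamiltonianAction vol L K (σ s) -
      lagrangianAction vol L K (fun x => (σ s x).proj)) 0 (Ici 0) 0 := by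
  have hσM : ∀ s ∈ Ici (0 : ℝ), ∀ x, σ s x ∈ M := hσ.mem
  have hf := contMDiffOn_proj_family hσ.smooth
  have h00 : (0 : ℝ) ∈ Ici (0 : ℝ) := self_mem_Ici
  have hne0 : ∀ x, pullbackForm (𝓡 n) (𝓡 (n + k)) (fun x => (σ 0 x).proj) vol x ≠ 0 := by
    rw [hσ.init]
    exact hγ.lift.pullbackForm_proj_ne_zero
  have hZ : ∀ x, tangentMultiVec vol (fun x => (σ 0 x).proj) x ∈
      legendreZ vol L (σ 0 x).proj (σ 0 x).2 := by
    rw [hσ.init]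
    exact hγ.mem_legendreZ hn
  set F : ℝ × X → ℝ := fun a =>
    ((tangentMultiVec vol (fun x => (σ a.1 x).proj) a.2 (σ a.1 a.2).2 : ℝ) -
      hamiltonian vol L (σ a.1 a.2)) -
      L ⟨(σ a.1 a.2).proj, tangentMultiVec vol (fun x => (σ a.1 x).proj) a.2⟩ with hF
  have hF0 : ∀ x, F (0, x) = 0 := by
    intro x
    have h1 := hamiltonian_eq hn hvol hL hM (hσM 0 h00 x) (hZ x)
    have h2 : hamiltonian vol L (σ 0 x) =
        (tangentMultiVec vol (fun x => (σ 0 x).proj) x (σ 0 x).2 : ℝ) -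
          L ⟨(σ 0 x).proj, tangentMultiVec vol (fun x => (σ 0 x).proj) x⟩ := h1
    simp only [hF, h2]
    ring
  have hsmooth : ∀ x, ContMDiffWithinAt (𝓘(ℝ, ℝ).prod (𝓡 n)) 𝓘(ℝ, ℝ) ∞ F (Ici 0 ×ˢ univ) (0, x) :=
    fun x => (contMDiffWithinAt_hamiltonian_family hn hvol hL hM hσ.smooth hσM h00 (hne0 x)).sub
      (contMDiffWithinAt_lagrangian_family (f := fun s x => (σ s x).proj) hn hvol hL hf h00 (hne0 x))
  have hderiv : ∀ x, HasDerivWithinAt (fun s => F (s, x)) 0 (Ici 0) 0 := by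
    intro x
    have hp : ContMDiffWithinAt 𝓘(ℝ, ℝ) (formI n k) 1 (fun t => σ t x) (Ici 0) 0 :=
      (contMDiffWithinAt_curve (hσ.smooth (0, x) ⟨h00, mem_univ _⟩)).of_le (by simp)
    have hz : ContMDiffWithinAt 𝓘(ℝ, ℝ) (multiVecI n k) 1 (fun t => (⟨(σ t x).proj,
        tangentMultiVec vol (fun x => (σ t x).proj) x⟩ : MultiVecBundle n k N)) (Ici 0) 0 :=
      (contMDiffWithinAt_curve
        (contMDiffWithinAt_tangentMultiVec (f := fun s x => (σ s x).proj) hvol hf h00 (hne0 x))).of_le (by simp)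
    have hev : ∀ᶠ t in 𝓝[Ici 0] (0 : ℝ),
        pullbackForm (𝓡 n) (𝓡 (n + k)) (fun x => (σ t x).proj) vol x ≠ 0 := by
      have := eventually_forall_mem_compact (isCompact_singleton (x := x)) (P := fun a : ℝ × X =>
        pullbackForm (𝓡 n) (𝓡 (n + k)) (fun x => (σ a.1 x).proj) vol a.2 ≠ 0)
        (fun y _ => eventually_pullbackForm_ne_zero (f := fun s x => (σ s x).proj) hvol hf h00 (hne0 y))
      filter_upwards [this] with t ht using ht x rfl
    have := hasDerivWithinAt_pontryaginW_sub_hamiltonian hn hvol hL hM h00 hz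
      (p := fun t => (σ t x).2) hp
      (by filter_upwards [hev] with t ht
        using tangentMultiVec_mem_DOmega (g := fun x => (σ t x).proj) hn ht)
      (by filter_upwards [self_mem_nhdsWithin] with t ht using hσM t ht x) (hZ x)
    refine this.congr_of_eventuallyEq_of_mem (Filter.Eventually.of_forall fun t => ?_) h00
    simp only [hF, pontryaginW]
    exact sub_right_comm _ _ _
  -- The volume density also moves with `s`; compactness of the time interval times the piece bounds
  -- it.
  have hbound : ∀ c : X, ∃ B : ℝ, ∀ s ∈ Icc (0 : ℝ) 1, ∀ y ∈ chartPiece n K c,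
      |formCoeff (pullbackForm (𝓡 n) (𝓡 (n + k)) (fun x => (σ s x).proj) vol) c y| ≤ B := by
    intro c
    obtain ⟨B, hB⟩ := (isCompact_Icc.prod (isCompact_chartPiece hK c)).exists_bound_of_continuousOn
      ((continuousOn_formCoeff_family (f := fun s x => (σ s x).proj) hvol hf c).mono
        (prod_mono (s₁ := Icc (0 : ℝ) 1) (fun s hs => hs.1) (chartPiece_subset_target K c)))
    exact ⟨B, fun s hs y hy => hB (s, y) ⟨hs, hy⟩⟩
  choose B hB using hbound
  set C : ℝ := ∑ c ∈ (finite_charts (n := n) hK).toFinset,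
    |B c| * volume.real (chartPiece n K c) with hC
  have hC0 : 0 ≤ C := Finset.sum_nonneg fun c _ => by positivity
  refine hasDerivWithinAt_zero_of_abs_le fun c hc => ?_
  -- Chosen so that `δ * s * C ≤ c * s`; the `+ 1` covers `C = 0`.
  have hδ : 0 < c / (C + 1) := by positivity
  filter_upwards [self_mem_nhdsWithin, Icc_mem_nhdsGE (zero_lt_one (α := ℝ)),
    eventually_forall_mem_compact hK fun x _ => eventually_abs_sub_le hδ (hsmooth x) (hderiv x),
    eventually_forall_mem_compact hK (P := fun a : ℝ × X =>
      pullbackForm (𝓡 n) (𝓡 (n + k)) (fun x => (σ a.1 x).proj) vol a.2 ≠ 0)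
      (fun x _ => eventually_pullbackForm_ne_zero (f := fun s x => (σ s x).proj) hvol hf h00 (hne0 x))] with s hs hs1 hsF hsne
  have hslice : ContMDiff (𝓡 n) (formI n k) ∞ (σ s) := fun x =>
    contMDiffWithinAt_univ.1 (contMDiffWithinAt_comp_of_eventually_mem
      (f := fun x : X => (s, x)) (a := x) (hσ.smooth (s, x) ⟨hs, mem_univ _⟩)
      (contMDiffWithinAt_const.prodMk contMDiffWithinAt_id)
      (Filter.Eventually.of_forall fun _ => ⟨hs, mem_univ _⟩))
  rw [hamiltonianAction_eq hK hslice hsne, lagrangianAction, formIntegral_smul_sub hK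
    (fun c => continuousOn_formCoeff_chartPiece (f := fun s x => (σ s x).proj) hvol hf hs K c)
    (fun x hx => (continuousAt_slice hs (contMDiffWithinAt_hamiltonian_family hn hvol hL hM
      hσ.smooth hσM hs (hsne x hx)).continuousWithinAt).continuousWithinAt)
    (fun x hx => (continuousAt_slice hs (contMDiffWithinAt_lagrangian_family (f := fun s x => (σ s x).proj) hn hvol hL
      hf hs (hsne x hx)).continuousWithinAt).continuousWithinAt)]
  refine (abs_formIntegral_smul_le hK (δ := c / (C + 1) * s) (fun x hx => ?_)
    (fun c => hB c s hs1)).trans ?_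
  · have := hsF x hx
    rw [hF0] at this
    simpa [hF] using this
  · rw [← hC, mul_right_comm]
    refine mul_le_mul_of_nonneg_right ?_ hs
    rw [div_mul_eq_mul_div, div_le_iff₀ (by positivity)]
    nlinarith

end Difference

/-! ### Lifting variations of the base to variations in `M` -/

section Ray

variable {F : Type*} [NormedAddCommGroup F] [NormedSpace ℝ F]

/-- The point `w + r u`. -/
def rayPoint (w u : F) (r : ℝ) : F := w + r • u

theorem rayPoint_zero (w u : F) : rayPoint w u 0 = w := by simp [rayPoint]

theorem rayPoint_of_eq_zero {u : F} (hu : u = 0) (w : F) (r : ℝ) : rayPoint w u r = w := by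
  simp [rayPoint, hu]

theorem rayPoint_mem {V : Submodule ℝ F} {w u : F} (hw : w ∈ V) (hu : u ∈ V) (r : ℝ) :
    rayPoint w u r ∈ V := V.add_mem hw (V.smul_mem r hu)

theorem rayPoint_nonneg {ℓ : F →L[ℝ] ℝ} {w u : F} (hw : 0 ≤ ℓ w) (hu : 0 ≤ ℓ u) {r : ℝ}
    (hr : 0 ≤ r) : 0 ≤ ℓ (rayPoint w u r) := by
  rw [rayPoint, map_add, map_smul]
  exact add_nonneg hw (mul_nonneg hr hu)

theorem contMDiffWithinAt_rayPoint {E' H' A : Type*} [NormedAddCommGroup E'] [NormedSpace ℝ E']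
    [TopologicalSpace H'] {I' : ModelWithCorners ℝ E' H'} [TopologicalSpace A] [ChartedSpace H' A]
    {s : Set A} {a : A} {m : ℕ∞ω} {w : A → F} {r : A → ℝ} (hw : ContMDiffWithinAt I' 𝓘(ℝ, F) m w s a)
    (hr : ContMDiffWithinAt I' 𝓘(ℝ, ℝ) m r s a) (u : F) :
    ContMDiffWithinAt I' 𝓘(ℝ, F) m (fun b => rayPoint (w b) u (r b)) s a :=
  hw.add (hr.smul contMDiffWithinAt_const)

end Ray

section Lifting

variable {n k : ℕ} {N : Type*} [TopologicalSpace N]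
  [ChartedSpace (EuclideanSpace ℝ (Fin (n + k))) N] [IsManifold (𝓡 (n + k)) ∞ N]
  {X : Type*} [TopologicalSpace X] [ChartedSpace (EuclideanSpace ℝ (Fin n)) X]

/-- `σ` is a family of maps into `M` over `[0, ε)`, starting at `γ` and constant outside `K`, that
lifts the family `(t, x) ↦ τ (t φ(x)) x`. -/
structure IsPartialLift (M : Set (FormBundle n k N)) (K : Set X) (γ : X → FormBundle n k N)
    (τ : ℝ → X → N) (φ : X → ℝ) (ε : ℝ) (σ : ℝ → X → FormBundle n k N) : Prop where
  smooth : ContMDiffOn (𝓘(ℝ, ℝ).prod (𝓡 n)) (formI n k) ∞ (fun a : ℝ × X => σ a.1 a.2)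
    (Ico 0 ε ×ˢ univ)
  init : σ 0 = γ
  mem : ∀ t ∈ Ico 0 ε, ∀ x, σ t x ∈ M
  proj_eq : ∀ t ∈ Ico 0 ε, ∀ x, (σ t x).proj = τ (t * φ x) x
  support : ∀ t ∈ Ico 0 ε, ∀ x, x ∉ K → σ t x = γ x

variable {M : Set (FormBundle n k N)} {K : Set X} {γ : X → FormBundle n k N} {τ : ℝ → X → N}
  {φ ρ : X → ℝ} {ε : ℝ} {σ : ℝ → X → FormBundle n k N}

theorem contMDiffOn_rescale
    (hτ : ContMDiffOn (𝓘(ℝ, ℝ).prod (𝓡 n)) (𝓡 (n + k)) ∞ (fun a : ℝ × X => τ a.1 a.2)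
      (Ici 0 ×ˢ univ)) (hφ : ContMDiff (𝓡 n) 𝓘(ℝ, ℝ) ∞ φ) (hφ0 : ∀ x, 0 ≤ φ x) :
    ContMDiffOn (𝓘(ℝ, ℝ).prod (𝓡 n)) (𝓡 (n + k)) ∞
      (fun a : ℝ × X => τ (a.1 * φ a.2) a.2) (Ici 0 ×ˢ univ) := by
  have h1 : ContMDiff (𝓘(ℝ, ℝ).prod (𝓡 n)) 𝓘(ℝ, ℝ) ∞ (fun a : ℝ × X => a.1 * φ a.2) :=
    contMDiff_fst.mul (hφ.comp contMDiff_snd)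
  exact hτ.comp (h1.prodMk contMDiff_snd).contMDiffOn
    fun a ha => ⟨mul_nonneg ha.1 (hφ0 a.2), mem_univ _⟩

/-- In the fibred chart `Φ` advance the base point from `τ (t φ)` to `τ (t (φ + ρ))` and push the
fibre coordinate by `t ρ u`. With `u = 0` this is one step in lifting a base variation; with `τ`
constant in time it creates a vertical variation. -/
theorem IsPartialLift.extend (hσ : IsPartialLift M K γ τ φ ε σ) (hε : 0 < ε)
    (hK : IsCompact K)
    (hτ : ContMDiffOn (𝓘(ℝ, ℝ).prod (𝓡 n)) (𝓡 (n + k)) ∞ (fun a : ℝ × X => τ a.1 a.2)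
      (Ici 0 ×ˢ univ)) (hτ0 : ∀ x, τ 0 x = (γ x).proj)
    (hτK : ∀ s, 0 ≤ s → ∀ x, x ∉ K → τ s x = (γ x).proj)
    (hφ : ContMDiff (𝓡 n) 𝓘(ℝ, ℝ) ∞ φ) (hφ0 : ∀ x, 0 ≤ φ x)
    (hρ : ContMDiff (𝓡 n) 𝓘(ℝ, ℝ) ∞ ρ) (hρ0 : ∀ x, 0 ≤ ρ x)
    {Φ : OpenPartialHomeomorph (FormBundle n k N) (N × FormModel n k)}
    {V : Submodule ℝ (FormModel n k)} {ℓ : FormModel n k →L[ℝ] ℝ}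
    (hΦ : ContMDiffOn (formI n k) (formI n k) ∞ Φ Φ.source)
    (hΦs : ContMDiffOn (formI n k) (formI n k) ∞ Φ.symm Φ.target)
    (hM : ∀ μ' ∈ Φ.source, (Φ μ').1 = μ'.proj ∧ (μ' ∈ M ↔ (Φ μ').2 ∈ V ∧ 0 ≤ ℓ (Φ μ').2))
    (hsupp : ∀ x ∈ tsupport ρ, γ x ∈ Φ.source) {u : FormModel n k} (hu : u ∈ V) (hℓu : 0 ≤ ℓ u)
    (huK : ∀ x, x ∉ K → ρ x = 0 ∨ u = 0) [T2Space X] :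
    ∃ ε' > 0, ∃ σ', IsPartialLift M K γ τ (fun x => φ x + ρ x) ε' σ' ∧
      ∀ t ∈ Ico 0 ε', ∀ x ∈ tsupport ρ ∩ K, σ' t x =
        Φ.symm (τ (t * (φ x + ρ x)) x, rayPoint (Φ (σ t x)).2 u (t * ρ x)) := by
  classical
  set T := tsupport ρ ∩ K with hT
  have hTc : IsCompact T := hK.inter_left (isClosed_tsupport ρ)
  have hψ0 : ∀ x, 0 ≤ φ x + ρ x := fun x => add_nonneg (hφ0 x) (hρ0 x)
  set pair : ℝ × X → N × FormModel n k := fun a =>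
    (τ (a.1 * (φ a.2 + ρ a.2)) a.2, rayPoint (Φ (σ a.1 a.2)).2 u (a.1 * ρ a.2)) with hpair
  set W : Set (ℝ × X) := {a | σ a.1 a.2 ∈ Φ.source ∧ pair a ∈ Φ.target} with hW
  have hpairs : ∀ a ∈ Ico 0 ε ×ˢ (univ : Set X), σ a.1 a.2 ∈ Φ.source →
      ContMDiffWithinAt (𝓘(ℝ, ℝ).prod (𝓡 n)) (formI n k) ∞ pair (Ico 0 ε ×ˢ univ) a := by
    intro a ha hs
    have h1 := (contMDiffOn_rescale hτ (hφ.add hρ) hψ0 a ⟨ha.1.1, mem_univ _⟩).mono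
      (prod_mono (s₁ := Ico 0 ε) (fun t ht => ht.1) le_rfl)
    have h2 := ((hΦ.contMDiffAt (Φ.open_source.mem_nhds hs)).comp_contMDiffWithinAt a
      (f := fun a : ℝ × X => σ a.1 a.2) (hσ.smooth a ha))
    have h3 : ContMDiff (𝓘(ℝ, ℝ).prod (𝓡 n)) 𝓘(ℝ, ℝ) ∞ (fun a : ℝ × X => a.1 * ρ a.2) :=
      contMDiff_fst.mul (hρ.comp contMDiff_snd)
    exact h1.prodMk (contMDiffWithinAt_rayPoint
      (contMDiff_snd.contMDiffAt.comp_contMDiffWithinAt a h2) h3.contMDiffAt.contMDiffWithinAt u)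
  have hWopen : ∀ a ∈ Ico 0 ε ×ˢ (univ : Set X), a ∈ W → W ∈ 𝓝[Ico 0 ε ×ˢ univ] a := by
    intro a ha haW
    exact Filter.inter_mem
      ((hσ.smooth a ha).continuousWithinAt.preimage_mem_nhdsWithin
        (Φ.open_source.mem_nhds haW.1))
      ((hpairs a ha haW.1).continuousWithinAt.preimage_mem_nhdsWithin
        (Φ.open_target.mem_nhds haW.2))
  -- Off `T` the new formula returns the old family wherever it makes sense, so the two definitions
  -- glue smoothly across the boundary of `T`.
  have hG : ∀ t ∈ Ico 0 ε, ∀ x, (t, x) ∈ W → x ∉ T → Φ.symm (pair (t, x)) = σ t x := by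
    intro t ht x hx hxT
    have h1 : pair (t, x) = Φ (σ t x) := by
      refine Prod.ext ?_ ?_
      swap
      · by_cases hxK : x ∈ K
        · have : ρ x = 0 := image_eq_zero_of_notMem_tsupport fun h => hxT ⟨h, hxK⟩
          simp only [hpair, this, mul_zero, rayPoint_zero]
        · rcases huK x hxK with h | h
          · simp only [hpair, h, mul_zero, rayPoint_zero]
          · exact rayPoint_of_eq_zero h _ _
      rw [(hM _ hx.1).1, hσ.proj_eq t ht]
      by_cases hxK : x ∈ K
      · have : ρ x = 0 := image_eq_zero_of_notMem_tsupport fun h => hxT ⟨h, hxK⟩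
        simp only [hpair, this, add_zero]
      · exact (hτK _ (mul_nonneg ht.1 (hψ0 x)) x hxK).trans
          (hτK _ (mul_nonneg ht.1 (hφ0 x)) x hxK).symm
    rw [h1, Φ.left_inv hx.1]
  have h0W : ∀ x ∈ T, ((0 : ℝ), x) ∈ W := by
    intro x hx
    have h1 := hsupp x hx.1
    have h2 : pair (0, x) = Φ (γ x) := by
      refine Prod.ext ?_ (by simp only [hpair, hσ.init, zero_mul, rayPoint_zero])
      simp only [hpair, zero_mul]
      rw [(hM _ h1).1, hτ0]
    refine ⟨by simpa only [hσ.init] using h1, ?_⟩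
    rw [h2]
    exact Φ.map_source h1
  -- At time `0` the formula gives `γ`; compactness of `T` keeps it inside the chart for a common
  -- short time.
  have hev : ∀ᶠ t in 𝓝[Ici 0] (0 : ℝ), ∀ x ∈ T, (t, x) ∈ W := by
    refine eventually_forall_mem_compact hTc fun x hx => ?_
    have h1 := hWopen (0, x) ⟨⟨le_rfl, hε⟩, mem_univ _⟩ (h0W x hx)
    rwa [nhdsWithin_prod_eq, show 𝓝[Ico 0 ε] (0 : ℝ) = 𝓝[Ici 0] 0 from
      nhdsWithin_inter_of_mem' (mem_nhdsWithin_of_mem_nhds (Iio_mem_nhds hε)),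
      ← nhdsWithin_prod_eq] at h1
  obtain ⟨ε₁, hε₁, hsub⟩ := mem_nhdsGE_iff_exists_Ico_subset.1 hev
  have hε' : 0 < min ε ε₁ := lt_min hε hε₁
  have hI : Ico 0 (min ε ε₁) ⊆ Ico 0 ε := Ico_subset_Ico_right (min_le_left _ _)
  have hTW : ∀ t ∈ Ico 0 (min ε ε₁), ∀ x ∈ T, (t, x) ∈ W := fun t ht x hx =>
    hsub ⟨ht.1, ht.2.trans_le (min_le_right _ _)⟩ x hx
  refine ⟨min ε ε₁, hε', fun t x => if x ∈ T then Φ.symm (pair (t, x)) else σ t x, ⟨?_, ?_, ?_, ?_, ?_⟩,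
    fun t _ x hx => if_pos hx⟩
  · rintro ⟨t, x⟩ ⟨ht, -⟩
    have hmem : (t, x) ∈ Ico 0 ε ×ˢ (univ : Set X) := ⟨hI ht, mem_univ _⟩
    by_cases hx : x ∈ T
    · have haW := hTW t ht x hx
      have h1 : ContMDiffWithinAt (𝓘(ℝ, ℝ).prod (𝓡 n)) (formI n k) ∞
          (fun a => Φ.symm (pair a)) (Ico 0 ε ×ˢ univ) (t, x) :=
        (hΦs.contMDiffAt (Φ.open_target.mem_nhds haW.2)).comp_contMDiffWithinAt (t, x)
          (hpairs _ hmem haW.1)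
      refine (h1.congr_of_eventuallyEq_of_mem ?_ hmem).mono (prod_mono hI le_rfl)
      filter_upwards [hWopen _ hmem haW, self_mem_nhdsWithin] with b hb hb'
      by_cases hbT : b.2 ∈ T
      · simp only [hbT, if_true]
      · simp only [hbT, if_false]
        exact (hG b.1 hb'.1 b.2 hb hbT).symm
    · refine ((hσ.smooth _ hmem).congr_of_eventuallyEq_of_mem ?_ hmem).mono (prod_mono hI le_rfl)
      filter_upwards [continuous_snd.continuousWithinAt.preimage_mem_nhdsWithin (x := (t, x))
        (s := Ico 0 ε ×ˢ univ) (hTc.isClosed.isOpen_compl.mem_nhds hx)] with b hb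
      have hb' : b.2 ∉ T := hb
      simp only [hb', if_false]
  · funext x
    by_cases hx : x ∈ T
    · have h1 := hsupp x hx.1
      have h2 : pair (0, x) = Φ (γ x) := by
        refine Prod.ext ?_ (by simp only [hpair, hσ.init, zero_mul, rayPoint_zero])
        simp only [hpair, zero_mul]
        rw [(hM _ h1).1, hτ0]
      simp only [hx, if_true, h2, Φ.left_inv h1]
    · simp only [hx, if_false, hσ.init]
  · intro t ht x
    by_cases hx : x ∈ T
    · have haW := hTW t ht x hx
      simp only [hx, if_true]
      have h1 := (hM _ (Φ.map_target haW.2)).2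
      rw [h1, Φ.right_inv haW.2]
      obtain ⟨hV, hℓ⟩ := (hM _ haW.1).2.1 (hσ.mem t (hI ht) x)
      -- The push is by a nonnegative multiple of an inward direction, so the half-space is
      -- preserved.
      exact ⟨rayPoint_mem hV hu _, rayPoint_nonneg hℓ hℓu (mul_nonneg ht.1 (hρ0 x))⟩
    · simp only [hx, if_false]
      exact hσ.mem t (hI ht) x
  · intro t ht x
    by_cases hx : x ∈ T
    · have haW := hTW t ht x hx
      simp only [hx, if_true]
      rw [← (hM _ (Φ.map_target haW.2)).1, Φ.right_inv haW.2]
    · simp only [hx, if_false]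
      rw [hσ.proj_eq t (hI ht)]
      by_cases hxK : x ∈ K
      · have : ρ x = 0 := image_eq_zero_of_notMem_tsupport fun h => hx ⟨h, hxK⟩
        simp only [this, add_zero]
      · rw [hτK _ (mul_nonneg ht.1 (hψ0 x)) x hxK, hτK _ (mul_nonneg ht.1 (hφ0 x)) x hxK]
  · intro t ht x hx
    have : x ∉ T := fun h => hx h.2
    simp only [this, if_false]
    exact hσ.support t (hI ht) x hx

/-- The reparametrization `s ↦ εs / (ε + s)` of `[0, ∞)` onto `[0, ε)`. -/
def timeChange (ε s : ℝ) : ℝ := ε * s / (ε + s)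

theorem timeChange_mem (hε : 0 < ε) {s : ℝ} (hs : 0 ≤ s) : timeChange ε s ∈ Ico 0 ε := by
  have : 0 < ε + s := by positivity
  refine ⟨by unfold timeChange; positivity, ?_⟩
  rw [timeChange, div_lt_iff₀ this]
  nlinarith

theorem contDiffOn_timeChange (hε : 0 < ε) : ContDiffOn ℝ ∞ (timeChange ε) (Ici 0) := by
  unfold timeChange
  refine ContDiffOn.div (by fun_prop) (by fun_prop) fun s hs => ?_
  have : 0 ≤ s := hs
  positivity

theorem timeChange_zero : timeChange ε 0 = 0 := by simp [timeChange]

theorem contMDiffOn_timeChange_family {B E' H' : Type*} [NormedAddCommGroup E'] [NormedSpace ℝ E']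
    [TopologicalSpace H'] {I' : ModelWithCorners ℝ E' H'} [TopologicalSpace B] [ChartedSpace H' B]
    {σ : ℝ → X → B} (hε : 0 < ε) (hσ : ContMDiffOn (𝓘(ℝ, ℝ).prod (𝓡 n)) I' ∞
      (fun a : ℝ × X => σ a.1 a.2) (Ico 0 ε ×ˢ univ)) :
    ContMDiffOn (𝓘(ℝ, ℝ).prod (𝓡 n)) I' ∞ (fun a : ℝ × X => σ (timeChange ε a.1) a.2)
      (Ici 0 ×ˢ univ) := by
  have h1 : ContMDiffOn (𝓘(ℝ, ℝ).prod (𝓡 n)) 𝓘(ℝ, ℝ) ∞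
      (fun a : ℝ × X => timeChange ε a.1) (Ici 0 ×ˢ univ) :=
    (contDiffOn_timeChange hε).contMDiffOn.comp contMDiff_fst.contMDiffOn fun a ha => ha.1
  exact hσ.comp (h1.prodMk contMDiff_snd.contMDiffOn)
    fun a ha => ⟨timeChange_mem hε ha.1, mem_univ _⟩

theorem IsPartialLift.isVariation (hσ : IsPartialLift M K γ τ φ ε σ) (hε : 0 < ε) :
    IsVariation n (formI n k) M K γ (fun s => σ (timeChange ε s)) where
  smooth := contMDiffOn_timeChange_family hε hσ.smooth
  init := by rw [timeChange_zero, hσ.init]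
  mem s hs x := hσ.mem _ (timeChange_mem hε hs) x
  support s hs x hx := hσ.support _ (timeChange_mem hε hs) x hx

/-- Every variation of the projection of `γ` lifts, up to a change of time, to a variation of `γ`
in the fibred submanifold `M`. -/
theorem IsVariation.exists_lift [T2Space X] [SigmaCompactSpace X] [IsManifold (𝓡 n) ∞ X] {m : ℕ}
    (hM : IsFibredSubmanifold m M) (hγ : ContMDiff (𝓡 n) (formI n k) ∞ γ) (hγM : ∀ x, γ x ∈ M)
    (hK : IsCompact K) (hτ : IsVariation n (𝓡 (n + k)) univ K (fun x => (γ x).proj) τ) :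
    ∃ ε > 0, ∃ σ, IsVariation n (formI n k) M K γ σ ∧
      ∀ s, 0 ≤ s → ∀ x, (σ s x).proj = τ (timeChange ε s) x := by
  classical
  choose Φ V ℓ hsrc hV hΦ hΦs hΦM using fun x => hM (γ x) (hγM x)
  obtain ⟨t, ht⟩ := hK.elim_finite_subcover (fun x : X => γ ⁻¹' (Φ x).source)
    (fun x => (Φ x).open_source.preimage hγ.continuous)
    fun x _ => mem_iUnion.2 ⟨x, hsrc x⟩
  obtain ⟨ρ, hρ⟩ := SmoothPartitionOfUnity.exists_isSubordinate (𝓡 n) hK.isClosed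
    (fun i : t => γ ⁻¹' (Φ i).source)
    (fun i => (Φ i).open_source.preimage hγ.continuous)
    (fun x hx => by
      obtain ⟨y, hy, hxy⟩ := mem_iUnion₂.1 (ht hx)
      exact mem_iUnion.2 ⟨⟨y, hy⟩, hxy⟩)
  -- Induction over the charts: after the charts in `s` have been used, the base point at `x` has
  -- moved for the time `t ∑ ρ i x`.
  have key : ∀ s : Finset t, ∃ ε > 0, ∃ σ,
      IsPartialLift M K γ τ (fun x => ∑ i ∈ s, ρ i x) ε σ := by
    intro s
    induction s using Finset.induction_on with
    | empty =>
      refine ⟨1, one_pos, fun _ => γ, (hγ.comp contMDiff_snd).contMDiffOn, rfl,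
        fun _ _ x => hγM x, fun t _ x => ?_, fun _ _ _ _ => rfl⟩
      simp [hτ.init]
    | insert i s hi ih =>
      obtain ⟨ε, hε, σ, hσ⟩ := ih
      obtain ⟨ε', hε', σ', hσ', -⟩ := hσ.extend hε hK hτ.smooth (fun x => by rw [hτ.init]) hτ.support
        (contMDiff_finsetSum fun i _ => (ρ i).contMDiff)
        (fun x => Finset.sum_nonneg fun i _ => ρ.nonneg i x) (ρ i).contMDiff (ρ.nonneg i)
        (hΦ i) (hΦs i) (hΦM i) (fun x hx => hρ i hx)
        -- `u = 0`: only the base point moves.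
        (V (i : X)).zero_mem (map_zero (ℓ (i : X))).ge (fun _ _ => Or.inr rfl)
      refine ⟨ε', hε', σ', ?_⟩
      simpa only [Finset.sum_insert hi, add_comm] using hσ'
  obtain ⟨ε, hε, σ, hσ⟩ := key Finset.univ
  refine ⟨ε, hε, _, hσ.isVariation hε, fun s hs x => ?_⟩
  have hm := timeChange_mem hε hs
  rw [hσ.proj_eq _ hm]
  by_cases hx : x ∈ K
  -- On `K` the weights add up to `1`, so the full time has been used; off `K` the base variation is
  -- constant.
  · have h1 := ρ.sum_eq_one hx
    rw [finsum_eq_sum_of_fintype] at h1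
    simp only [h1, mul_one]
  · rw [hτ.support _ hm.1 x hx, hτ.support _ _ x hx]
    exact mul_nonneg hm.1 (Finset.sum_nonneg fun i _ => ρ.nonneg i x)

end Lifting

/-! ### Critical points of the two actions -/

section Critical

variable {n k : ℕ} {N : Type*} [TopologicalSpace N]
  [ChartedSpace (EuclideanSpace ℝ (Fin (n + k))) N] [IsManifold (𝓡 (n + k)) ∞ N]
  {X : Type*} [TopologicalSpace X] [ChartedSpace (EuclideanSpace ℝ (Fin n)) X]
  [IsManifold (𝓡 n) ∞ X] [T2Space X] [SigmaCompactSpace X]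
  {vol : ∀ q : N, FormFiber n k N q} {L : MultiVecBundle n k N → ℝ} {M : Set (FormBundle n k N)}

theorem IsVariation.proj {K : Set X} {γ : X → FormBundle n k N} {σ : ℝ → X → FormBundle n k N}
    (hσ : IsVariation n (formI n k) M K γ σ) :
    IsVariation n (𝓡 (n + k)) univ K (fun x => (γ x).proj) (fun s x => (σ s x).proj) where
  smooth := contMDiffOn_proj_family hσ.smooth
  init := by rw [hσ.init]
  mem _ _ _ := mem_univ _
  support s hs x hx := by rw [hσ.support s hs x hx]

/-- The inverse reparametrization `t ↦ ε t / (ε - t)` of `[0, ε)` is differentiable at `0`, so the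
chain rule undoes the time change. -/
theorem hasDerivWithinAt_zero_of_timeChange {A : ℝ → ℝ} {ε : ℝ} (hε : 0 < ε)
    (h : HasDerivWithinAt (fun s => A (timeChange ε s)) 0 (Ici 0) 0) :
    HasDerivWithinAt A 0 (Ici 0) 0 := by
  have h1 : DifferentiableAt ℝ (fun t : ℝ => ε * t / (ε - t)) 0 := by
    refine DifferentiableAt.div (by fun_prop) (by fun_prop) ?_
    simpa using hε.ne'
  have h2 : HasDerivWithinAt (fun t : ℝ => ε * t / (ε - t)) _ (Ico 0 ε) 0 :=
    h1.hasDerivAt.hasDerivWithinAt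
  have hmaps : MapsTo (fun t : ℝ => ε * t / (ε - t)) (Ico 0 ε) (Ici 0) := fun t ht =>
    div_nonneg (mul_nonneg hε.le ht.1) (sub_nonneg.2 ht.2.le)
  have h3 : HasDerivWithinAt (fun s => A (timeChange ε s)) 0 (Ici 0) (ε * 0 / (ε - 0)) := by
    simpa using h
  have h4 := h3.comp (h₂ := fun s => A (timeChange ε s)) 0 h2 hmaps
  rw [zero_mul] at h4
  have h5 : HasDerivWithinAt A 0 (Ico 0 ε) 0 := by
    refine h4.congr_of_mem (fun t ht => ?_) ⟨le_rfl, hε⟩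
    have : ε - t ≠ 0 := (sub_pos.2 ht.2).ne'
    have h6 : timeChange ε (ε * t / (ε - t)) = t := by
      unfold timeChange
      have h7 : ε + ε * t / (ε - t) = ε * ε / (ε - t) := by
        field_simp
        ring
      rw [h7]
      field_simp
    simp only [Function.comp_apply, h6]
  exact h5.mono_of_mem_nhdsWithin (Ico_mem_nhdsGE hε)

/-- The two actions have the same first variation along any variation of `γ` and its projection. One
direction projects variations; the other lifts them up to a time change. -/
theorem IsLegendreLift.isCriticalPoint_iff (hn : 1 ≤ n) (hvol : IsSpaceTimeVolume vol)
    (hL : IsLagrangian vol L) (hM : LegendreCorrespondenceHypothesis vol L M)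
    {γ : X → FormBundle n k N} (hγ : IsLegendreLift vol L M (fun x => (γ x).proj) γ) :
    IsCriticalPoint n (𝓡 (n + k)) univ (lagrangianAction vol L) (fun x => (γ x).proj) ↔
      IsCriticalPoint n (formI n k) M (hamiltonianAction vol L) γ := by
  constructor
  · intro h K hK σ hσ
    have h1 := hasDerivWithinAt_hamiltonianAction_sub_lagrangianAction hn hvol hL hM hγ hK hσ
    have h2 := h1.add (h K hK _ hσ.proj)
    rw [add_zero] at h2
    refine h2.congr_of_mem (fun s _ => ?_) self_mem_Ici
    simp only [Pi.add_apply]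
    ring
  · intro h K hK τ hτ
    obtain ⟨m, -, hfib⟩ := hM.fibred
    obtain ⟨ε, hε, σ, hσ, hστ⟩ := hτ.exists_lift hfib hγ.lift.smooth hγ.lift.mem hK
    have h1 := hasDerivWithinAt_hamiltonianAction_sub_lagrangianAction hn hvol hL hM hγ hK hσ
    have h2 := (h K hK σ hσ).sub h1
    rw [sub_zero] at h2
    refine hasDerivWithinAt_zero_of_timeChange hε
      (h2.congr_of_mem (fun s hs => ?_) self_mem_Ici)
    have h3 : τ (timeChange ε s) = fun x => (σ s x).proj := funext fun x => (hστ s hs x).symm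
    simp only [h3, Pi.sub_apply]
    ring

end Critical

/-! ### Vertical variations -/

section Vertical

variable {n k : ℕ} {N : Type*} [TopologicalSpace N]
  [ChartedSpace (EuclideanSpace ℝ (Fin (n + k))) N] [IsManifold (𝓡 (n + k)) ∞ N]
  {X : Type*} [TopologicalSpace X] [ChartedSpace (EuclideanSpace ℝ (Fin n)) X]
  [IsManifold (𝓡 n) ∞ X] [T2Space X]
  {vol : ∀ q : N, FormFiber n k N q} {L : MultiVecBundle n k N → ℝ} {M : Set (FormBundle n k N)}
  {γ : X → FormBundle n k N} {x₀ : X}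

/-- The constant family is extended with weight a bump function `f`; `f = 1` at `x₀` gives the exact
ray there, whose velocity can be prescribed. -/
theorem exists_vertical_lift (hγ : ContMDiff (𝓡 n) (formI n k) ∞ γ) (hγM : ∀ x, γ x ∈ M)
    {Φ : OpenPartialHomeomorph (FormBundle n k N) (N × FormModel n k)}
    {V : Submodule ℝ (FormModel n k)} {ℓ : FormModel n k →L[ℝ] ℝ} (hsrc : γ x₀ ∈ Φ.source)
    (hΦ : ContMDiffOn (formI n k) (formI n k) ∞ Φ Φ.source)
    (hΦs : ContMDiffOn (formI n k) (formI n k) ∞ Φ.symm Φ.target)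
    (hM : ∀ μ' ∈ Φ.source, (Φ μ').1 = μ'.proj ∧ (μ' ∈ M ↔ (Φ μ').2 ∈ V ∧ 0 ≤ ℓ (Φ μ').2))
    {u : FormModel n k} (hu : u ∈ V) (hℓu : 0 ≤ ℓ u) :
    ∃ (K : Set X) (φ : X → ℝ) (ε : ℝ) (σ : ℝ → X → FormBundle n k N), 0 < ε ∧
      IsPartialLift M K γ (fun _ x => (γ x).proj) φ ε σ ∧ ∀ t ∈ Ico 0 ε,
        σ t x₀ = Φ.symm ((γ x₀).proj, rayPoint (Φ (γ x₀)).2 u t) := by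
  obtain ⟨f, -, hf⟩ := (SmoothBumpFunction.nhds_basis_tsupport (I := 𝓡 n) x₀).mem_iff.1
    (hγ.continuous.continuousAt.preimage_mem_nhds (Φ.open_source.mem_nhds hsrc))
  have h0 : IsPartialLift M (tsupport f) γ (fun _ x => (γ x).proj) (fun _ => 0) 1 (fun _ => γ) :=
    ⟨(hγ.comp contMDiff_snd).contMDiffOn, rfl, fun _ _ x => hγM x, fun _ _ _ => rfl,
      fun _ _ _ _ => rfl⟩
  obtain ⟨ε, hε, σ, hσ, hσ'⟩ := h0.extend one_pos f.hasCompactSupport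
    (contMDiff_formProj.comp (hγ.comp contMDiff_snd)).contMDiffOn (fun _ => rfl)
    (fun _ _ _ _ => rfl) contMDiff_const (fun _ => le_rfl) f.contMDiff (fun _ => f.nonneg)
    hΦ hΦs hM hf hu hℓu (fun x hx => Or.inl (image_eq_zero_of_notMem_tsupport hx))
  refine ⟨_, _, ε, σ, hε, hσ, fun t ht => ?_⟩
  have hx₀ : x₀ ∈ tsupport f := subset_tsupport _ (by
    rw [Function.mem_support, f.eq_one]
    exact one_ne_zero)
  rw [hσ' t ht x₀ ⟨hx₀, hx₀⟩, f.eq_one, mul_one]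

/-- Time at `x` is slowed down by the factor `χ x`. The family is vertical, so this leaves the
projection fixed while shrinking the support. -/
theorem IsPartialLift.localize {K : Set X} {φ : X → ℝ} {ε : ℝ} {σ : ℝ → X → FormBundle n k N}
    (hσ : IsPartialLift M K γ (fun _ x => (γ x).proj) φ ε σ) {χ : X → ℝ}
    (hχ : ContMDiff (𝓡 n) 𝓘(ℝ, ℝ) ∞ χ) (hχ0 : ∀ x, 0 ≤ χ x) (hχ1 : ∀ x, χ x ≤ 1) {K' : Set X}
    (hK' : ∀ x, x ∉ K' → χ x = 0) {ε' : ℝ} (hε' : 0 < ε') (hεε' : ε' ≤ ε) :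
    IsVariation n (formI n k) M K' γ (fun s x => σ (timeChange ε' s * χ x) x) := by
  have hmem : ∀ s, 0 ≤ s → ∀ x, timeChange ε' s * χ x ∈ Ico 0 ε := fun s hs x => by
    have h1 := timeChange_mem hε' hs
    exact ⟨mul_nonneg h1.1 (hχ0 x), ((mul_le_of_le_one_right h1.1 (hχ1 x)).trans_lt h1.2).trans_le
      hεε'⟩
  refine ⟨?_, ?_, fun s hs x => hσ.mem _ (hmem s hs x) x, fun s hs x hx => ?_⟩
  · have h1 : ContMDiffOn (𝓘(ℝ, ℝ).prod (𝓡 n)) 𝓘(ℝ, ℝ) ∞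
        (fun a : ℝ × X => timeChange ε' a.1) (Ici 0 ×ˢ univ) :=
      (contDiffOn_timeChange hε').contMDiffOn.comp contMDiff_fst.contMDiffOn fun a ha => ha.1
    exact hσ.smooth.comp ((h1.mul (hχ.comp contMDiff_snd).contMDiffOn).prodMk
      contMDiff_snd.contMDiffOn) fun a ha => ⟨hmem _ ha.1 _, mem_univ _⟩
  · simp only [timeChange_zero, zero_mul, hσ.init]
  · simp only [hK' x hx, mul_zero, hσ.init]

theorem tangentMultiVec_apply_congr {h₁ h₂ : X → N} (h : h₁ = h₂) {x : X}
    {p₁ : FormFiber n k N (h₁ x)} {p₂ : FormFiber n k N (h₂ x)}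
    (hp : (⟨h₁ x, p₁⟩ : FormBundle n k N) = ⟨h₂ x, p₂⟩) :
    (tangentMultiVec vol h₁ x p₁ : ℝ) = tangentMultiVec vol h₂ x p₂ := by
  subst h
  rw [eq_of_heq (TotalSpace.mk.inj hp).2]

theorem hasDerivWithinAt_timeChange {ε : ℝ} (hε : 0 < ε) : HasDerivWithinAt (timeChange ε) 1 (Ici 0) 0 := by
  have h := ((hasDerivAt_id (0 : ℝ)).const_mul ε).div ((hasDerivAt_id (0 : ℝ)).const_add ε)
    (by simpa using hε.ne')
  refine (h.congr_deriv ?_).hasDerivWithinAt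
  simp [hε.ne', pow_two]

theorem nonneg_of_hasDerivWithinAt_Ici {h : ℝ → ℝ} {a : ℝ} (hd : HasDerivWithinAt h a (Ici 0) 0)
    (h0 : h 0 = 0) (hpos : ∀ᶠ s in 𝓝[Ici 0] (0 : ℝ), 0 ≤ h s) : 0 ≤ a := by
  rw [hasDerivWithinAt_iff_tendsto_slope, Ici_sdiff_left] at hd
  refine ge_of_tendsto hd ?_
  filter_upwards [self_mem_nhdsWithin, nhdsWithin_mono _ Ioi_subset_Ici_self hpos] with s hs hs'
  rw [slope_def_field, h0, sub_zero, sub_zero]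
  exact div_nonneg hs' (le_of_lt hs)

variable [SigmaCompactSpace X]

/-- The first variation of the Hamiltonian action along a vertical family vanishes pointwise at
critical points. -/
theorem IsPartialLift.vertical_deriv_eq_zero (hn : 1 ≤ n) (hvol : IsSpaceTimeVolume vol)
    (hL : IsLagrangian vol L) (hM : LegendreCorrespondenceHypothesis vol L M)
    (hγ : IsOmegaSubmanifoldLift vol M γ)
    (hcrit : IsCriticalPoint n (formI n k) M (hamiltonianAction vol L) γ)
    {K : Set X} {φ : X → ℝ} {ε : ℝ} {σ : ℝ → X → FormBundle n k N}
    (hσ : IsPartialLift M K γ (fun _ x => (γ x).proj) φ ε σ) (hε : 0 < ε) {A : ℝ}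
    (hA : HasDerivWithinAt (fun r => (tangentMultiVec vol (fun x => (σ r x).proj) x₀ (σ r x₀).2 : ℝ) -
      hamiltonian vol L (σ r x₀)) A (Ici 0) 0) : A = 0 := by
  by_contra hA0
  set g : X → N := fun x => (γ x).proj with hg
  have hg0 : ∀ x, pullbackForm (𝓡 n) (𝓡 (n + k)) g vol x ≠ 0 := hγ.pullbackForm_proj_ne_zero
  have hproj : ∀ r ∈ Ico 0 ε, (fun x => (σ r x).proj) = g := fun r hr => funext (hσ.proj_eq r hr)
  have h0ε : (0 : ℝ) ∈ Ico 0 ε := ⟨le_rfl, hε⟩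
  set B : ℝ × X → ℝ := fun a =>
    (tangentMultiVec vol (fun x => (σ a.1 x).proj) a.2 (σ a.1 a.2).2 : ℝ) -
      hamiltonian vol L (σ a.1 a.2) with hB
  have hBs : ContMDiffWithinAt (𝓘(ℝ, ℝ).prod (𝓡 n)) 𝓘(ℝ, ℝ) ∞ B (Ici 0 ×ˢ univ) (0, x₀) := by
    have h1 := contMDiffWithinAt_hamiltonian_family (x₀ := x₀) hn hvol hL hM hσ.smooth hσ.mem h0ε
      (by rw [hproj 0 h0ε]; exact hg0 x₀)
    refine h1.mono_of_mem_nhdsWithin ?_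
    rw [nhdsWithin_prod_eq]
    exact Filter.prod_mem_prod (Ico_mem_nhdsGE hε) Filter.univ_mem
  -- With tolerance `|A| / 2` the density moves at speed at least `|A| / 2`, with the sign of `A`,
  -- at all points near `x₀`.
  have hest := eventually_abs_sub_le (half_pos (abs_pos.2 hA0)) hBs hA
  rw [nhdsWithin_prod_eq, nhdsWithin_univ] at hest
  obtain ⟨pa, hpa, pb, hpb, hab⟩ := Filter.eventually_prod_iff.1 hest
  obtain ⟨ε₁, hε₁, hsub⟩ := mem_nhdsGE_iff_exists_Ico_subset.1 hpa
  obtain ⟨χ, -, hχ⟩ := (SmoothBumpFunction.nhds_basis_tsupport (I := 𝓡 n) x₀).mem_iff.1 hpb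
  set ε' := min ε ε₁ with hε'
  have hε'0 : 0 < ε' := lt_min hε hε₁
  have hχ0 : ∀ x, 0 ≤ χ x := fun _ => χ.nonneg
  have hχ1 : ∀ x, χ x ≤ 1 := fun _ => χ.le_one
  have hvar := hσ.localize χ.contMDiff hχ0 hχ1 (K' := tsupport χ)
    (fun x hx => image_eq_zero_of_notMem_tsupport hx) hε'0 (min_le_left _ _)
  have hK : IsCompact (tsupport χ) := χ.hasCompactSupport
  have hmem : ∀ s, 0 ≤ s → ∀ x, timeChange ε' s * χ x ∈ Ico 0 ε' := fun s hs x => by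
    have h1 := timeChange_mem hε'0 hs
    exact ⟨mul_nonneg h1.1 (hχ0 x), (mul_le_of_le_one_right h1.1 (hχ1 x)).trans_lt h1.2⟩
  have hmemε : ∀ s, 0 ≤ s → ∀ x, timeChange ε' s * χ x ∈ Ico 0 ε := fun s hs x =>
    Ico_subset_Ico_right (min_le_left _ _) (hmem s hs x)
  set η : ℝ → X → FormBundle n k N := fun s x => σ (timeChange ε' s * χ x) x with hη
  have hηproj : ∀ s, 0 ≤ s → (fun x => (η s x).proj) = g := fun s hs =>
    funext fun x => hσ.proj_eq _ (hmemε s hs x) x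
  set ν := pullbackForm (𝓡 n) (𝓡 (n + k)) g vol with hν
  set b : ℝ → X → ℝ := fun s x => B (timeChange ε' s * χ x, x) with hb
  -- `η s` is not a time slice of `σ`, but all projections equal `g`. The tangent multivector is
  -- therefore the same, and the density at `x` depends only on the value `η s x`, not on
  -- derivatives of the fibre coordinate.
  have hbη : ∀ s, 0 ≤ s → ∀ x, (tangentMultiVec vol (fun x => (η s x).proj) x (η s x).2 : ℝ) -
      hamiltonian vol L (η s x) = b s x := by
    intro s hs x
    refine congrArg (fun r => r - hamiltonian vol L (η s x)) ?_
    exact tangentMultiVec_apply_congr ((hηproj s hs).trans (hproj _ (hmemε s hs x)).symm) rfl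
  have hact : ∀ s, 0 ≤ s → hamiltonianAction vol L (tsupport χ) (η s) =
      formIntegral ν (fun x => b s x • ν x) (tsupport χ) := by
    intro s hs
    have hslice : ContMDiff (𝓡 n) (formI n k) ∞ (η s) := fun x =>
      contMDiffWithinAt_univ.1 (contMDiffWithinAt_comp_of_eventually_mem
        (f := fun x : X => (s, x)) (a := x) (hvar.smooth (s, x) ⟨hs, mem_univ _⟩)
        (contMDiffWithinAt_const.prodMk contMDiffWithinAt_id)
        (Filter.Eventually.of_forall fun _ => ⟨hs, mem_univ _⟩))
    rw [hamiltonianAction_eq hK hslice (by rw [hηproj s hs]; exact fun x _ => hg0 x)]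
    simp only [hbη s hs]
    rw [hηproj s hs]
  have hbc : ∀ s, 0 ≤ s → ContinuousOn (b s) (tsupport χ) := by
    intro s hs x _
    have h1 := contMDiffWithinAt_hamiltonian_family (x₀ := x) (s₀ := s) hn hvol hL hM hvar.smooth
      hvar.mem hs (by rw [hηproj s hs]; exact hg0 x)
    have h2 := continuousAt_slice hs h1.continuousWithinAt
    have h3 : (fun x => (tangentMultiVec vol (fun x => (η s x).proj) x (η s x).2 : ℝ) -
      hamiltonian vol L (η s x)) = b s := funext (hbη s hs)
    exact (h3 ▸ h2 : ContinuousAt (b s) x).continuousWithinAt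
  have hνc : ∀ c, ContinuousOn (formCoeff ν c) (chartPiece n (tsupport χ) c) := fun c =>
    continuousOn_formCoeff_chartPiece (f := fun _ => g) (S := univ) hvol
      ((contMDiff_formProj.comp hγ.smooth).comp contMDiff_snd).contMDiffOn (mem_univ 0) _ c
  have hχc : ContinuousOn χ (tsupport χ) := χ.contMDiff.continuous.continuousOn
  set J := formIntegral ν (fun x => χ x • ν x) (tsupport χ) with hJ
  have hJ0 : 0 < J := by
    refine formIntegral_smul_pos hK hνc hχc (fun x _ => hχ0 x) (x₀ := x₀) ?_
      (by rw [χ.eq_one]; exact one_pos) ?_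
    · exact χ.tsupport_mem_nhds
    · intro c hc
      rw [formCoeff_extChartAt hc]
      obtain ⟨d, hd, hα⟩ := exists_chartFrame_eq hc
      rw [hα]
      exact mul_ne_zero hd (topForm_ne_zero_iff.1 (hg0 x₀))
  -- `e` is the sign of `A`; it treats both signs at once.
  obtain ⟨e, he, heA⟩ : ∃ e : ℝ, |e| = 1 ∧ e * A = |A| := by
    rcases lt_or_gt_of_ne hA0 with h | h
    · exact ⟨-1, by simp, by rw [abs_of_neg h, neg_one_mul]⟩
    · exact ⟨1, by simp, by rw [abs_of_pos h, one_mul]⟩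
  have hlow : ∀ s, 0 ≤ s → |A| / 2 * timeChange ε' s * J ≤
      e * (hamiltonianAction vol L (tsupport χ) (η s) -
        hamiltonianAction vol L (tsupport χ) (η 0)) := by
    intro s hs
    rw [hact s hs, hact 0 le_rfl, formIntegral_smul_sub hK hνc (hbc s hs) (hbc 0 le_rfl), hJ,
      ← formIntegral_const_mul hK, ← formIntegral_const_mul hK]
    refine formIntegral_smul_mono hK hνc (continuousOn_const.mul hχc)
      (continuousOn_const.mul ((hbc s hs).sub (hbc 0 le_rfl))) fun x hx => ?_
    have h1 := hmem s hs x
    have h2 := hab (hsub (Ico_subset_Ico_right (min_le_right _ _) h1)) (hχ hx)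
    simp only at h2
    have h3 : b 0 x = B (0, x) := by simp only [hb, timeChange_zero, zero_mul]
    rw [h3]
    have h4 : |e * (b s x - B (0, x)) - |A| * (timeChange ε' s * χ x)| ≤
        |A| / 2 * (timeChange ε' s * χ x) := by
      rw [← heA, mul_assoc, ← mul_sub, abs_mul, he, one_mul, heA]
      exact h2
    linarith [(abs_le.1 h4).1]
  -- The nonnegative gap in `hlow` has derivative `-(|A| / 2) * J < 0` at `0`, since the action is
  -- critical and the time change has derivative `1`: a contradiction.
  have hd1 := (((hcrit _ hK η hvar).sub_const
    (hamiltonianAction vol L (tsupport χ) (η 0))).const_mul e).sub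
    (((hasDerivWithinAt_timeChange hε'0).const_mul (|A| / 2)).mul_const J)
  have h5 := nonneg_of_hasDerivWithinAt_Ici hd1 (by simp [timeChange_zero]) (by
    filter_upwards [self_mem_nhdsWithin] with s hs
    exact sub_nonneg.2 (hlow s hs))
  have h6 : 0 < |A| := abs_pos.2 hA0
  nlinarith [mul_pos h6 hJ0]

end Vertical

/-! ### Critical points of the Hamiltonian action are Legendre lifts -/

section TangentCone

variable {F : Type*} [NormedAddCommGroup F] [NormedSpace ℝ F]

theorem hasDerivWithinAt_rayPoint {Θ : F → F} {w u : F} (hΘ : ContDiffAt ℝ ∞ Θ w) (Z : F →L[ℝ] ℝ) :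
    HasDerivWithinAt (fun r => Z (Θ (rayPoint w u r))) (Z (fderiv ℝ Θ w u)) (Ici 0) 0 := by
  have h1 : HasDerivAt (fun r : ℝ => rayPoint w u r) u 0 := by
    simpa [rayPoint] using ((hasDerivAt_id (0 : ℝ)).smul_const u).const_add w
  have h2 : HasFDerivAt Θ (fderiv ℝ Θ w) (rayPoint w u 0) := by
    rw [rayPoint_zero]
    exact (hΘ.differentiableAt (by simp)).hasFDerivAt
  exact (Z.hasFDerivAt.comp_hasDerivAt (0 : ℝ) (h2.comp_hasDerivAt (0 : ℝ) h1)).hasDerivWithinAt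

theorem exists_hasDerivWithinAt_rayPoint {Θ : F → F} {w u : F} (hΘ : ContDiffAt ℝ ∞ Θ w)
    (Z₁ Z₂ : F →L[ℝ] ℝ) : ∃ A, HasDerivWithinAt
      (fun r => Z₁ (Θ (rayPoint w u r)) - Z₂ (Θ (rayPoint w u r))) A (Ici 0) 0 :=
  ⟨_, (hasDerivWithinAt_rayPoint hΘ Z₁).sub (hasDerivWithinAt_rayPoint hΘ Z₂)⟩

variable [FiniteDimensional ℝ F]

/-- The differential of the straightening map `Ψ` sends a tangent-cone vector `y` into `V`, and that
of `Θ` brings it back; on `V` the functional `Z₁ - Z₂` is controlled by `hZ`. The vector is given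
through `c`, `d` and `l` so that it can be transported from a fibre to the model by `formCoord`. -/
theorem apply_eq_of_tangent {Ψ Θ : F → F} {p₀ : F} (hΨ : ContDiffAt ℝ ∞ Ψ p₀)
    (hΘ : ContDiffAt ℝ ∞ Θ (Ψ p₀)) (hinv : ∀ᶠ p in nhdsNorm p₀, Θ (Ψ p) = p)
    {V : Submodule ℝ F} {S : Set F} (hp₀ : p₀ ∈ S) (hS : ∀ᶠ p in nhdsNorm p₀, p ∈ S → Ψ p ∈ V)
    {Z₁ Z₂ ℓ : F →L[ℝ] ℝ}
    (hZ : ∀ u ∈ V, 0 ≤ ℓ u → HasDerivWithinAt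
      (fun r => Z₁ (Θ (rayPoint (Ψ p₀) u r)) - Z₂ (Θ (rayPoint (Ψ p₀) u r))) 0 (Ici 0) 0)
    {α : Type*} {l : Filter α} [l.NeBot] {c : α → ℝ} {d : α → F} {y : F}
    (hd : Filter.Tendsto d l (nhdsNorm 0)) (hds : ∀ᶠ a in l, p₀ + d a ∈ S)
    (hcd : Filter.Tendsto (fun a => c a • d a) l (nhdsNorm y)) : Z₁ y = Z₂ y := by
  have hy : y ∈ tangentConeAt ℝ S p₀ := mem_tangentConeAt_of_seq l c d hd hds hcd
  have hΨ' : HasFDerivAt Ψ (fderiv ℝ Ψ p₀) p₀ := (hΨ.differentiableAt (by simp)).hasFDerivAt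
  have hΘ' : HasFDerivAt Θ (fderiv ℝ Θ (Ψ p₀)) (Ψ p₀) :=
    (hΘ.differentiableAt (by simp)).hasFDerivAt
  have hid : (fderiv ℝ Θ (Ψ p₀)).comp (fderiv ℝ Ψ p₀) = ContinuousLinearMap.id ℝ F :=
    (hΘ'.comp p₀ hΨ').unique ((hasFDerivAt_id p₀).congr_of_eventuallyEq hinv)
  set v := fderiv ℝ Ψ p₀ y with hv
  have hvy : fderiv ℝ Θ (Ψ p₀) v = y := DFunLike.congr_fun hid y
  -- Any functional vanishing on `V` is zero along `Ψ` on `S`, so its derivative kills tangent-cone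
  -- vectors.
  have hvV : v ∈ V := by
    by_contra hvV
    obtain ⟨f, hfv, hfV⟩ := V.exists_le_ker_of_notMem hvV
    set f' := LinearMap.toContinuousLinearMap f with hf'
    have h1 : HasFDerivWithinAt (fun p => f' (Ψ p)) (f'.comp (fderiv ℝ Ψ p₀)) S p₀ :=
      (f'.hasFDerivAt.comp p₀ hΨ').hasFDerivWithinAt
    have h2 : HasFDerivWithinAt (fun p => f' (Ψ p)) (0 : F →L[ℝ] ℝ) S p₀ := by
      refine (hasFDerivWithinAt_const (0 : ℝ) p₀ S).congr_of_eventuallyEq ?_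
        (hfV (hS.self_of_nhds hp₀))
      filter_upwards [mem_nhdsWithin_of_mem_nhds hS, self_mem_nhdsWithin] with p hp hpS
      exact hfV (hp hpS)
    exact hfv (h1.unique_on h2 hy)
  have hkey : ∀ u ∈ V, 0 ≤ ℓ u →
      Z₁ (fderiv ℝ Θ (Ψ p₀) u) - Z₂ (fderiv ℝ Θ (Ψ p₀) u) = 0 := fun u hu hℓ =>
    (uniqueDiffWithinAt_Ici (0 : ℝ)).eq_deriv _
      ((hasDerivWithinAt_rayPoint hΘ Z₁).sub (hasDerivWithinAt_rayPoint hΘ Z₂)) (hZ u hu hℓ)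
  -- One of `v`, `-v` points into the half-space, and the conclusion is linear.
  rcases le_total 0 (ℓ v) with h | h
  · have := hkey v hvV h
    rw [hvy] at this
    exact sub_eq_zero.1 this
  · have := hkey (-v) (V.neg_mem hvV) (by rw [map_neg]; exact neg_nonneg.2 h)
    rw [map_neg, hvy, map_neg, map_neg] at this
    linarith

end TangentCone

/-! ### Tangent cones of the fibres of `M`, read in coordinates. -/

section Contact

variable {n k : ℕ} {N : Type*} [TopologicalSpace N]
  [ChartedSpace (EuclideanSpace ℝ (Fin (n + k))) N] [IsManifold (𝓡 (n + k)) ∞ N]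
  {vol : ∀ q : N, FormFiber n k N q} {L : MultiVecBundle n k N → ℝ} {M : Set (FormBundle n k N)}

theorem tendsto_formCoord (q : N) (p₀ : FormFiber n k N q) :
    Filter.Tendsto (fun p : FormFiber n k N q => formCoord q ⟨q, p⟩) (𝓝 p₀)
      (nhdsNorm (formCoord q ⟨q, p₀⟩)) := by
  have h1 : Continuous (fun p : FormFiber n k N q => (⟨q, p⟩ : FormBundle n k N)) :=
    FiberBundle.continuous_totalSpaceMk (FormModel n k) (FormFiber n k N) q
  have h2 : ContinuousAt (trivializationAt (FormModel n k) (FormFiber n k N) q) ⟨q, p₀⟩ :=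
    (trivializationAt (FormModel n k) (FormFiber n k N) q).continuousAt
      ((Trivialization.mem_source _).2 (FiberBundle.mem_baseSet_trivializationAt' q))
  exact (continuous_snd.continuousAt.comp h2).comp h1.continuousAt

theorem contMDiffAt_form_const {E' H' A : Type*} [NormedAddCommGroup E'] [NormedSpace ℝ E']
    [TopologicalSpace H'] {I' : ModelWithCorners ℝ E' H'} [TopologicalSpace A]
    [ChartedSpace H' A] {s : Set A} {a : A} {m : ℕ∞ω} [ENat.LEInfty m] (q : N)
    {c : A → FormModel n k} (hc : ContMDiffWithinAt I' 𝓘(ℝ, FormModel n k) m c s a) :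
    ContMDiffWithinAt I' (formI n k) m
      (fun t => (⟨q, formOfCoord q q (c t)⟩ : FormBundle n k N)) s a := by
  have hs := mem_chart_source (EuclideanSpace ℝ (Fin (n + k))) q
  refine (contMDiffWithinAt_form_iff (q₀ := q) hs).2 ⟨contMDiffWithinAt_const, ?_⟩
  simpa only [formCoord_formOfCoord hs] using hc

theorem mk_formOfCoord_formCoord {q : N} {μ : FormBundle n k N} (h : μ.proj = q) :
    (⟨q, formOfCoord q q (formCoord q μ)⟩ : FormBundle n k N) = μ := by
  subst h
  exact congrArg _ (formOfCoord_formCoord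
    (mem_chart_source (EuclideanSpace ℝ (Fin (n + k))) μ.proj) μ.2)

theorem formCoord_add (q₀ q : N) (p p' : FormFiber n k N q) :
    formCoord q₀ ⟨q, p + p'⟩ = formCoord q₀ ⟨q, p⟩ + formCoord q₀ ⟨q, p'⟩ := by
  ext v
  change formCoord q₀ ⟨q, p + p'⟩ v = formCoord q₀ ⟨q, p⟩ v + formCoord q₀ ⟨q, p'⟩ v
  simp only [formCoord_apply]
  rfl

theorem formCoord_smul (q₀ q : N) (c : ℝ) (p : FormFiber n k N q) :
    formCoord q₀ ⟨q, c • p⟩ = c • formCoord q₀ ⟨q, p⟩ := by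
  ext v
  change formCoord q₀ ⟨q, c • p⟩ v = c * formCoord q₀ ⟨q, p⟩ v
  simp only [formCoord_apply]
  rfl

theorem formCoord_zero (q₀ q : N) : formCoord q₀ (⟨q, 0⟩ : FormBundle n k N) = 0 := by
  ext v
  rw [formCoord_apply]
  rfl

theorem mvCoord_eq_of_mem_tangentConeAt {q : N} {p₀ : FormFiber n k N q}
    {Z₁ Z₂ : MultiVecModel n k} {Ψ Θ : FormModel n k → FormModel n k}
    (hΨ : ContDiffAt ℝ ∞ Ψ (formCoord q ⟨q, p₀⟩))
    (hΘ : ContDiffAt ℝ ∞ Θ (Ψ (formCoord q ⟨q, p₀⟩)))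
    (hinv : ∀ᶠ p in nhdsNorm (formCoord q ⟨q, p₀⟩), Θ (Ψ p) = p)
    (hp₀ : (⟨q, p₀⟩ : FormBundle n k N) ∈ M) {V : Submodule ℝ (FormModel n k)}
    (hS : ∀ᶠ p in nhdsNorm (formCoord q ⟨q, p₀⟩),
      (⟨q, formOfCoord q q p⟩ : FormBundle n k N) ∈ M → Ψ p ∈ V)
    {ℓ : FormModel n k →L[ℝ] ℝ}
    (hZ : ∀ u ∈ V, 0 ≤ ℓ u → HasDerivWithinAt
      (fun r => Z₁ (Θ (rayPoint (Ψ (formCoord q ⟨q, p₀⟩)) u r)) -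
        Z₂ (Θ (rayPoint (Ψ (formCoord q ⟨q, p₀⟩)) u r))) 0 (Ici 0) 0)
    {p' : FormFiber n k N q} (hp' : p' ∈
      tangentConeAt ℝ {p : FormFiber n k N q | (⟨q, p⟩ : FormBundle n k N) ∈ M} p₀) :
    Z₁ (formCoord q ⟨q, p'⟩) = Z₂ (formCoord q ⟨q, p'⟩) := by
  obtain ⟨α, l, hl, c, d, hd, hds, hcd⟩ := exists_fun_of_mem_tangentConeAt hp'
  have hs := mem_chart_source (EuclideanSpace ℝ (Fin (n + k))) q
  refine apply_eq_of_tangent hΨ hΘ hinv (c := c) (d := fun a => formCoord q ⟨q, d a⟩) (l := l)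
    (S := {p | (⟨q, formOfCoord q q p⟩ : FormBundle n k N) ∈ M}) ?_ hS hZ ?_ ?_ ?_
  · change (⟨q, formOfCoord q q (formCoord q ⟨q, p₀⟩)⟩ : FormBundle n k N) ∈ M
    rwa [formOfCoord_formCoord hs]
  · have h1 := (tendsto_formCoord q (0 : FormFiber n k N q)).comp hd
    rwa [formCoord_zero] at h1
  · filter_upwards [hds] with a ha
    change (⟨q, formOfCoord q q (formCoord q ⟨q, p₀⟩ + formCoord q ⟨q, d a⟩)⟩ :
      FormBundle n k N) ∈ M
    rw [← formCoord_add, formOfCoord_formCoord hs]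
    exact ha
  · refine ((tendsto_formCoord q p').comp hcd).congr fun a => ?_
    exact formCoord_smul q q (c a) (d a)

end Contact

/-! ### Criticality of the Hamiltonian action forces contact. -/

section ContactOfCritical

variable {n k : ℕ} {N : Type*} [TopologicalSpace N]
  [ChartedSpace (EuclideanSpace ℝ (Fin (n + k))) N] [IsManifold (𝓡 (n + k)) ∞ N]
  {X : Type*} [TopologicalSpace X] [ChartedSpace (EuclideanSpace ℝ (Fin n)) X]
  [IsManifold (𝓡 n) ∞ X] [T2Space X] [SigmaCompactSpace X]
  {vol : ∀ q : N, FormFiber n k N q} {L : MultiVecBundle n k N → ℝ} {M : Set (FormBundle n k N)}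
  {γ : X → FormBundle n k N} {x₀ : X}

/-- Along a vertical family the first variation of the Hamiltonian density is the pairing of
`z - ζ₀`, for any `ζ₀ ∈ Z_q(p)`, with the velocity. -/
theorem IsPartialLift.hasDerivWithinAt_vertical (hn : 1 ≤ n) (hvol : IsSpaceTimeVolume vol)
    (hL : IsLagrangian vol L) (hM : LegendreCorrespondenceHypothesis vol L M)
    {K : Set X} {φ : X → ℝ} {ε : ℝ} {σ : ℝ → X → FormBundle n k N}
    (hσ : IsPartialLift M K γ (fun _ x => (γ x).proj) φ ε σ) (hε : 0 < ε)
    {ζ₀ : MultiVecFiber n k N (γ x₀).proj} (hζ₀ : ζ₀ ∈ legendreZ vol L (γ x₀).proj (γ x₀).2)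
    {A : ℝ} (hA : HasDerivWithinAt (fun r =>
      mvCoord (γ x₀).proj ⟨(γ x₀).proj, tangentMultiVec vol (fun x => (γ x).proj) x₀⟩
        (formCoord (γ x₀).proj (σ r x₀)) -
      mvCoord (γ x₀).proj ⟨(γ x₀).proj, ζ₀⟩ (formCoord (γ x₀).proj (σ r x₀))) A (Ici 0) 0) :
    HasDerivWithinAt (fun r =>
      (tangentMultiVec vol (fun x => (σ r x).proj) x₀ (σ r x₀).2 : ℝ) -
        hamiltonian vol L (σ r x₀)) A (Ici 0) 0 := by
  have h0 : (0 : ℝ) ∈ Ico 0 ε := ⟨le_rfl, hε⟩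
  have hs := mem_chart_source (EuclideanSpace ℝ (Fin (n + k))) (γ x₀).proj
  have hmk : ∀ r ∈ Ico 0 ε,
      (⟨(γ x₀).proj, formOfCoord (γ x₀).proj (γ x₀).proj (formCoord (γ x₀).proj (σ r x₀))⟩ : FormBundle n k N) = σ r x₀ :=
    fun r hr => mk_formOfCoord_formCoord (hσ.proj_eq r hr x₀)
  have hp : ContMDiffWithinAt 𝓘(ℝ, ℝ) (formI n k) 1 (fun r =>
      (⟨(γ x₀).proj, formOfCoord (γ x₀).proj (γ x₀).proj (formCoord (γ x₀).proj (σ r x₀))⟩ : FormBundle n k N)) (Ico 0 ε) 0 := by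
    have h1 : ContMDiffWithinAt 𝓘(ℝ, ℝ) (formI n k) 1 (fun r => σ r x₀) (Ico 0 ε) 0 :=
      (contMDiffWithinAt_curve (hσ.smooth (0, x₀) ⟨h0, mem_univ _⟩)).of_le (by simp)
    exact h1.congr_of_mem hmk h0
  have hp0 : formOfCoord (γ x₀).proj (γ x₀).proj (formCoord (γ x₀).proj (σ 0 x₀)) = (γ x₀).2 := by
    rw [hσ.init]
    exact formOfCoord_formCoord hs (γ x₀).2
  -- With `ζ₀` held fixed, `W(q, ζ₀, p) - ℋ(q, p)` has derivative zero. The density `⟨z, p⟩ - ℋ` is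
  -- this plus `⟨z - ζ₀, p⟩` plus the constant `L(q, ζ₀)`.
  have hD := hasDerivWithinAt_pontryaginW_sub_hamiltonian hn hvol hL hM h0 (q := fun _ => (γ x₀).proj)
    (z := fun _ => ζ₀) contMDiffWithinAt_const hp
    (Filter.Eventually.of_forall fun _ => hζ₀.1)
    (by
      filter_upwards [self_mem_nhdsWithin] with r hr
      rw [hmk r hr]
      exact hσ.mem r hr x₀)
    (by rw [hp0]; exact hζ₀)
  have hsum := ((hA.mono (t := Ici 0) (s := Ico 0 ε) fun r hr => hr.1).add hD).add_const
    (L ⟨(γ x₀).proj, ζ₀⟩)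
  rw [add_zero] at hsum
  refine (hsum.congr_of_mem (fun r hr => ?_) h0).mono_of_mem_nhdsWithin (Ico_mem_nhdsGE hε)
  have h1 : (tangentMultiVec vol (fun x => (σ r x).proj) x₀ (σ r x₀).2 : ℝ) =
      mvCoord (γ x₀).proj ⟨(γ x₀).proj, tangentMultiVec vol (fun x => (γ x).proj) x₀⟩ (formCoord (γ x₀).proj (σ r x₀)) := by
    have h2 := tangentMultiVec_apply_congr (vol := vol) (x := x₀) (p₁ := (σ r x₀).2)
      (p₂ := formOfCoord (γ x₀).proj (γ x₀).proj (formCoord (γ x₀).proj (σ r x₀))) (funext (hσ.proj_eq r hr)) (hmk r hr).symm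
    exact h2.trans (mvCoord_apply hs _ _).symm
  have h3 : mvCoord (γ x₀).proj ⟨(γ x₀).proj, ζ₀⟩ (formCoord (γ x₀).proj (σ r x₀)) =
      (ζ₀ (formOfCoord (γ x₀).proj (γ x₀).proj (formCoord (γ x₀).proj (σ r x₀))) : ℝ) := mvCoord_apply hs _ _
  have h4 : hamiltonian vol L ⟨(γ x₀).proj, formOfCoord (γ x₀).proj (γ x₀).proj (formCoord (γ x₀).proj (σ r x₀))⟩ =
      hamiltonian vol L (σ r x₀) := congrArg _ (hmk r hr)
  simp only [Pi.add_apply, h1, h3, h4, pontryaginW]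
  ring

/-- Vertical variations show that `z - ζ₀` annihilates `T_pM_q`, where `z` is the tangent
multivector and `ζ₀ ∈ Z_q(p)`; the orthogonality clause then gives `z ∈ Z_q(p)`. -/
theorem IsCriticalPoint.isLegendreLift (hn : 1 ≤ n) (hvol : IsSpaceTimeVolume vol)
    (hL : IsLagrangian vol L) (hM : LegendreCorrespondenceHypothesis vol L M)
    (hγ : IsOmegaSubmanifoldLift vol M γ)
    (hcrit : IsCriticalPoint n (formI n k) M (hamiltonianAction vol L) γ) :
    IsLegendreLift vol L M (fun x => (γ x).proj) γ := by
  refine ⟨hγ, fun _ => rfl, fun x₀ => ?_⟩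
  set q := (γ x₀).proj with hq
  set z : MultiVecFiber n k N q := tangentMultiVec vol (fun x => (γ x).proj) x₀ with hz
  have hs := mem_chart_source (EuclideanSpace ℝ (Fin (n + k))) q
  obtain ⟨ζ₀, hζ₀⟩ := (hM.connected (γ x₀) (hγ.mem x₀)).nonempty
  suffices h : z ∈ legendreZ vol L (γ x₀).proj (γ x₀).2 from h.2
  rw [hM.orthogonal (γ x₀) (hγ.mem x₀) ζ₀ hζ₀]
  refine ⟨tangentMultiVec_mem_DOmega (g := fun x => (γ x).proj) hn
    (hγ.pullbackForm_proj_ne_zero x₀), ?_⟩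
  obtain ⟨m, -, hfib⟩ := hM.fibred
  obtain ⟨Φ, V, ℓ, hsrc, -, hΦ, hΦs, hΦM⟩ := hfib (γ x₀) (hγ.mem x₀)
  set p₀ := formCoord q ⟨q, (γ x₀).2⟩ with hp₀
  have hpt : (⟨q, formOfCoord q q p₀⟩ : FormBundle n k N) = γ x₀ :=
    congrArg _ (formOfCoord_formCoord hs (γ x₀).2)
  have hmk : ContMDiffAt 𝓘(ℝ, FormModel n k) (formI n k) ∞
      (fun p => (⟨q, formOfCoord q q p⟩ : FormBundle n k N)) p₀ :=
    contMDiffAt_form_const q contMDiffWithinAt_id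
  -- The fibred chart restricted to the fibre over `q`, with inverse `Θ`.
  set Ψ : FormModel n k → FormModel n k := fun p => (Φ ⟨q, formOfCoord q q p⟩).2 with hΨ
  set Θ : FormModel n k → FormModel n k := fun w => formCoord q (Φ.symm (q, w)) with hΘ
  have hΨ0 : Ψ p₀ = (Φ (γ x₀)).2 := by simp only [hΨ, hpt]
  have hpair : (q, Ψ p₀) = Φ (γ x₀) := Prod.ext (hΦM _ hsrc).1.symm hΨ0
  have hΨs : ContDiffAt ℝ ∞ Ψ p₀ := by
    rw [← contMDiffAt_iff_contDiffAt]
    have h1 : ContMDiffAt (formI n k) (formI n k) ∞ Φ (⟨q, formOfCoord q q p₀⟩) := by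
      rw [hpt]
      exact hΦ.contMDiffAt (Φ.open_source.mem_nhds hsrc)
    exact contMDiff_snd.contMDiffAt.comp p₀ (h1.comp p₀ hmk)
  have hΘs : ContDiffAt ℝ ∞ Θ (Ψ p₀) := by
    rw [← contMDiffAt_iff_contDiffAt]
    have h1 : ContMDiffAt (formI n k) (formI n k) ∞ Φ.symm (q, Ψ p₀) := by
      rw [hpair]
      exact hΦs.contMDiffAt (Φ.open_target.mem_nhds (Φ.map_source hsrc))
    have h2 : ContMDiffAt 𝓘(ℝ, FormModel n k) (formI n k) ∞
        (fun w : FormModel n k => (q, w)) (Ψ p₀) := contMDiffAt_const.prodMk contMDiffAt_id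
    have h3 : ContMDiffAt 𝓘(ℝ, FormModel n k) (formI n k) ∞
        (fun w : FormModel n k => Φ.symm (q, w)) (Ψ p₀) := h1.comp (Ψ p₀) h2
    refine contMDiffWithinAt_univ.1 ((contMDiffWithinAt_form_iff (q₀ := q) ?_).1
      (contMDiffWithinAt_univ.2 h3)).2
    rw [hpair, Φ.left_inv hsrc]
    exact hs
  have hnear : ∀ᶠ p in nhdsNorm p₀, (⟨q, formOfCoord q q p⟩ : FormBundle n k N) ∈ Φ.source :=
    hmk.continuousAt.preimage_mem_nhds (Φ.open_source.mem_nhds (by rw [hpt]; exact hsrc))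
  have hinv : ∀ᶠ p in nhdsNorm p₀, Θ (Ψ p) = p := by
    filter_upwards [hnear] with p hp
    have h1 : (q, Ψ p) = Φ ⟨q, formOfCoord q q p⟩ := Prod.ext (hΦM _ hp).1.symm rfl
    simp only [hΘ, h1, Φ.left_inv hp, formCoord_formOfCoord hs]
  have hS : ∀ᶠ p in nhdsNorm p₀,
      (⟨q, formOfCoord q q p⟩ : FormBundle n k N) ∈ M → Ψ p ∈ V := by
    filter_upwards [hnear] with p hp hpM using ((hΦM _ hp).2.1 hpM).1
  have hZ : ∀ u ∈ V, 0 ≤ ℓ u → HasDerivWithinAt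
      (fun r => mvCoord q ⟨q, z⟩ (Θ (rayPoint (Ψ p₀) u r)) -
        mvCoord q ⟨q, ζ₀⟩ (Θ (rayPoint (Ψ p₀) u r))) 0 (Ici 0) 0 := by
    intro u hu hℓu
    obtain ⟨K, φ, ε, σ, hε, hσ, hσx⟩ :=
      exists_vertical_lift hγ.smooth hγ.mem hsrc hΦ hΦs hΦM hu hℓu
    -- The derivative exists by smoothness of `Θ`; it is also the first variation of the density at
    -- `x₀`, so criticality makes it zero.
    obtain ⟨A, hA⟩ := exists_hasDerivWithinAt_rayPoint (u := u) hΘs (mvCoord q ⟨q, z⟩)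
      (mvCoord q ⟨q, ζ₀⟩)
    have hA' : HasDerivWithinAt (fun r => mvCoord q ⟨q, z⟩ (formCoord q (σ r x₀)) -
        mvCoord q ⟨q, ζ₀⟩ (formCoord q (σ r x₀))) A (Ici 0) 0 := by
      refine ((hA.mono (s := Ico 0 ε) fun r hr => hr.1).congr_of_mem (fun r hr => ?_)
        ⟨le_rfl, hε⟩).mono_of_mem_nhdsWithin (Ico_mem_nhdsGE hε)
      rw [hσx r hr, hΨ0]
    have hA0 : A = 0 := hσ.vertical_deriv_eq_zero hn hvol hL hM hγ hcrit hε
      (hσ.hasDerivWithinAt_vertical hn hvol hL hM hε hζ₀ hA')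
    rwa [hA0] at hA
  intro p' hp'
  change (z p' : ℝ) - ζ₀ p' = 0
  rw [sub_eq_zero]
  -- `T_pM_q` is the span of the tangent cone, and the condition is linear.
  refine Submodule.span_induction (p := fun p _ => (z p : ℝ) = ζ₀ p) (fun p hp => ?_) ?_ ?_ ?_ hp'
  · have h1 := mvCoord_eq_of_mem_tangentConeAt hΨs hΘs hinv (hγ.mem x₀) hS hZ hp
    rwa [mvCoord_pairing hs, mvCoord_pairing hs] at h1
  · simp only [map_zero]
  · intro p₁ p₂ _ _ h1 h2
    rw [map_add, map_add, h1, h2]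
  · intro c p _ h1
    rw [map_smul, map_smul, h1]

end ContactOfCritical

end LepageDedecker

end

/-! ### The two assertions. -/

theorem mainTheorem1 {n k : ℕ} (hn : 1 ≤ n) (hk : 1 ≤ k)
    {N : Type*} [TopologicalSpace N] [T2Space N]
    [ChartedSpace (EuclideanSpace ℝ (Fin (n + k))) N] [IsManifold (𝓡 (n + k)) ∞ N]
    (vol : ∀ q : N, LepageDedecker.FormFiber n k N q) (hvol : LepageDedecker.IsSpaceTimeVolume vol)
    (L : LepageDedecker.MultiVecBundle n k N → ℝ) (hL : LepageDedecker.IsLagrangian vol L)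
    (M : Set (LepageDedecker.FormBundle n k N))
    (hM : LepageDedecker.LegendreCorrespondenceHypothesis vol L M)
    {X : Type*} [TopologicalSpace X] [T2Space X] [SigmaCompactSpace X]
    [ChartedSpace (EuclideanSpace ℝ (Fin n)) X] [IsManifold (𝓡 n) ∞ X] :
    (∀ g : X → N, LepageDedecker.IsOmegaSubmanifold vol g →
      ∀ γ : X → LepageDedecker.FormBundle n k N, LepageDedecker.IsLegendreLift vol L M g γ →
        (LepageDedecker.IsCriticalPoint n (𝓡 (n + k)) univ
            (LepageDedecker.lagrangianAction vol L) g ↔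
          LepageDedecker.IsCriticalPoint n (LepageDedecker.formI n k) M
            (LepageDedecker.hamiltonianAction vol L) γ)) ∧
    (∀ γ : X → LepageDedecker.FormBundle n k N, LepageDedecker.IsOmegaSubmanifoldLift vol M γ →
      LepageDedecker.IsCriticalPoint n (LepageDedecker.formI n k) M
        (LepageDedecker.hamiltonianAction vol L) γ →
      LepageDedecker.IsLegendreLift vol L M (fun x => (γ x).proj) γ ∧
        LepageDedecker.IsOmegaSubmanifold vol (fun x => (γ x).proj) ∧
        LepageDedecker.IsCriticalPoint n (𝓡 (n + k)) univ
          (LepageDedecker.lagrangianAction vol L) (fun x => (γ x).proj)) := by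
  refine ⟨fun g _ γ hγ => ?_, fun γ hγ hcrit => ?_⟩
  · obtain rfl : g = fun x => (γ x).proj := funext fun x => (hγ.proj_eq x).symm
    exact hγ.isCriticalPoint_iff hn hvol hL hM
  · have hlift := LepageDedecker.IsCriticalPoint.isLegendreLift hn hvol hL hM hγ hcrit
    exact ⟨hlift,
      ⟨LepageDedecker.contMDiff_formProj.comp hγ.smooth, hγ.pullbackForm_proj_ne_zero⟩,
      (hlift.isCriticalPoint_iff hn hvol hL hM).2 hcrit⟩
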